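/- All graphs are finite, simple and undirected. A graph is $k$-connected if it has more than $k$ vertices and remains connected after the deletion of any fewer than $k$ vertices. A graph is uniquely hamiltonian if it has exactly one hamiltonian cycle (cycles being identified with their edge sets). Let $d\ge 4$. A $d$-seed is a graph $G=(V,E)$ with vertices $s,t\in V$ such that: the maximum degree of $G$ is $4$; there are exactly $d-2$ vertices of degree $3$, among them $s$; $t$ is the unique vertex of degree $2$; there is exactly one hamiltonian path from $s$ to $t$ in $G$; and the following graph is $3$-connected: add to $G$ a new vertex $v$ adjacent to $t$ and to all vertices of degree $3$ (in $G$) except $s$, and then a further new vertex $v'$ adjacent to $v$, $s$ and $t$. A graph $G$ realizes a finite set $M\subset\mathbb N$ if $G$ is uniquely hamiltonian, $\{\deg(w) : w\in V(G)\}=M$, and $G$ is $2$-connected if $2\in M$ and $3$-connected if $2\notin M$. A finite set $M=\{d_0,d_1,\dots,d_k\}\subset\mathbb N$ with $k\ge 1$ and $d_0<d_1<\dots<d_k$ is strongly uhc-realizable if for every partition of $\{d_1,\dots,d_k\}$ into two sets $D_1,D_2$ (one of them possibly empty) there are constants $c_1\in\mathbb N$ and $c_2\in\mathbb R$, $c_2>0$,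 and an infinite sequence of pairwise non-isomorphic graphs $G_i=(V_i,E_i)$ realizing $M$ such that, for every $i$, $G_i$ has at most $c_1$ vertices of degree $d$ for each $d\in D_1$ and at least $c_2|V_i|$ vertices of degree $d'$ for each $d'\in D_2$. **Corollary.** There is a $3$-connected uniquely hamiltonian $4$-regular graph if and only if there is a $4$-seed. In that case there are infinitely many pairwise non-isomorphic $3$-connected uniquely hamiltonian $4$-regular graphs, and every finite set $M$ of natural numbers $d\ge 2$ with $4\in M$ and $|M|\ge 2$ is strongly uhc-realizable. -/

import Mathlib

/-- `G` is `k`-connected: it has more than `k` vertices, and it stays connected whenever fewer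
than `k` vertices are deleted. -/
def IsKConnected {V : Type*} [Fintype V] (k : ℕ) (G : SimpleGraph V) : Prop :=
  k < Fintype.card V ∧ ∀ S : Finset V, S.card < k → (G.induce ((S : Set V)ᶜ)).Connected

open scoped Classical in
/-- `G` has exactly one hamiltonian cycle. A hamiltonian cycle is identified with its set of edges,
so that the choice of a starting vertex and of a direction does not matter. -/
def IsUniquelyHamiltonian {V : Type*} (G : SimpleGraph V) : Prop :=
  ∃! C : Set (Sym2 V), ∃ (a : V) (p : G.Walk a a), p.IsHamiltonianCycle ∧ {e | e ∈ p.edges} = C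

open scoped Classical in
/-- The set of vertices of `G` that have degree `d`. -/
noncomputable def verticesOfDegree {V : Type*} [Fintype V] (G : SimpleGraph V) (d : ℕ) :
    Finset V :=
  {v | G.degree v = d}

open scoped Classical in
/-- The degree set of `G`, that is, the set of all degrees of vertices of `G`. -/
def degreeSet {V : Type*} [Fintype V] (G : SimpleGraph V) : Set ℕ :=
  Set.range fun v => G.degree v

/-- `G` realizes the finite set `M`: it is uniquely hamiltonian, its degree set is `M`, and it is
2-connected if `2 ∈ M` and 3-connected otherwise. -/
def Realizes {V : Type*} [Fintype V] (G : SimpleGraph V) (M : Finset ℕ) : Prop :=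
  degreeSet G = (M : Set ℕ) ∧ IsUniquelyHamiltonian G ∧
    IsKConnected (if 2 ∈ M then 2 else 3) G

/-- `M`, a finite set with at least two elements and least element `d₀`, is strongly
uhc-realizable: for every partition of `M \ {d₀}` into `D₁` and `D₂` (one of them possibly empty)
there are `c₁ ∈ ℕ`, a real `c₂ > 0` and an infinite sequence of pairwise non-isomorphic finite
graphs realizing `M`, in each of which every degree in `D₁` occurs at most `c₁` times and
every degree in `D₂` occurs at least `c₂ |V|` times. -/
def IsStronglyUhcRealizable (M : Finset ℕ) : Prop :=
  1 < M.card ∧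
  ∀ d₀ : ℕ, IsLeast (M : Set ℕ) d₀ →
    ∀ D₁ D₂ : Finset ℕ, Disjoint D₁ D₂ → D₁ ∪ D₂ = M.erase d₀ →
      ∃ (c₁ : ℕ) (c₂ : ℝ), 0 < c₂ ∧
        ∃ (V : ℕ → Type) (_ : ∀ i, Fintype (V i)) (G : ∀ i, SimpleGraph (V i)),
          (∀ i, Realizes (G i) M) ∧
          (∀ i j, i ≠ j → IsEmpty (G i ≃g G j)) ∧
          (∀ i, ∀ d ∈ D₁, (verticesOfDegree (G i) d).card ≤ c₁) ∧
          (∀ i, ∀ d ∈ D₂,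
            c₂ * (Fintype.card (V i) : ℝ) ≤ ((verticesOfDegree (G i) d).card : ℝ))

/-- The graph obtained from `G` by adding one new vertex, `none`, and connecting it to exactly the
vertices in `A`. -/
def addVertex {V : Type*} (G : SimpleGraph V) (A : Set V) : SimpleGraph (Option V) where
  Adj
    | some a, some b => G.Adj a b
    | some a, none => a ∈ A
    | none, some b => b ∈ A
    | none, none => False
  symm := ⟨by
    rintro (_ | a) (_ | b) h
    · exact h
    · exact h
    · exact h
    · exact SimpleGraph.Adj.symm h⟩
  loopless := ⟨by
    rintro (_ | a) h
    · exact h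
    · exact G.loopless.irrefl a h⟩

open scoped Classical in
/-- The graph `W(G)`: a new vertex `v = none` is added to `G` and connected to `t` and to all
vertices of degree 3 except `s`. -/
def seedExtension {V : Type*} [Fintype V] (G : SimpleGraph V) (s t : V) :
    SimpleGraph (Option V) :=
  addVertex G {w | w = t ∨ (w ≠ s ∧ G.degree w = 3)}

open scoped Classical in
/-- `G` with the vertices `s` and `t` is a `d`-seed: the maximum degree is 4; there are exactly
`d - 2 ≥ 2` vertices of degree 3, and `s` is one of them; `t` is the only vertex of degree 2;
there is exactly one hamiltonian path from `s` to `t`; and `W(G)` together with a new vertex `v'`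
connected to `v`, `s` and `t` is 3-connected. -/
structure IsSeed {V : Type*} [Fintype V] (d : ℕ) (G : SimpleGraph V) (s t : V) : Prop where
  maxDegree_eq : G.maxDegree = 4
  four_le : 4 ≤ d
  card_degree_three : (verticesOfDegree G 3).card = d - 2
  degree_s : G.degree s = 3
  degree_eq_two_iff : ∀ v, G.degree v = 2 ↔ v = t
  unique_path : ∃! p : G.Walk s t, p.IsHamiltonian
  connected : IsKConnected 3 (addVertex (seedExtension G s t) {none, some s, some t})

/-- There is a (finite) `d`-seed. -/
def ExistsSeed (d : ℕ) : Prop :=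
  ∃ (V : Type) (_ : Fintype V) (G : SimpleGraph V) (s t : V), IsSeed d G s t

open scoped Classical in
/-- `G` is a 3-connected uniquely hamiltonian 4-regular graph. -/
def IsThreeConnectedUH4Regular {V : Type*} [Fintype V] (G : SimpleGraph V) : Prop :=
  IsKConnected 3 G ∧ IsUniquelyHamiltonian G ∧ G.IsRegularOfDegree 4

namespace UniqHam

open SimpleGraph

variable {V W X : Type*}

/-! ### Degrees, reachability and deletion of vertices -/

/-- The degree of a vertex, as the cardinality of the neighbor set. -/
noncomputable def deg (G : SimpleGraph V) (v : V) : ℕ := (G.neighborSet v).ncard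

lemma degree_eq_deg (G : SimpleGraph V) (v : V) [Fintype (G.neighborSet v)] :
    G.degree v = deg G v := by
  rw [deg, ← Nat.card_coe_set_eq, Nat.card_eq_fintype_card, card_neighborSet_eq_degree]

lemma deg_eq_two_iff {G : SimpleGraph V} {v : V} :
    deg G v = 2 ↔ ∃ p q, p ≠ q ∧ ∀ w, G.Adj v w ↔ w = p ∨ w = q := by
  rw [deg, Set.ncard_eq_two]
  simp [Set.ext_iff]

lemma deg_eq_two {G : SimpleGraph V} {v p q : V} (h : p ≠ q)
    (hv : ∀ w, G.Adj v w ↔ w = p ∨ w = q) : deg G v = 2 :=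
  deg_eq_two_iff.2 ⟨p, q, h, hv⟩

lemma adj_iff_of_deg_eq_two {G : SimpleGraph V} {v p q : V} (h : deg G v = 2) (hpq : p ≠ q)
    (hp : G.Adj v p) (hq : G.Adj v q) (w : V) : G.Adj v w ↔ w = p ∨ w = q := by
  obtain ⟨a, b, -, hw⟩ := deg_eq_two_iff.1 h
  rw [hw] at hp hq ⊢
  grind

lemma exists_adj_of_deg_ne_zero {G : SimpleGraph V} {v : V} (h : deg G v ≠ 0) :
    ∃ w, G.Adj v w := by
  by_contra! hc
  apply h
  rw [deg, show G.neighborSet v = ∅ from Set.eq_empty_iff_forall_notMem.2 hc, Set.ncard_empty]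

lemma deg_ne_zero [Finite V] {G : SimpleGraph V} {v w : V} (h : G.Adj v w) : deg G v ≠ 0 := by
  rw [deg, Ne, Set.ncard_eq_zero (Set.toFinite _)]
  exact Set.nonempty_iff_ne_empty.1 ⟨w, h⟩

/-- If all vertices but one have even degree, then so does the remaining one. -/
lemma even_deg_of_forall_ne [Finite V] (G : SimpleGraph V) (u : V)
    (h : ∀ v, v ≠ u → Even (deg G v)) : Even (deg G u) := by
  classical
  have := Fintype.ofFinite V
  have hs := G.sum_degrees_eq_twice_card_edges
  rw [← Finset.add_sum_erase _ _ (Finset.mem_univ u)] at hs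
  have h2 : Even (∑ v ∈ Finset.univ.erase u, G.degree v) :=
    Finset.even_sum _ fun v hv => by
      rw [degree_eq_deg]; exact h v (Finset.ne_of_mem_erase hv)
  have h3 : Even (G.degree u + ∑ v ∈ Finset.univ.erase u, G.degree v) := hs ▸ even_two_mul _
  rw [← degree_eq_deg G u]
  exact (Nat.even_add.1 h3).2 h2

/-- A map that sends edges to pairs of connected vertices preserves reachability. -/
lemma reachable_map {G : SimpleGraph V} {H : SimpleGraph W} (f : V → W)
    (h : ∀ v w, G.Adj v w → H.Reachable (f v) (f w)) {v w : V} (hr : G.Reachable v w) :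
    H.Reachable (f v) (f w) := by
  obtain ⟨p⟩ := hr
  induction p with
  | nil => exact Reachable.refl _
  | cons h' _ ih => exact (h _ _ h').trans ih

/-- A set of vertices without edges to its complement is closed under reachability. -/
lemma mem_of_reachable {G : SimpleGraph V} (S : Set V)
    (h : ∀ v w, G.Adj v w → v ∈ S → w ∈ S) {v w : V} (hr : G.Reachable v w) (hv : v ∈ S) :
    w ∈ S := by
  obtain ⟨p⟩ := hr
  induction p with
  | nil => exact hv
  | cons h' _ ih => exact ih (h _ _ h' hv)

/-- If a vertex in the image of `f` is connected to a vertex outside of it, then it is connected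
inside the image to a vertex with a neighbor outside of it. -/
lemma exists_exit (H : SimpleGraph W) (G : SimpleGraph X) (f : X → W)
    (hG : ∀ x y, H.Adj (f x) (f y) → G.Adj x y) {x : X} {w : W}
    (hr : H.Reachable (f x) w) (hw : w ∉ Set.range f) :
    ∃ y, G.Reachable x y ∧ ∃ z ∉ Set.range f, H.Adj (f y) z := by
  obtain ⟨p⟩ := hr
  generalize hv : f x = v at p
  induction p generalizing x with
  | nil => exact absurd ⟨x, hv⟩ hw
  | @cons a b c h' q ih =>
    subst hv
    by_cases hb : b ∈ Set.range f
    · obtain ⟨y, rfl⟩ := hb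
      obtain ⟨z, hz, h⟩ := ih hw rfl
      exact ⟨z, (hG _ _ h').reachable.trans hz, h⟩
    · exact ⟨x, Reachable.refl _, b, hb, h'⟩

/-- `G` with all edges at vertices in `S` removed. -/
def del (G : SimpleGraph V) (S : Set V) : SimpleGraph V where
  Adj v w := G.Adj v w ∧ v ∉ S ∧ w ∉ S
  symm := ⟨fun _ _ h => ⟨h.1.symm, h.2.2, h.2.1⟩⟩
  loopless := ⟨fun _ h => G.loopless.irrefl _ h.1⟩

lemma induce_reachable_iff {G : SimpleGraph V} {S : Set V} {v w : V} (hv : v ∉ S) (hw : w ∉ S) :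
    (G.induce Sᶜ).Reachable ⟨v, hv⟩ ⟨w, hw⟩ ↔ (del G S).Reachable v w := by
  constructor
  · exact reachable_map (Subtype.val : ↥Sᶜ → V)
      fun a b h => Adj.reachable (G := del G S) ⟨h, a.2, b.2⟩
  · intro h
    classical
    have := reachable_map (G := del G S) (H := G.induce Sᶜ)
      (fun a => if ha : a ∈ S then ⟨v, hv⟩ else ⟨a, ha⟩) (fun a b hab => by
        rw [dif_neg hab.2.1, dif_neg hab.2.2]
        exact Adj.reachable hab.1) h
    simpa [hv, hw] using this

lemma isKConnected_iff [Fintype V] {k : ℕ} {G : SimpleGraph V} :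
    IsKConnected k G ↔ k < Fintype.card V ∧ ∀ S : Finset V, S.card < k →
      ∀ v w, v ∉ S → w ∉ S → (del G S).Reachable v w := by
  refine and_congr_right fun hk => forall₂_congr fun S hS => ?_
  constructor
  · intro h v w hv hw
    exact (induce_reachable_iff hv hw).1 (h.preconnected _ _)
  · intro h
    have : Nonempty ((S : Set V)ᶜ : Set V) := by
      obtain ⟨v, hv⟩ : ∃ v, v ∉ S := by
        by_contra! hc
        have := Finset.card_le_card (fun v _ => hc v : Finset.univ ⊆ S)
        rw [Finset.card_univ] at this
        omega
      exact ⟨⟨v, hv⟩⟩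
    exact ⟨fun v w => (induce_reachable_iff v.2 w.2).2 (h _ _ v.2 w.2)⟩

lemma del_mono {G : SimpleGraph V} {S T : Set V} (h : S ⊆ T) {v w : V}
    (hr : (del G T).Reachable v w) : (del G S).Reachable v w :=
  hr.mono (show del G T ≤ del G S from
    fun _ _ h' => ⟨h'.1, fun hs => h'.2.1 (h hs), fun hs => h'.2.2 (h hs)⟩)

/-- Deleting up to two vertices leaves the graph connected. -/
def Robust (G : SimpleGraph V) : Prop :=
  ∀ p q v w, v ≠ p → v ≠ q → w ≠ p → w ≠ q → (del G {p, q}).Reachable v w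

/-- Deleting more vertices only makes it harder to stay connected, so a smaller set is padded to a
pair that avoids the two vertices to be connected. In `Robust` the two deleted vertices may
coincide. -/
lemma isKConnected_three_iff [Fintype V] {G : SimpleGraph V} :
    IsKConnected 3 G ↔ 3 < Fintype.card V ∧ Robust G := by
  classical
  rw [isKConnected_iff]
  refine and_congr_right fun hk => ⟨fun h p q v w hvp hvq hwp hwq => ?_, fun h S hS v w hv hw => ?_⟩
  · have := h {p, q} (Finset.card_le_two.trans_lt (by norm_num)) v w (by simp [hvp, hvq])
      (by simp [hwp, hwq])
    simpa using this
  · obtain ⟨p, q, hpq⟩ : ∃ p q : V, S ⊆ {p, q} ∧ v ∉ ({p, q} : Finset V) ∧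
        w ∉ ({p, q} : Finset V) := by
      obtain hS | hS | hS : S.card = 0 ∨ S.card = 1 ∨ S.card = 2 := by omega
      · obtain ⟨p, hp⟩ : ∃ p, p ∉ ({v, w} : Finset V) := by
          by_contra! hc
          have := Finset.card_le_card (fun v _ => hc v : Finset.univ ⊆ {v, w})
          rw [Finset.card_univ] at this
          have := Finset.card_le_two (a := v) (b := w)
          omega
        refine ⟨p, p, ?_⟩
        rw [Finset.card_eq_zero] at hS
        simp only [Finset.mem_insert, Finset.mem_singleton] at hp ⊢
        simp [hS]
        grind
      · obtain ⟨p, rfl⟩ := Finset.card_eq_one.1 hS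
        exact ⟨p, p, by simp, by simpa using hv, by simpa using hw⟩
      · obtain ⟨p, q, -, rfl⟩ := Finset.card_eq_two.1 hS
        exact ⟨p, q, by simp, hv, hw⟩
    simp only [Finset.mem_insert, Finset.mem_singleton, not_or] at hpq
    refine del_mono ?_ (h p q v w hpq.2.1.1 hpq.2.1.2 hpq.2.2.1 hpq.2.2.2)
    intro z hz
    simpa using hpq.1 hz

lemma isKConnected_two [Fintype V] {G : SimpleGraph V} (hk : 2 < Fintype.card V)
    (h : ∀ p v w, v ≠ p → w ≠ p → (del G {p}).Reachable v w) : IsKConnected 2 G := by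
  classical
  refine isKConnected_iff.2 ⟨hk, fun S hS v w hv hw => ?_⟩
  obtain hS | hS : S.card = 0 ∨ S.card = 1 := by omega
  · obtain ⟨p, hp⟩ : ∃ p, p ∉ ({v, w} : Finset V) := by
      by_contra! hc
      have := Finset.card_le_card (fun v _ => hc v : Finset.univ ⊆ {v, w})
      rw [Finset.card_univ] at this
      have := Finset.card_le_two (a := v) (b := w)
      omega
    rw [Finset.card_eq_zero] at hS
    simp only [Finset.mem_insert, Finset.mem_singleton, not_or] at hp
    exact del_mono (by simp [hS]) (h p v w (Ne.symm hp.1) (Ne.symm hp.2))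
  · obtain ⟨p, rfl⟩ := Finset.card_eq_one.1 hS
    simp only [Finset.mem_singleton] at hv hw
    simpa using h p v w hv hw

/-- Every vertex of a robust graph on more than three vertices has degree at least three. -/
lemma Robust.three_le_deg [Fintype V] {G : SimpleGraph V} (h : Robust G)
    (hc : 3 < Fintype.card V) (v : V) : 3 ≤ deg G v := by
  classical
  by_contra! hlt
  obtain ⟨p, q, hpq⟩ : ∃ p q, p ≠ v ∧ q ≠ v ∧ ∀ w, G.Adj v w → w = p ∨ w = q := by
    obtain ⟨p, hp⟩ : ∃ p, p ≠ v := by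
      have := Fintype.one_lt_card_iff_nontrivial.1 (by omega : 1 < Fintype.card V)
      exact exists_ne v
    obtain h0 | h1 | h2 : deg G v = 0 ∨ deg G v = 1 ∨ deg G v = 2 := by omega
    · refine ⟨p, p, hp, hp, fun w hw => absurd h0 (deg_ne_zero hw)⟩
    · obtain ⟨a, ha⟩ := Set.ncard_eq_one.1 h1
      have hav : G.Adj v a := by rw [← mem_neighborSet, ha]; rfl
      refine ⟨a, a, hav.ne', hav.ne', fun w hw => ?_⟩
      rw [← mem_neighborSet, ha] at hw
      exact Or.inl hw
    · obtain ⟨a, b, -, hw⟩ := deg_eq_two_iff.1 h2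
      exact ⟨a, b, ((hw a).2 (Or.inl rfl)).ne', ((hw b).2 (Or.inr rfl)).ne', fun w => (hw w).1⟩
  obtain ⟨w, hw⟩ : ∃ w, w ∉ ({v, p, q} : Finset V) := by
    by_contra! hc'
    have := Finset.card_le_card (fun v _ => hc' v : Finset.univ ⊆ {v, p, q})
    rw [Finset.card_univ] at this
    have := Finset.card_le_three (a := v) (b := p) (c := q)
    omega
  simp only [Finset.mem_insert, Finset.mem_singleton, not_or] at hw
  -- Deleting `p` and `q` isolates `v`, while a fourth vertex `w` survives.
  have hr := h p q v w hpq.1.symm hpq.2.1.symm hw.2.1 hw.2.2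
  refine hw.1 (mem_of_reachable {v} ?_ hr rfl)
  rintro a b hab rfl
  exact absurd (hpq.2.2 _ hab.1) (by simpa using hab.2.2)

/-! ### Hamiltonian cycles as spanning subgraphs -/

/-- `C` is a cycle through all vertices. -/
structure IsHamGraph (C : SimpleGraph V) : Prop where
  reachable : ∀ v w, C.Reachable v w
  deg_eq : ∀ v, deg C v = 2

/-- `C` is a cycle that passes through all vertices outside of `Z`. -/
structure IsCycleOff (Z : Set V) (C : SimpleGraph V) : Prop where
  reachable : ∀ v w, deg C v ≠ 0 → deg C w ≠ 0 → C.Reachable v w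
  deg_eq : ∀ v, deg C v = 2 ∨ v ∈ Z ∧ deg C v = 0

lemma IsHamGraph.isCycleOff {C : SimpleGraph V} (h : IsHamGraph C) (Z : Set V) :
    IsCycleOff Z C :=
  ⟨fun v w _ _ => h.reachable v w, fun v => Or.inl (h.deg_eq v)⟩

/-- `C` is a hamiltonian cycle of `G`, and the only cycle of `G` that passes through all vertices
outside of `Z`. -/
structure IsUnique (G : SimpleGraph V) (Z : Set V) (C : SimpleGraph V) : Prop where
  le : C ≤ G
  ham : IsHamGraph C
  eq_of_le : ∀ D ≤ G, IsCycleOff Z D → D = C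

lemma IsHamGraph.eq_of_le {C D : SimpleGraph V} (hC : IsHamGraph C) (hD : IsHamGraph D)
    (h : D ≤ C) : D = C := by
  refine le_antisymm h fun v w hvw => ?_
  obtain ⟨p, q, hpq, hw⟩ := deg_eq_two_iff.1 (hD.deg_eq v)
  have hp := (hw p).2 (Or.inl rfl)
  have hq := (hw q).2 (Or.inr rfl)
  exact (hw w).2 ((adj_iff_of_deg_eq_two (hC.deg_eq v) hpq (h hp) (h hq) w).1 hvw)

/-- A cycle remains connected when one of its vertices is deleted. -/
lemma IsHamGraph.del_reachable [Finite V] {C : SimpleGraph V} (hC : IsHamGraph C) (n : V) {v w : V}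
    (hv : v ≠ n) (hw : w ≠ n) : (del C {n}).Reachable v w := by
  classical
  obtain ⟨p, q, hpq, hn⟩ := deg_eq_two_iff.1 (hC.deg_eq n)
  have hnp : C.Adj n p := (hn p).2 (Or.inl rfl)
  have hnq : C.Adj n q := (hn q).2 (Or.inr rfl)
  have key : (del C {n}).Reachable p q := by
    by_contra hno
    -- The component of `p` in `C - n`. If it does not contain `q`, then `p` has degree one in it
    -- and all its other vertices have degree two, against the handshake lemma.
    let D : SimpleGraph V :=
      { Adj := fun v w => (del C {n}).Adj v w ∧ (del C {n}).Reachable p v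
        symm := ⟨fun v w h => ⟨h.1.symm, h.2.trans h.1.reachable⟩⟩
        loopless := ⟨fun v h => (del C {n}).loopless.irrefl _ h.1⟩ }
    have hev := even_deg_of_forall_ne D p fun v hvp => by
      by_cases hr : (del C {n}).Reachable p v
      · have hvn : v ≠ n := by
          rintro rfl
          refine hvp.symm (mem_of_reachable {v} ?_ hr.symm rfl).symm.symm
          rintro a b hab rfl
          exact absurd rfl hab.2.1
        have hvq : v ≠ q := by rintro rfl; exact hno hr
        have : D.neighborSet v = C.neighborSet v := by
          ext w
          refine ⟨fun h => h.1.1, fun h => ⟨⟨h, hvn, ?_⟩, hr⟩⟩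
          rintro rfl
          have := (hn v).1 (C.adj_symm h)
          tauto
        rw [deg, this, ← deg, hC.deg_eq v]
        exact even_two
      · have : D.neighborSet v = ∅ := by
          ext w
          simp only [Set.mem_empty_iff_false, iff_false]
          exact fun h => hr h.2
        rw [deg, this]; simp
    obtain ⟨a, b, hab, hp⟩ := deg_eq_two_iff.1 (hC.deg_eq p)
    have : ∃ r, r ≠ n ∧ ∀ w, C.Adj p w ↔ w = n ∨ w = r := by
      have h1 := (hp n).1 hnp.symm
      rcases h1 with rfl | rfl
      · exact ⟨b, hab.symm, hp⟩
      · exact ⟨a, hab, fun w => by rw [hp]; tauto⟩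
    obtain ⟨r, hrn, hr⟩ := this
    have : D.neighborSet p = {r} := by
      ext w
      simp only [mem_neighborSet, Set.mem_singleton_iff]
      constructor
      · intro h
        exact ((hr w).1 h.1.1).resolve_left h.1.2.2
      · rintro rfl
        exact ⟨⟨(hr w).2 (Or.inr rfl), hnp.ne', hrn⟩, Reachable.refl _⟩
    rw [deg, this, Set.ncard_singleton] at hev
    exact absurd hev (by decide)
  have main : ∀ v, v ≠ n → (del C {n}).Reachable v p := by
    intro v hv
    obtain ⟨y, hy, z, hz, hyz⟩ := exists_exit C ((del C {n}).comap Subtype.val)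
      (Subtype.val : {v // v ≠ n} → V) (fun x y h => ⟨h, x.2, y.2⟩) (x := ⟨v, hv⟩)
      (hC.reachable v n) (by simp)
    have hy' : (del C {n}).Reachable v y :=
      reachable_map Subtype.val (fun a b h => Adj.reachable h) hy
    have hz : z = n := by simpa using hz
    subst hz
    rcases (hn _).1 hyz.symm with h | h
    · rwa [← h]
    · exact hy'.trans (h ▸ key.symm)
  exact (main v hv).trans (main w hw).symm

/-! ### Hamiltonian walks and their graphs -/

lemma walkGraph_adj {G : SimpleGraph V} {a b v w : V} {p : G.Walk a b} :
    p.toSubgraph.spanningCoe.Adj v w ↔ s(v, w) ∈ p.edges := by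
  rw [Subgraph.spanningCoe_adj, Walk.adj_toSubgraph_iff_mem_edges]

lemma isHamGraph_of_isCycle {G : SimpleGraph V} {a : V} {p : G.Walk a a} (hp : p.IsCycle)
    (h : ∀ v, v ∈ p.support) : IsHamGraph p.toSubgraph.spanningCoe where
  deg_eq v := hp.ncard_neighborSet_toSubgraph_eq_two (h v)
  reachable v w := by
    have := p.toSubgraph_connected.preconnected ⟨v, (Walk.mem_verts_toSubgraph p).2 (h v)⟩
      ⟨w, (Walk.mem_verts_toSubgraph p).2 (h w)⟩
    exact reachable_map Subtype.val (fun x y hxy => Adj.reachable hxy) this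

/-- A closed path in a graph of maximum degree two is a component. -/
lemma eq_walkGraph_of_isCycle [Finite V] {C : SimpleGraph V} (hC : IsHamGraph C) {a : V}
    {p : C.Walk a a} (hp : p.IsCycle) :
    (∀ v, v ∈ p.support) ∧ ∀ v w, C.Adj v w ↔ s(v, w) ∈ p.edges := by
  have hadj : ∀ v w, v ∈ p.support → C.Adj v w → s(v, w) ∈ p.edges := by
    intro v w hv hvw
    obtain ⟨x, y, hxy, h⟩ := deg_eq_two_iff.1
      (show deg p.toSubgraph.spanningCoe v = 2 from hp.ncard_neighborSet_toSubgraph_eq_two hv)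
    have hx := (h x).2 (Or.inl rfl)
    have hy := (h y).2 (Or.inr rfl)
    rw [← walkGraph_adj, h]
    exact (adj_iff_of_deg_eq_two (hC.deg_eq v) hxy (p.toSubgraph.spanningCoe_le hx)
      (p.toSubgraph.spanningCoe_le hy) w).1 hvw
  have hsup : ∀ v, v ∈ p.support := fun v =>
    mem_of_reachable {v | v ∈ p.support} (fun x y hxy hx =>
      p.snd_mem_support_of_mem_edges (hadj x y hx hxy)) (hC.reachable a v) p.start_mem_support
  exact ⟨hsup, fun v w => ⟨hadj v w (hsup v), p.adj_of_mem_edges⟩⟩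

lemma IsHamGraph.exists_walk [Finite V] [Nonempty V] {C : SimpleGraph V} (hC : IsHamGraph C) :
    ∃ (a : V) (p : C.Walk a a), p.IsCycle := by
  obtain ⟨v⟩ := ‹Nonempty V›
  have h : C.IsCycles := fun v _ => hC.deg_eq v
  obtain ⟨w, hw⟩ := exists_adj_of_deg_ne_zero (G := C) (v := v) (by rw [hC.deg_eq]; norm_num)
  obtain ⟨p, hp, -⟩ := h.exists_cycle_toSubgraph_verts_eq_connectedComponentSupp
    (c := C.connectedComponentMk v) rfl ⟨w, hw⟩
  exact ⟨v, p, hp⟩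

lemma isHamiltonianCycle_of_isCycle [DecidableEq V] {G : SimpleGraph V} {a : V} {p : G.Walk a a}
    (hp : p.IsCycle) (h : ∀ v, v ∈ p.support) : p.IsHamiltonianCycle := by
  refine ⟨hp, ?_⟩
  rw [Walk.IsPath.isHamiltonian_iff hp.isPath_tail]
  intro w
  rw [Walk.support_tail_of_not_nil _ hp.not_nil]
  by_cases hw : w = a
  · subst hw
    exact p.end_mem_tail_support hp.not_nil
  · have := h w
    rw [Walk.mem_support_iff] at this
    exact this.resolve_left hw

/-- The passage from closed walks to spanning subgraphs: with `Z = ∅` no vertex may be skipped, and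
the edge set of a hamiltonian walk determines and is determined by its subgraph. -/
theorem isUniquelyHamiltonian_iff [Finite V] [Nonempty V] {G : SimpleGraph V} :
    IsUniquelyHamiltonian G ↔ ∃ C, IsUnique G ∅ C := by
  classical
  have toGraph : ∀ {a : V} (p : G.Walk a a), p.IsHamiltonianCycle →
      IsHamGraph p.toSubgraph.spanningCoe := fun p hp =>
    isHamGraph_of_isCycle hp.isCycle hp.mem_support
  have toWalk : ∀ D ≤ G, IsHamGraph D → ∃ (a : V) (p : G.Walk a a), p.IsHamiltonianCycle ∧
      {e | e ∈ p.edges} = D.edgeSet := by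
    intro D hD hh
    obtain ⟨a, p, hp⟩ := hh.exists_walk
    obtain ⟨h1, h2⟩ := eq_walkGraph_of_isCycle hh hp
    refine ⟨a, p.mapLe hD, isHamiltonianCycle_of_isCycle (hp.mapLe hD) (by simpa using h1), ?_⟩
    ext e
    induction e with
    | h v w => simp [h2]
  have off : ∀ D : SimpleGraph V, IsCycleOff ∅ D → ∀ v, deg D v = 2 := fun D hD v =>
    (hD.deg_eq v).resolve_right (by simp)
  constructor
  · rintro ⟨S, ⟨a, p, hp, hS⟩, huniq⟩
    refine ⟨p.toSubgraph.spanningCoe, p.toSubgraph.spanningCoe_le, toGraph p hp, fun D hD hc => ?_⟩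
    have hDh : IsHamGraph D := ⟨fun v w => hc.reachable v w (by simp [off D hc])
      (by simp [off D hc]), off D hc⟩
    obtain ⟨b, q, hq, hqD⟩ := toWalk D hD hDh
    have h1 := huniq D.edgeSet ⟨b, q, hq, hqD⟩
    ext v w
    rw [walkGraph_adj, ← mem_edgeSet, h1, ← hS]
    rfl
  · rintro ⟨C, hC⟩
    obtain ⟨a, p, hp, hpC⟩ := toWalk C hC.le hC.ham
    refine ⟨C.edgeSet, ⟨a, p, hp, hpC⟩, ?_⟩
    rintro S ⟨b, q, hq, rfl⟩
    have := hC.eq_of_le _ q.toSubgraph.spanningCoe_le ((toGraph q hq).isCycleOff ∅)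
    rw [← this]
    ext e
    induction e with
    | h v w => rw [mem_edgeSet, walkGraph_adj]; rfl

/-! ### Hamiltonian paths -/

section

variable {G : SimpleGraph V} {A : Set V}

@[simp] lemma addVertex_some_some {v w : V} :
    (addVertex G A).Adj (some v) (some w) ↔ G.Adj v w := Iff.rfl
@[simp] lemma addVertex_none_some {v : V} : (addVertex G A).Adj none (some v) ↔ v ∈ A := Iff.rfl
@[simp] lemma addVertex_some_none {v : V} : (addVertex G A).Adj (some v) none ↔ v ∈ A := Iff.rfl

lemma deg_addVertex_none : deg (addVertex G A) none = A.ncard := by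
  rw [deg, ← Set.ncard_image_of_injective A (Option.some_injective V)]
  congr 1
  ext (_ | v) <;> simp

lemma deg_addVertex_of_mem [Finite V] {v : V} (hv : v ∈ A) :
    deg (addVertex G A) (some v) = deg G v + 1 := by
  rw [deg, show (addVertex G A).neighborSet (some v) = insert none (some '' G.neighborSet v) by
    ext (_ | w) <;> simp [hv], Set.ncard_insert_of_notMem (by simp) (Set.toFinite _),
    Set.ncard_image_of_injective _ (Option.some_injective V), deg]

lemma deg_addVertex_of_notMem {v : V} (hv : v ∉ A) : deg (addVertex G A) (some v) = deg G v := by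
  rw [deg, show (addVertex G A).neighborSet (some v) = some '' G.neighborSet v by
    ext (_ | w) <;> simp [hv], Set.ncard_image_of_injective _ (Option.some_injective V), deg]

end

lemma none_adj_iff {G : SimpleGraph V} {s t : V} {Q : SimpleGraph (Option V)}
    (hQ : deg Q none = 2) (hle : Q ≤ addVertex G {s, t}) (v : Option V) :
    Q.Adj none v ↔ v = some s ∨ v = some t := by
  obtain ⟨x, y, hxy, h⟩ := deg_eq_two_iff.1 hQ
  have : ∀ z, z = x ∨ z = y → z = some s ∨ z = some t := by
    intro z hz
    have := hle ((h z).2 hz)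
    cases z with
    | none => exact this.elim
    | some z => simpa [addVertex] using this
  rw [h]
  have h1 := this x (Or.inl rfl)
  have h2 := this y (Or.inr rfl)
  grind

lemma eq_addVertex {G : SimpleGraph V} {s t : V} {Q : SimpleGraph (Option V)}
    (hQ : deg Q none = 2) (hle : Q ≤ addVertex G {s, t}) :
    Q = addVertex (Q.comap some) {s, t} := by
  have h := none_adj_iff hQ hle
  ext (_ | v) (_ | w)
  · simp
  · rw [h]; simp
  · rw [Q.adj_comm, h]; simp
  · rfl

/-- The inclusion of a graph in its extension by a vertex. -/
def toAddVertex (G : SimpleGraph V) (A : Set V) : G →g addVertex G A where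
  toFun := some
  map_rel' h := h

@[simp] lemma toAddVertex_apply (G : SimpleGraph V) (A : Set V) (v : V) :
    toAddVertex G A v = some v := rfl

/-- The closed walk through the new vertex that is given by a walk in the old graph. -/
def closeWalk {G : SimpleGraph V} {s t : V} (p : G.Walk s t) :
    (addVertex G {s, t}).Walk none none :=
  Walk.cons (show (addVertex G {s, t}).Adj none (toAddVertex G {s, t} s) from Or.inl rfl)
    ((p.map (toAddVertex G {s, t})).concat
      (show (addVertex G {s, t}).Adj (toAddVertex G {s, t} t) none from Or.inr rfl))

lemma closeWalk_isCycle {G : SimpleGraph V} {s t : V} (hst : s ≠ t) {p : G.Walk s t}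
    (hp : p.IsPath) : (closeWalk p).IsCycle := by
  rw [closeWalk, Walk.cons_isCycle_iff]
  constructor
  · refine Walk.IsPath.concat (hp.map (Option.some_injective V)) ?_ _
    rw [Walk.support_map]
    simp
  · simp only [Walk.edges_concat, Walk.edges_map, List.mem_append, List.mem_map,
      List.concat_eq_append, List.mem_singleton, not_or, not_exists, not_and]
    constructor
    · intro e _ he
      have : (none : Option V) ∈ Sym2.map (toAddVertex G {s, t}) e := by rw [he]; simp
      obtain ⟨x, -, hx⟩ := Sym2.mem_map.1 this
      exact absurd hx (by simp)
    · intro h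
      have : s = t := by simpa using h
      exact hst this

lemma mem_edges_closeWalk {G : SimpleGraph V} {s t : V} {p : G.Walk s t} {v w : V} :
    s(some v, some w) ∈ (closeWalk p).edges ↔ s(v, w) ∈ p.edges := by
  simp only [closeWalk, Walk.edges_cons, Walk.edges_concat, Walk.edges_map, List.mem_cons,
    List.concat_eq_append, List.mem_append, List.mem_map]
  constructor
  · rintro (h | ⟨e, he, h⟩ | h)
    · simp at h
    · have : Sym2.map some e = Sym2.map some s(v, w) := h
      rwa [Sym2.map.injective (Option.some_injective V) this] at he
    · simp at h
  · intro h
    exact Or.inr (Or.inl ⟨_, h, rfl⟩)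

lemma mem_support_closeWalk {G : SimpleGraph V} {s t : V} {p : G.Walk s t} {v : V} :
    some v ∈ (closeWalk p).support ↔ v ∈ p.support := by
  rw [closeWalk, Walk.support_cons, Walk.support_concat, Walk.support_map]
  simp

lemma none_mem_support_closeWalk {G : SimpleGraph V} {s t : V} {p : G.Walk s t} :
    none ∈ (closeWalk p).support := Walk.start_mem_support _

/-- A path has just one edge at its start, so the edge set determines the first step and, by
induction, the rest. -/
lemma isPath_eq_of_edges {G : SimpleGraph V} {s t : V} {p q : G.Walk s t} (hp : p.IsPath)
    (hq : q.IsPath) (h : ∀ e, e ∈ p.edges ↔ e ∈ q.edges) : p = q := by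
  induction p with
  | nil =>
    cases q with
    | nil => rfl
    | cons hab q => exact absurd ((h _).2 List.mem_cons_self) (by simp)
  | @cons a b c hab p ih =>
    cases q with
    | nil => exact absurd ((h _).1 List.mem_cons_self) (by simp)
    | @cons _ b' _ hab' q =>
      rw [Walk.cons_isPath_iff] at hp hq
      have h1 : ∀ {x} (r : G.Walk x c), a ∉ r.support → ∀ y, s(a, y) ∉ r.edges :=
        fun r hr y hy => hr (r.fst_mem_support_of_mem_edges hy)
      have hb : b = b' := by
        have := (h s(a, b)).1 List.mem_cons_self
        rw [Walk.edges_cons, List.mem_cons] at this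
        rcases this with h' | h'
        · rcases Sym2.eq_iff.1 h' with h' | h'
          · exact h'.2
          · exact absurd h'.2 hab.ne'
        · exact absurd h' (h1 q hq.2 b)
      subst hb
      congr 1
      refine ih hp.1 hq.1 fun e => ?_
      have he := h e
      simp only [Walk.edges_cons, List.mem_cons] at he
      constructor
      · intro hep
        refine (he.1 (Or.inr hep)).resolve_left ?_
        rintro rfl
        exact h1 p hp.2 b hep
      · intro heq
        refine (he.2 (Or.inr heq)).resolve_left ?_
        rintro rfl
        exact h1 q hq.2 b heq

/-- Every hamiltonian cycle through the new vertex comes from a hamiltonian path. -/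
lemma exists_isPath_of_isHamGraph [Finite V] {G : SimpleGraph V} {s t : V} (hst : s ≠ t)
    {Q : SimpleGraph (Option V)} (hQ : IsHamGraph Q) (hle : Q ≤ addVertex G {s, t}) :
    ∃ p : G.Walk s t, p.IsPath ∧ (∀ v, v ∈ p.support) ∧
      ∀ v w, Q.Adj (some v) (some w) ↔ s(v, w) ∈ p.edges := by
  classical
  obtain ⟨D, rfl⟩ : ∃ D : SimpleGraph V, Q = addVertex D {s, t} :=
    ⟨_, eq_addVertex (hQ.deg_eq none) hle⟩
  have hDG : D ≤ G := fun v w h => hle (show (addVertex D {s, t}).Adj (some v) (some w) from h)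
  -- A cycle minus the new vertex is still connected, so `D` contains a path from `s` to `t`. Closed
  -- up through the new vertex it is a cycle inside the cycle `Q`, hence all of `Q`.
  have hr : D.Reachable s t := by
    have := hQ.del_reachable none (v := some s) (w := some t) (by simp) (by simp)
    refine reachable_map (H := D) (fun o : Option V => o.getD s) ?_ this
    rintro (_ | v) (_ | w) h
    · exact absurd rfl h.2.1
    · exact absurd rfl h.2.1
    · exact absurd rfl h.2.2
    · exact Adj.reachable h.1
  obtain ⟨p, hp⟩ := hr.exists_isPath
  obtain ⟨h1, h2⟩ := eq_walkGraph_of_isCycle hQ (closeWalk_isCycle hst hp)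
  refine ⟨p.mapLe hDG, hp.mapLe hDG, fun v => ?_, fun v w => ?_⟩
  · simpa using mem_support_closeWalk.1 (h1 (some v))
  · rw [h2, mem_edges_closeWalk]
    simp

/-- `P` is, with the new vertex as the last vertex, the only hamiltonian path from `s` to `t`. -/
structure IsUniquePath (G : SimpleGraph V) (s t : V) (P : SimpleGraph (Option V)) : Prop where
  le : P ≤ addVertex G {s, t}
  ham : IsHamGraph P
  eq_of_le : ∀ Q ≤ addVertex G {s, t}, IsHamGraph Q → Q = P

lemma addVertex_mono {G H : SimpleGraph V} {A B : Set V} (h : G ≤ H) (hA : A ⊆ B) :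
    addVertex G A ≤ addVertex H B := by
  rintro (_ | v) (_ | w) hvw
  · exact hvw
  · exact hA hvw
  · exact hA hvw
  · exact h hvw

lemma isHamGraph_closeWalk {G : SimpleGraph V} {s t : V} (hst : s ≠ t) {p : G.Walk s t}
    (hp : p.IsPath) (hs : ∀ v, v ∈ p.support) :
    IsHamGraph (closeWalk p).toSubgraph.spanningCoe := by
  refine isHamGraph_of_isCycle (closeWalk_isCycle hst hp) ?_
  rintro (_ | v)
  · exact none_mem_support_closeWalk
  · exact mem_support_closeWalk.2 (hs v)

theorem exists_isUniquePath [Finite V] [DecidableEq V] {G : SimpleGraph V} {s t : V} (hst : s ≠ t)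
    (h : ∃! p : G.Walk s t, p.IsHamiltonian) : ∃ P, IsUniquePath G s t P := by
  obtain ⟨p, hp, hu⟩ := h
  have hH := isHamGraph_closeWalk hst hp.isPath hp.mem_support
  refine ⟨_, (closeWalk p).toSubgraph.spanningCoe_le, hH, fun Q hQ hQH => ?_⟩
  obtain ⟨q, hq, hqs, hqe⟩ := exists_isPath_of_isHamGraph hst hQH hQ
  obtain rfl := hu q ((Walk.IsPath.isHamiltonian_iff hq).2 hqs)
  obtain ⟨r, hr, hrs, hre⟩ := exists_isPath_of_isHamGraph hst hH
    (closeWalk q).toSubgraph.spanningCoe_le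
  have key : ∀ {R : SimpleGraph (Option V)}, R ≤ addVertex G {s, t} → IsHamGraph R →
      ∀ v, R.Adj none v ↔ v = some s ∨ v = some t := by
    intro R hR hRH v
    obtain ⟨x, y, hxy, h⟩ := deg_eq_two_iff.1 (hRH.deg_eq none)
    have : ∀ z, z = x ∨ z = y → z = some s ∨ z = some t := by
      intro z hz
      have := hR ((h z).2 hz)
      cases z with
      | none => exact this.elim
      | some z => simpa [addVertex] using this
    rw [h]
    have h1 := this x (Or.inl rfl)
    have h2 := this y (Or.inr rfl)
    grind
  have k1 := key hQ hQH
  have k2 := key (closeWalk q).toSubgraph.spanningCoe_le hH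
  ext v w
  cases v with
  | none => rw [k1, k2]
  | some v =>
    cases w with
    | none => rw [Q.adj_comm, adj_comm _ (some v), k1, k2]
    | some w => rw [hqe, walkGraph_adj, mem_edges_closeWalk]

/-! ### Replacing a vertex by a graph -/

/-- The image of a graph under a map of the vertices. -/
def quo (f : V → W) (D : SimpleGraph V) : SimpleGraph W where
  Adj p q := p ≠ q ∧ ∃ x y, f x = p ∧ f y = q ∧ D.Adj x y
  symm := ⟨fun _ _ ⟨h, x, y, hx, hy, hxy⟩ => ⟨h.symm, y, x, hy, hx, hxy.symm⟩⟩
  loopless := ⟨fun _ h => h.1 rfl⟩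

lemma quo_reachable (f : V → W) {D : SimpleGraph V} {x y : V} (h : D.Reachable x y) :
    (quo f D).Reachable (f x) (f y) :=
  reachable_map f (fun v w hvw => by
    by_cases hf : f v = f w
    · rw [hf]
    · exact Adj.reachable ⟨hf, v, w, rfl, rfl, hvw⟩) h

/-- Degrees in glued graphs are computed by contracting one side. Nothing changes at `x` when no
other vertex with an edge is identified with it, its neighbours stay apart and none of them is
merged with `x`. -/
lemma deg_quo {f : V → W} {D : SimpleGraph V} {x : V}
    (hx : ∀ x' y, f x' = f x → D.Adj x' y → x' = x) (hinj : Set.InjOn f (D.neighborSet x))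
    (hne : ∀ y, D.Adj x y → f y ≠ f x) : deg (quo f D) (f x) = deg D x := by
  rw [deg, deg, ← hinj.ncard_image]
  congr 1
  ext q
  simp only [mem_neighborSet, Set.mem_image]
  constructor
  · rintro ⟨-, x', y, hx', rfl, hxy⟩
    obtain rfl := hx x' y hx' hxy
    exact ⟨y, hxy, rfl⟩
  · rintro ⟨y, hxy, rfl⟩
    exact ⟨(hne y hxy).symm, x, y, rfl, rfl, hxy⟩

/-- `Γ` with the vertex `u` replaced by the graph `G`, linked to the rest by `R`. -/
def glue (Γ : SimpleGraph V) (u : V) (G : SimpleGraph X) (R : V → X → Prop) :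
    SimpleGraph ({v // v ≠ u} ⊕ X) where
  Adj
    | .inl y, .inl y' => Γ.Adj y y'
    | .inl y, .inr z => R y z
    | .inr z, .inl y => R y z
    | .inr z, .inr z' => G.Adj z z'
  symm := ⟨by
    rintro (y | z) (y' | z') h
    · exact Adj.symm (G := Γ) h
    · exact h
    · exact h
    · exact Adj.symm (G := G) h⟩
  loopless := ⟨by
    rintro (y | z) h
    · exact Γ.loopless.irrefl _ h
    · exact G.loopless.irrefl _ h⟩

section

variable {Γ : SimpleGraph V} {u : V} {G : SimpleGraph X} {R : V → X → Prop}

@[simp] lemma glue_inl_inl {y y' : {v // v ≠ u}} :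
    (glue Γ u G R).Adj (.inl y) (.inl y') ↔ Γ.Adj y y' := Iff.rfl

@[simp] lemma glue_inl_inr {y : {v // v ≠ u}} {z : X} :
    (glue Γ u G R).Adj (.inl y) (.inr z) ↔ R y z := Iff.rfl

@[simp] lemma glue_inr_inl {y : {v // v ≠ u}} {z : X} :
    (glue Γ u G R).Adj (.inr z) (.inl y) ↔ R y z := Iff.rfl

@[simp] lemma glue_inr_inr {z z' : X} :
    (glue Γ u G R).Adj (.inr z) (.inr z') ↔ G.Adj z z' := Iff.rfl

end

/-! ### Replacing a cubic vertex: the hamiltonian cycle and its uniqueness -/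

/-- The links of a pole with the ends `s`, `t`, `x` to the vertices `a`, `b`, `c`; if `ε` holds,
then `a` is linked to `t`, too. -/
def link (a b c : V) (s t x : X) (ε : Prop) (y : V) (z : X) : Prop :=
  y = a ∧ z = s ∨ y = b ∧ z = t ∨ y = c ∧ z = x ∨ ε ∧ y = a ∧ z = t

/-- The links that are used by the hamiltonian cycle. -/
def cycleLink (a b : V) (s t : X) (y : V) (z : X) : Prop := y = a ∧ z = s ∨ y = b ∧ z = t

/-- `u` is a vertex with the neighbors `a`, `b`, `c` that are joined to it by two edges of `C` and
one other edge. -/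
structure IsSite (Γ C : SimpleGraph V) (u a b c : V) : Prop where
  adj_iff : ∀ v, Γ.Adj u v ↔ v = a ∨ v = b ∨ v = c
  cycle_adj_iff : ∀ v, C.Adj u v ↔ v = a ∨ v = b
  hab : a ≠ b
  hac : a ≠ c
  hbc : b ≠ c

/-- The hamiltonian cycle after the replacement of a vertex. -/
def glueCycle (C : SimpleGraph V) (u a b : V) (s t : X) (P : SimpleGraph (Option X)) :
    SimpleGraph ({v // v ≠ u} ⊕ X) :=
  glue C u (P.comap some) (cycleLink a b s t)

/-- The contraction of the pole to the vertex it replaced. -/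
def contract (u : V) : {v // v ≠ u} ⊕ X → V := Sum.elim Subtype.val fun _ => u

/-- The contraction of everything outside of the pole. -/
def coContract (u : V) : {v // v ≠ u} ⊕ X → Option X := Sum.elim (fun _ => none) some

@[simp] lemma contract_inl {u : V} (y : {v // v ≠ u}) : contract (X := X) u (.inl y) = y := rfl
@[simp] lemma contract_inr {u : V} (z : X) : contract u (.inr z) = u := rfl
@[simp] lemma coContract_inl {u : V} (y : {v // v ≠ u}) :
    coContract (X := X) u (.inl y) = none := rfl
@[simp] lemma coContract_inr {u : V} (z : X) : coContract u (.inr z) = some z := rfl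

/-- Contracting the pole gives `C`, and contracting everything outside of it gives `P`. Both are
2-regular, and each contraction preserves the degrees on the side that it leaves alone. -/
lemma glueCycle_isHamGraph [Finite V] [Finite X] {Γ C : SimpleGraph V} {u a b c : V}
    {G : SimpleGraph X} {s t : X} {P : SimpleGraph (Option X)} (hC : IsHamGraph C)
    (hs : IsSite Γ C u a b c) (hst : s ≠ t) (hP : IsUniquePath G s t P) :
    IsHamGraph (glueCycle C u a b s t P) := by
  have hua : a ≠ u := ((hs.cycle_adj_iff a).2 (Or.inl rfl)).ne'
  have hub : b ≠ u := ((hs.cycle_adj_iff b).2 (Or.inr rfl)).ne'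
  have hab := hs.hab
  have hn := none_adj_iff (hP.ham.deg_eq none) hP.le
  have hns : ∀ z, P.Adj (some z) none ↔ z = s ∨ z = t := fun z => by
    rw [P.adj_comm, hn]; simp
  have hca := hs.cycle_adj_iff
  have hca' : ∀ v, C.Adj v u ↔ v = a ∨ v = b := fun v => by rw [C.adj_comm, hca]
  set D := glueCycle C u a b s t P with hD
  constructor
  · have hX : ∀ z, D.Reachable (.inr z) (.inr s) := by
      intro z
      have := hP.ham.del_reachable none (v := some z) (w := some s) (by simp) (by simp)
      refine reachable_map (H := D) (fun o : Option X => .inr (o.getD s)) ?_ this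
      rintro (_ | v) (_ | w) h
      · exact absurd rfl h.2.1
      · exact absurd rfl h.2.1
      · exact absurd rfl h.2.2
      · exact Adj.reachable (G := D) h.1
    classical
    have hY : ∀ y, D.Reachable (.inl y) (.inr s) := by
      intro y
      have := reachable_map (H := D) (fun v => if h : v = u then .inr s else .inl ⟨v, h⟩) ?_
        (hC.reachable y u)
      · simpa [y.2] using this
      · intro v w hvw
        have aux : ∀ v (hv : v ≠ u), C.Adj v u → D.Reachable (.inl ⟨v, hv⟩) (.inr s) := by
          intro v hv h
          rw [hca'] at h
          rcases h with rfl | rfl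
          · exact Adj.reachable (G := D) (Or.inl ⟨rfl, rfl⟩)
          · exact (show D.Adj (.inl ⟨v, hv⟩) (.inr t) from Or.inr ⟨rfl, rfl⟩).reachable.trans
              (hX t)
        by_cases hv : v = u
        · by_cases hw : w = u
          · simp [hv, hw]
          · subst hv
            simpa [hw] using (aux w hw hvw.symm).symm
        · by_cases hw : w = u
          · subst hw
            simpa [hv] using aux v hv hvw
          · simp only [hv, hw, dite_false]
            exact Adj.reachable (G := D) hvw
    have : ∀ v, D.Reachable v (.inr s) := by
      rintro (y | z)
      · exact hY y
      · exact hX z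
    exact fun v w => (this v).trans (this w).symm
  · rintro (y | z)
    · have hq : quo (contract u) D = C := by
        ext p q
        constructor
        · rintro ⟨hpq, (y | z), (y' | z'), rfl, rfl, h⟩
          · exact h
          · simp only [contract_inl, contract_inr]
            rw [hca']
            have : cycleLink a b s t y z' := h
            grind [cycleLink]
          · simp only [contract_inl, contract_inr]
            rw [hca]
            have : cycleLink a b s t y' z := h
            grind [cycleLink]
          · exact absurd rfl hpq
        · intro h
          refine ⟨h.ne, ?_⟩
          by_cases hp : p = u
          · subst hp
            rw [hca] at h
            rcases h with rfl | rfl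
            · exact ⟨.inr s, .inl ⟨q, hua⟩, rfl, rfl, Or.inl ⟨rfl, rfl⟩⟩
            · exact ⟨.inr t, .inl ⟨q, hub⟩, rfl, rfl, Or.inr ⟨rfl, rfl⟩⟩
          · by_cases hq : q = u
            · subst hq
              rw [hca'] at h
              rcases h with rfl | rfl
              · exact ⟨.inl ⟨p, hua⟩, .inr s, rfl, rfl, Or.inl ⟨rfl, rfl⟩⟩
              · exact ⟨.inl ⟨p, hub⟩, .inr t, rfl, rfl, Or.inr ⟨rfl, rfl⟩⟩
            · exact ⟨.inl ⟨p, hp⟩, .inl ⟨q, hq⟩, rfl, rfl, h⟩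
      have := deg_quo (f := contract u) (D := D) (x := .inl y) ?_ ?_ ?_
      · rw [← this, hq]; exact hC.deg_eq _
      · rintro (y' | z') _ h _
        · exact congrArg _ (Subtype.ext h)
        · exact absurd h.symm y.2
      · rintro (p | p) hp (q | q) hq' h
        · exact congrArg _ (Subtype.ext h)
        · exact absurd h p.2
        · exact absurd h.symm q.2
        · have h1 : cycleLink a b s t y p := hp
          have h2 : cycleLink a b s t y q := hq'
          grind [cycleLink]
      · rintro (p | p) hp h
        · exact (Adj.ne (G := C) hp) (h.symm)
        · exact y.2 h.symm
    · have hq : quo (coContract u) D = P := by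
        ext p q
        constructor
        · rintro ⟨hpq, (y | z), (y' | z'), rfl, rfl, h⟩
          · exact absurd rfl hpq
          · simp only [coContract_inl, coContract_inr]
            rw [hn]
            have : cycleLink a b s t y z' := h
            grind [cycleLink]
          · simp only [coContract_inl, coContract_inr]
            rw [hns]
            have : cycleLink a b s t y' z := h
            grind [cycleLink]
          · exact h
        · intro h
          refine ⟨h.ne, ?_⟩
          cases p with
          | none =>
            rw [hn] at h
            rcases h with rfl | rfl
            · exact ⟨.inl ⟨a, hua⟩, .inr s, rfl, rfl, Or.inl ⟨rfl, rfl⟩⟩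
            · exact ⟨.inl ⟨b, hub⟩, .inr t, rfl, rfl, Or.inr ⟨rfl, rfl⟩⟩
          | some p =>
            cases q with
            | none =>
              rw [hns] at h
              rcases h with rfl | rfl
              · exact ⟨.inr p, .inl ⟨a, hua⟩, rfl, rfl, Or.inl ⟨rfl, rfl⟩⟩
              · exact ⟨.inr p, .inl ⟨b, hub⟩, rfl, rfl, Or.inr ⟨rfl, rfl⟩⟩
            | some q => exact ⟨.inr p, .inr q, rfl, rfl, h⟩
      have := deg_quo (f := coContract u) (D := D) (x := .inr z) ?_ ?_ ?_
      · rw [← this, hq]; exact hP.ham.deg_eq _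
      · rintro (y' | z') _ h _
        · simp at h
        · simpa using h
      · rintro (p | p) hp (q | q) hq' h
        · have h1 : cycleLink a b s t p z := hp
          have h2 : cycleLink a b s t q z := hq'
          congr 1
          grind [cycleLink]
        · simp at h
        · simp at h
        · simpa using h
      · rintro (p | p) hp h
        · simp at h
        · have h1 : P.Adj (some z) (some p) := hp
          simp at h
          simp [h] at h1

lemma deg_le_of_subset_pair {G : SimpleGraph V} {u p q : V} (h : ∀ v, G.Adj u v → v = p ∨ v = q) :
    deg G u ≤ 2 := by
  classical
  refine (Set.ncard_le_ncard (t := (({p, q} : Finset V) : Set V)) (fun v hv => ?_)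
    (Set.toFinite _)).trans ?_
  · simpa using h v hv
  · rw [Set.ncard_coe_finset]; exact Finset.card_le_two

lemma deg_le_of_subset_triple {G : SimpleGraph V} {u p q r : V}
    (h : ∀ v, G.Adj u v → v = p ∨ v = q ∨ v = r) : deg G u ≤ 3 := by
  classical
  refine (Set.ncard_le_ncard (t := (({p, q, r} : Finset V) : Set V)) (fun v hv => ?_)
    (Set.toFinite _)).trans ?_
  · simpa using h v hv
  · rw [Set.ncard_coe_finset]; exact Finset.card_le_three

/-- Parity replaces counting how often a cycle crosses the boundary of the pole: the contracted
vertex has even degree, and a nonzero even number that is at most three is two. -/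
lemma isCycleOff_of_deg [Finite V] {D' : SimpleGraph V} {Z : Set V} {u : V}
    (hu : deg D' u ≤ 3) (hu0 : deg D' u ≠ 0)
    (hy : ∀ y, y ≠ u → deg D' y = 2 ∨ y ∈ Z ∧ deg D' y = 0)
    (hr : ∀ y, y ≠ u → deg D' y ≠ 0 → D'.Reachable y u) : IsCycleOff Z D' := by
  have hev := even_deg_of_forall_ne D' u fun v hv => by
    rcases hy v hv with h | h
    · rw [h]; exact even_two
    · rw [h.2]; simp
  have hr' : ∀ y, deg D' y ≠ 0 → D'.Reachable y u := fun y h => by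
    by_cases hyu : y = u
    · rw [hyu]
    · exact hr y hyu h
  refine ⟨fun v w hv hw => (hr' v hv).trans (hr' w hw).symm, fun v => ?_⟩
  by_cases hv : v = u
  · subst hv
    left
    obtain ⟨k, hk⟩ := hev
    omega
  · exact hy v hv

/-- `D` contracts to a cycle of `Γ`, which must be `C`. So `D` uses links at `a` and `b` but not at
`c`, and its part inside the pole closes up to a hamiltonian cycle through the extra vertex, which
must be `P`. If `ε` fails, the only link at `a` ends in `s`, so `D` passes through `s` even when it
is allowed to skip it. If `ε` holds, `a` has a second link, to `t`, and the freedom to skip `a` in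
`Γ` excludes its use. -/
lemma glue_eq_of_le [Finite V] [Finite X] {Γ C : SimpleGraph V} {Z : Set V} {u a b c : V}
    {G : SimpleGraph X} {s t x : X} {P : SimpleGraph (Option X)} {ε : Prop}
    (hC : IsUnique Γ Z C) (hs : IsSite Γ C u a b c) (hst : s ≠ t) (hP : IsUniquePath G s t P)
    (hε : ε → a ∈ Z) (hbZ : b ∉ Z) {D : SimpleGraph ({v // v ≠ u} ⊕ X)}
    (hD : D ≤ glue Γ u G (link a b c s t x ε))
    (hoff : IsCycleOff (Sum.elim (fun y => y.1 ∈ Z) fun z => z = s ∧ ¬ε) D) :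
    D = glueCycle C u a b s t P := by
  classical
  obtain ⟨hna, hca, hab, hac, hbc⟩ := hs
  have hua : a ≠ u := ((hca a).2 (Or.inl rfl)).ne'
  have hub : b ≠ u := ((hca b).2 (Or.inr rfl)).ne'
  have huc : c ≠ u := ((hna c).2 (Or.inr (Or.inr rfl))).ne'
  have hna' : ∀ v, Γ.Adj v u ↔ v = a ∨ v = b ∨ v = c := fun v => by rw [Γ.adj_comm, hna]
  have hlink : ∀ {y z}, D.Adj (.inl y) (.inr z) → link a b c s t x ε y z := fun h => hD h
  have hlink' : ∀ {y z}, D.Adj (.inr z) (.inl y) → link a b c s t x ε y z := fun h => hD h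
  have hdeg : ∀ v, deg D v = 2 ∨ deg D v = 0 := fun v => (hoff.deg_eq v).imp_right And.right
  have hdb : deg D (.inl ⟨b, hub⟩) = 2 := (hoff.deg_eq _).resolve_right fun h => hbZ h.1
  have hdt : deg D (.inr t) = 2 := (hoff.deg_eq _).resolve_right fun h => hst h.1.1.symm
  have hdy : ∀ y : {v // v ≠ u}, deg D (.inl y) = 2 ∨ y.1 ∈ Z ∧ deg D (.inl y) = 0 :=
    fun y => hoff.deg_eq (.inl y)
  -- Neither `t` nor `b` can be skipped. So `t` serves as a common base point for connectivity, and
  -- `b` shows that the cycle does not stay inside the pole.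
  have hrt : ∀ v, deg D v ≠ 0 → D.Reachable v (.inr t) := fun v hv =>
    hoff.reachable v _ hv (by simp [hdt])
  by_cases hboth : D.Adj (.inl ⟨a, hua⟩) (.inr s) ∧ D.Adj (.inl ⟨a, hua⟩) (.inr t)
  · -- the cycle turns back at `a`; contract `a` together with the pole
    exfalso
    obtain ⟨has, hat⟩ := hboth
    have hda : deg D (.inl ⟨a, hua⟩) = 2 := (hdeg _).resolve_right (deg_ne_zero has)
    have hadj := adj_iff_of_deg_eq_two hda (by simpa using hst) has hat
    have haZ : a ∈ Z := by
      have := hlink hat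
      apply hε
      grind [link]
    let f : {v // v ≠ u} ⊕ X → V := Sum.elim (fun y => if y.1 = a then u else y) fun _ => u
    have hfa : ∀ y : {v // v ≠ u}, y.1 = a → f (.inl y) = u := fun y hy => if_pos hy
    have hfy : ∀ y : {v // v ≠ u}, y.1 ≠ a → f (.inl y) = y := fun y hy => if_neg hy
    have hfz : ∀ z, f (.inr z) = u := fun z => rfl
    have hyy : ∀ y y' : {v // v ≠ u}, D.Adj (.inl y) (.inl y') → y.1 ≠ a := by
      rintro ⟨y, hy⟩ y' h rfl
      simpa using (hadj _).1 h
    -- Both edges of `D` at `a` lead into the pole, so nothing else can leave the contracted set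
    -- through `a`.
    have huD : ∀ v, (quo f D).Adj u v → v = b ∨ v = c := by
      rintro v ⟨huv, (y | z), (y' | z'), h1, rfl, h⟩
      · have hya := hyy _ _ h
        rw [hfy y hya] at h1
        exact absurd h1 y.2
      · exact absurd rfl huv
      · by_cases hy : y'.1 = a
        · exact absurd (hfa y' hy).symm huv
        · rw [hfy _ hy]
          have := hlink' h
          grind [link]
      · exact absurd rfl huv
    have hle : quo f D ≤ Γ := by
      intro p q h
      by_cases hp : p = u
      · subst hp
        rw [hna]
        exact Or.inr (huD q h)
      · by_cases hq : q = u
        · subst hq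
          rw [hna']
          exact Or.inr (huD p h.symm)
        · obtain ⟨-, (y | z), (y' | z'), h1, h2, h⟩ := h
          · rw [hfy _ (hyy _ _ h)] at h1
            rw [hfy _ (hyy _ _ h.symm)] at h2
            subst h1 h2
            exact hD h
          · exact absurd h2.symm hq
          · exact absurd h1.symm hp
          · exact absurd h1.symm hp
    have hda0 : deg (quo f D) a = 0 := by
      by_contra hne
      obtain ⟨w, -, (y | z), y', h1, -, -⟩ := exists_adj_of_deg_ne_zero hne
      · by_cases hy : y.1 = a
        · rw [hfa y hy] at h1
          exact hua h1.symm
        · rw [hfy y hy] at h1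
          exact hy h1
      · exact hua h1.symm
    have hdq : ∀ y : {v // v ≠ u}, y.1 ≠ a → deg (quo f D) y = deg D (.inl y) := by
      intro y hy
      rw [← hfy y hy]
      apply deg_quo
      · rintro (y' | z') w h1 _
        · by_cases hy' : y'.1 = a
          · rw [hfa y' hy', hfy y hy] at h1
            exact absurd h1.symm y.2
          · rw [hfy y' hy', hfy y hy] at h1
            exact congrArg _ (Subtype.ext h1)
        · rw [hfy y hy] at h1
          exact absurd h1.symm y.2
      · rintro (p | p) hp (q | q) hq h
        · rw [hfy p (hyy _ _ (Adj.symm hp)), hfy q (hyy _ _ (Adj.symm hq))] at h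
          exact congrArg _ (Subtype.ext h)
        · rw [hfy p (hyy _ _ (Adj.symm hp))] at h
          exact absurd h p.2
        · rw [hfy q (hyy _ _ (Adj.symm hq))] at h
          exact absurd h.symm q.2
        · have h1 := hlink hp
          have h2 := hlink hq
          congr 1
          grind [link]
      · rintro (p | p) hp h
        · rw [hfy p (hyy _ _ (Adj.symm hp)), hfy y hy] at h
          exact hp.ne (congrArg _ (Subtype.ext h.symm))
        · rw [hfy y hy] at h
          exact y.2 h.symm
    have hru : ∀ y, y ≠ u → deg (quo f D) y ≠ 0 → (quo f D).Reachable y u := by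
      intro y hyu hy0
      have hya : y ≠ a := by rintro rfl; exact hy0 hda0
      have h1 := hdq ⟨y, hyu⟩ hya
      have := quo_reachable f (hrt (.inl ⟨y, hyu⟩) (by rw [← h1]; exact hy0))
      rwa [hfy ⟨y, hyu⟩ hya] at this
    have hu0 : deg (quo f D) u ≠ 0 := by
      have h1 := hdq ⟨b, hub⟩ hab.symm
      intro h0
      have := hru b hub (by rw [h1, hdb]; norm_num)
      refine hub (mem_of_reachable {u} ?_ this.symm rfl)
      rintro p q hpq rfl
      exact absurd h0 (deg_ne_zero hpq)
    -- The contracted cycle misses `a`, which is permitted because `a ∈ Z`. So it would be `C`, but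
    -- `C` passes through `a`.
    have := hC.eq_of_le _ hle (isCycleOff_of_deg ((deg_le_of_subset_pair huD).trans
      (by norm_num)) hu0 (fun y hyu => ?_) hru)
    · have h2 := hC.ham.deg_eq a
      rw [← this, hda0] at h2
      exact absurd h2 (by norm_num)
    · by_cases hya : y = a
      · subst hya
        exact Or.inr ⟨haZ, hda0⟩
      · rw [hdq ⟨y, hyu⟩ hya]
        exact hdy _
  -- In the remaining case `D` uses at most one of the links at `a`, so contracting just the pole
  -- preserves the degrees outside.
  · have huD : ∀ v, (quo (contract u) D).Adj u v → v = a ∨ v = b ∨ v = c := by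
      rintro v ⟨huv, (y | z), (y' | z'), h1, rfl, h⟩
      · exact absurd h1 y.2
      · exact absurd rfl huv
      · have := hlink' h
        simp only [contract_inl]
        grind [link]
      · exact absurd rfl huv
    have hle : quo (contract u) D ≤ Γ := by
      intro p q h
      by_cases hp : p = u
      · subst hp
        exact (hna q).2 (huD q h)
      · by_cases hq : q = u
        · subst hq
          exact (hna' p).2 (huD p h.symm)
        · obtain ⟨-, (y | z), (y' | z'), h1, h2, h⟩ := h
          · subst h1 h2
            exact hD h
          · exact absurd h2.symm hq
          · exact absurd h1.symm hp
          · exact absurd h1.symm hp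
    have hdq : ∀ y : {v // v ≠ u}, deg (quo (contract u) D) y = deg D (.inl y) := by
      intro y
      apply deg_quo (f := contract u) (x := .inl y)
      · rintro (y' | z') w h1 _
        · exact congrArg _ (Subtype.ext h1)
        · exact absurd h1.symm y.2
      · rintro (p | p) hp (q | q) hq h
        · exact congrArg _ (Subtype.ext h)
        · exact absurd h p.2
        · exact absurd h.symm q.2
        · have h1 := hlink hp
          have h2 := hlink hq
          congr 1
          by_cases hya : y = ⟨a, hua⟩
          · subst hya
            grind [link, mem_neighborSet]
          · have : y.1 ≠ a := fun h => hya (Subtype.ext h)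
            grind [link]
      · rintro (p | p) hp h
        · exact hp.ne (congrArg _ (Subtype.ext h.symm))
        · exact y.2 h.symm
    have hru : ∀ y, y ≠ u → deg (quo (contract u) D) y ≠ 0 →
        (quo (contract u) D).Reachable y u := by
      intro y hyu hy0
      exact quo_reachable (contract u) (hrt (.inl ⟨y, hyu⟩) (by rw [← hdq]; exact hy0))
    have hu0 : deg (quo (contract u) D) u ≠ 0 := by
      intro h0
      have := hru b hub (by rw [hdq ⟨b, hub⟩, hdb]; norm_num)
      refine hub (mem_of_reachable {u} ?_ this.symm rfl)
      rintro p q hpq rfl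
      exact absurd h0 (deg_ne_zero hpq)
    have hDC := hC.eq_of_le _ hle (isCycleOff_of_deg (deg_le_of_subset_triple huD) hu0
      (fun y hyu => by rw [hdq ⟨y, hyu⟩]; exact hdy _) hru)
    have hout : ∀ {y : {v // v ≠ u}} {z}, D.Adj (.inl y) (.inr z) → C.Adj u y := by
      intro y z h
      rw [← hDC]
      exact ⟨y.2.symm, .inr z, .inl y, rfl, rfl, h.symm⟩
    have hin : ∀ y : {v // v ≠ u}, C.Adj u y → ∃ z, D.Adj (.inl y) (.inr z) := by
      intro y h
      rw [← hDC] at h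
      obtain ⟨-, (y1 | z1), (y2 | z2), h1, h2, h⟩ := h
      · exact absurd h1 y1.2
      · exact absurd h1 y1.2
      · obtain rfl : y2 = y := Subtype.ext h2
        exact ⟨z1, h.symm⟩
      · exact absurd h2.symm y.2
    have hnc : ∀ {y : {v // v ≠ u}} {z}, D.Adj (.inl y) (.inr z) → y.1 = a ∨ y.1 = b :=
      fun h => (hca _).1 (hout h)
    have hbt : D.Adj (.inl ⟨b, hub⟩) (.inr t) := by
      obtain ⟨z, hz⟩ := hin ⟨b, hub⟩ ((hca b).2 (Or.inr rfl))
      have := hlink hz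
      have : z = t := by grind [link]
      rwa [this] at hz
    -- Otherwise both edges of `D` at `t` leave the pole, to `a` and to `b`. Then `D` has no edge
    -- between `t` and the rest of the pole, and that rest has no other exit. But `ε` holds in this
    -- case, so `s` lies on `D` and would have to be connected to `t`.
    have hnat : ¬ D.Adj (.inl ⟨a, hua⟩) (.inr t) := by
      intro hat
      have hε' : ε := by
        have := hlink hat
        grind [link]
      have hadj := adj_iff_of_deg_eq_two hdt (by simpa using hab) hat.symm hbt.symm
      have hds : deg D (.inr s) ≠ 0 := by
        rcases hoff.deg_eq (.inr s) with h | h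
        · rw [h]; norm_num
        · exact absurd hε' h.1.2
      have hmem := mem_of_reachable {v | ∃ z, z ≠ t ∧ v = .inr z} ?_ (hrt _ hds) ⟨s, hst, rfl⟩
      · obtain ⟨z, hz, h⟩ := hmem
        exact hz (by simpa using h.symm)
      · rintro v w hvw ⟨z, hz, rfl⟩
        rcases w with y | z'
        · exfalso
          have h1 := hnc hvw.symm
          have h2 := hlink' hvw
          have h3 : z = s ∧ y.1 = a := by grind [link]
          obtain ⟨rfl, h3⟩ := h3
          obtain rfl : y = ⟨a, hua⟩ := Subtype.ext h3
          exact hboth ⟨hvw.symm, hat⟩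
        · refine ⟨z', ?_, rfl⟩
          rintro rfl
          simpa using (hadj _).1 hvw.symm
    have has : D.Adj (.inl ⟨a, hua⟩) (.inr s) := by
      obtain ⟨z, hz⟩ := hin ⟨a, hua⟩ ((hca a).2 (Or.inl rfl))
      have := hlink hz
      have : z = s := by
        have : z ≠ t := by rintro rfl; exact hnat hz
        grind [link]
      rwa [this] at hz
    have hcross : ∀ (y : {v // v ≠ u}) z, D.Adj (.inl y) (.inr z) ↔ cycleLink a b s t y z := by
      rintro ⟨y, hy⟩ z
      constructor
      · intro h
        have h1 := hnc h
        have h2 := hlink h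
        have h3 : y = a → z ≠ t := by rintro rfl rfl; exact hnat h
        grind [link, cycleLink]
      · rintro (⟨rfl, rfl⟩ | ⟨rfl, rfl⟩)
        · exact has
        · exact hbt
    have hsz : ∀ z, deg D (.inr z) = 2 := by
      intro z
      rcases hoff.deg_eq (.inr z) with h | h
      · exact h
      · have h3 : z = s := h.1.1
        subst h3
        exact absurd h.2 (deg_ne_zero has.symm)
    have hQn : ∀ v, (quo (coContract u) D).Adj none v ↔ v = some s ∨ v = some t := by
      intro v
      constructor
      · rintro ⟨h0, (y1 | z1), (y2 | z2), h1, rfl, h⟩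
        · exact absurd rfl h0
        · have := (hcross _ _).1 h
          simp only [coContract_inr, Option.some.injEq]
          grind [cycleLink]
        · exact absurd rfl h0
        · simp at h1
      · rintro (rfl | rfl)
        · exact ⟨by simp, _, _, rfl, rfl, has⟩
        · exact ⟨by simp, _, _, rfl, rfl, hbt⟩
    have hQs : ∀ z z', (quo (coContract u) D).Adj (some z) (some z') ↔ D.Adj (.inr z) (.inr z') := by
      intro z z'
      constructor
      · rintro ⟨h0, (y1 | z1), (y2 | z2), h1, h2, h⟩
        · simp at h1
        · simp at h1
        · simp at h2
        · simp only [coContract_inr, Option.some.injEq] at h1 h2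
          rwa [← h1, ← h2]
      · intro h
        exact ⟨by simpa using h.ne, _, _, rfl, rfl, h⟩
    have hQP : quo (coContract u) D = P := by
      apply hP.eq_of_le
      · rintro (_ | z) (_ | z') h
        · exact absurd rfl h.1
        · have := (hQn _).1 h
          simpa [addVertex] using this
        · have := (hQn _).1 h.symm
          simpa [addVertex] using this
        · exact hD ((hQs _ _).1 h)
      · constructor
        · have : ∀ v, (quo (coContract u) D).Reachable v (some t) := by
            rintro (_ | z)
            · exact ((hQn _).2 (Or.inr rfl)).reachable
            · exact quo_reachable (coContract u) (hrt (.inr z) (by simp [hsz z]))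
          exact fun v w => (this v).trans (this w).symm
        · rintro (_ | z)
          · exact deg_eq_two (by simpa using hst) hQn
          · rw [← hsz z]
            apply deg_quo (f := coContract u) (x := .inr z)
            · rintro (y' | z') w h1 _
              · simp at h1
              · simpa using h1
            · rintro (p | p) hp (q | q) hq h
              · have h1 := (hcross _ _).1 (Adj.symm hp)
                have h2 := (hcross _ _).1 (Adj.symm hq)
                congr 1
                apply Subtype.ext
                grind [cycleLink]
              · simp at h
              · simp at h
              · simpa using h
            · rintro (p | p) hp h
              · simp at h
              · simp only [coContract_inr, Option.some.injEq] at h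
                exact hp.ne (by rw [h])
    ext v w
    rcases v with y | z <;> rcases w with y' | z'
    · change _ ↔ C.Adj y y'
      rw [← hDC]
      constructor
      · intro h
        exact ⟨fun h' => h.ne (congrArg _ (Subtype.ext h')), _, _, rfl, rfl, h⟩
      · rintro ⟨-, (y1 | z1), (y2 | z2), h1, h2, h⟩
        · obtain rfl : y1 = y := Subtype.ext h1
          obtain rfl : y2 = y' := Subtype.ext h2
          exact h
        · exact absurd h2.symm y'.2
        · exact absurd h1.symm y.2
        · exact absurd h1.symm y.2
    · exact hcross y z'
    · rw [D.adj_comm]; exact hcross y' z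
    · change _ ↔ P.Adj (some z) (some z')
      rw [← hQP, hQs]

/-- Replacing a vertex by a pole with a unique hamiltonian path. -/
theorem IsUnique.glue [Finite V] [Finite X] {Γ C : SimpleGraph V} {Z : Set V} {u a b c : V}
    {G : SimpleGraph X} {s t x : X} {P : SimpleGraph (Option X)} {ε : Prop}
    (hC : IsUnique Γ Z C) (hs : IsSite Γ C u a b c) (hst : s ≠ t) (hP : IsUniquePath G s t P)
    (hε : ε → a ∈ Z) (hbZ : b ∉ Z) :
    IsUnique (glue Γ u G (link a b c s t x ε))
      (Sum.elim (fun y => y.1 ∈ Z) fun z => z = s ∧ ¬ε) (glueCycle C u a b s t P) where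
  le := by
    rintro (y | z) (y' | z') h
    · exact hC.le h
    · exact Or.imp_right Or.inl h
    · exact Or.imp_right Or.inl h
    · exact hP.le (show P.Adj (some z) (some z') from h)
  ham := glueCycle_isHamGraph hC.ham hs hst hP
  eq_of_le _ hD hoff := glue_eq_of_le hC hs hst hP hε hbZ hD hoff

/-! ### Replacing a cubic vertex: 3-connectivity -/

/-- The connectivity of a pole that makes it a replacement for a vertex of degree three. -/
structure IsPole (G : SimpleGraph X) (s t x : X) (ε : Prop) : Prop where
  reachable : ∀ z w, G.Reachable z w
  stx : ∀ p q z, z ≠ p → z ≠ q →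
    ∃ w, (w = s ∨ w = t ∨ w = x) ∧ w ≠ p ∧ w ≠ q ∧ (del G {p, q}).Reachable z w
  tx : ∀ p z, z ≠ p → ∃ w, (w = t ∨ w = x) ∧ w ≠ p ∧ (del G {p}).Reachable z w
  st : ∀ p z, z ≠ p → ∃ w, (w = s ∨ w = t) ∧ w ≠ p ∧ (del G {p}).Reachable z w
  sx : ¬ε → ∀ p z, z ≠ p → ∃ w, (w = s ∨ w = x) ∧ w ≠ p ∧ (del G {p}).Reachable z w

section

variable {Γ : SimpleGraph V} {u : V} {G : SimpleGraph X} {R : V → X → Prop}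

lemma glue_reachable_inl {q : {v // v ≠ u}} (hΓ : Robust Γ) {S : Set ({v // v ≠ u} ⊕ X)}
    (hS : ∀ y, .inl y ∈ S → y = q) {y y' : {v // v ≠ u}} (hy : y ≠ q) (hy' : y' ≠ q) :
    (del (glue Γ u G R) S).Reachable (.inl y) (.inl y') := by
  classical
  have := reachable_map (H := del (glue Γ u G R) S)
    (fun v => if h : v ≠ u then .inl ⟨v, h⟩ else .inl y)
    ?_ (hΓ u q y y' y.2 (fun h => hy (Subtype.ext h)) y'.2 (fun h => hy' (Subtype.ext h)))
  · simpa [y.2, y'.2] using this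
  · intro v w ⟨h, hv, hw⟩
    simp only [Set.mem_insert_iff, Set.mem_singleton_iff, not_or] at hv hw
    simp only [hv.1, hw.1, ne_eq, not_false_eq_true, dite_true]
    exact Adj.reachable (G := del (glue Γ u G R) S)
      ⟨h, fun h' => hv.2 (congrArg Subtype.val (hS _ h')),
        fun h' => hw.2 (congrArg Subtype.val (hS _ h'))⟩

lemma glue_reachable_inl' (hΓ : Robust Γ) {S : Set ({v // v ≠ u} ⊕ X)}
    (hS : ∀ y, .inl y ∉ S) (y y' : {v // v ≠ u}) :
    (del (glue Γ u G R) S).Reachable (.inl y) (.inl y') := by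
  classical
  have := reachable_map (H := del (glue Γ u G R) S)
    (fun v => if h : v ≠ u then .inl ⟨v, h⟩ else .inl y)
    ?_ (hΓ u u y y' y.2 y.2 y'.2 y'.2)
  · simpa [y.2, y'.2] using this
  · intro v w ⟨h, hv, hw⟩
    simp only [Set.mem_insert_iff, Set.mem_singleton_iff, not_or] at hv hw
    simp only [hv.1, hw.1, ne_eq, not_false_eq_true, dite_true]
    exact Adj.reachable (G := del (glue Γ u G R) S) ⟨h, hS _, hS _⟩

lemma glue_reachable_inr {T : Set X} {S : Set ({v // v ≠ u} ⊕ X)}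
    (hS : ∀ z, .inr z ∈ S → z ∈ T) {z z' : X} (h : (del G T).Reachable z z') :
    (del (glue Γ u G R) S).Reachable (.inr z) (.inr z') :=
  reachable_map (G := del G T) Sum.inr (fun v w h' => Adj.reachable (G := del (glue Γ u G R) S)
    ⟨(h'.1 : G.Adj v w), fun h'' => h'.2.1 (hS _ h''), fun h'' => h'.2.2 (hS _ h'')⟩) h

end

/-- If both deleted vertices lie outside the pole, the connected pole plays the part of `u`.
Otherwise the surviving outside vertices are connected to each other, since `Γ` minus `u` and one
more vertex is connected, and it suffices to leave the pole from each of its surviving vertices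
through an end whose link survives. -/
theorem Robust.glue {Γ : SimpleGraph V} {u a b c : V} {G : SimpleGraph X} {s t x : X} {ε : Prop}
    (hΓ : Robust Γ) (hn : ∀ v, Γ.Adj u v ↔ v = a ∨ v = b ∨ v = c) (hab : a ≠ b) (hac : a ≠ c)
    (hbc : b ≠ c) (hG : IsPole G s t x ε) : Robust (glue Γ u G (link a b c s t x ε)) := by
  classical
  have hua : a ≠ u := ((hn a).2 (by simp)).ne'
  have hub : b ≠ u := ((hn b).2 (by simp)).ne'
  have huc : c ≠ u := ((hn c).2 (by simp)).ne'
  have hn' : ∀ v, Γ.Adj v u ↔ v = a ∨ v = b ∨ v = c := fun v => by rw [Γ.adj_comm, hn]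
  set Γ' := UniqHam.glue Γ u G (link a b c s t x ε) with hΓ'
  have las : Γ'.Adj (.inr s) (.inl ⟨a, hua⟩) := Or.inl ⟨rfl, rfl⟩
  have lbt : Γ'.Adj (.inr t) (.inl ⟨b, hub⟩) := Or.inr (Or.inl ⟨rfl, rfl⟩)
  have lcx : Γ'.Adj (.inr x) (.inl ⟨c, huc⟩) := Or.inr (Or.inr (Or.inl ⟨rfl, rfl⟩))
  have lat : ε → Γ'.Adj (.inr t) (.inl ⟨a, hua⟩) :=
    fun h => Or.inr (Or.inr (Or.inr ⟨h, rfl, rfl⟩))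
  have combine : ∀ S : Set ({v // v ≠ u} ⊕ X),
      (∀ y y', .inl y ∉ S → .inl y' ∉ S → (del Γ' S).Reachable (.inl y) (.inl y')) →
      (∀ z, .inr z ∉ S → ∃ y, .inl y ∉ S ∧ (del Γ' S).Reachable (.inr z) (.inl y)) →
      ∀ v w, v ∉ S → w ∉ S → (del Γ' S).Reachable v w := by
    intro S h1 h2 v w hv hw
    have : ∀ v, v ∉ S → ∃ y, .inl y ∉ S ∧ (del Γ' S).Reachable v (.inl y) := by
      rintro (y | z) h
      · exact ⟨y, h, Reachable.refl _⟩
      · exact h2 z h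
    obtain ⟨y, hy, hvy⟩ := this v hv
    obtain ⟨y', hy', hwy⟩ := this w hw
    exact (hvy.trans (h1 y y' hy hy')).trans hwy.symm
  have exit : ∀ (S : Set ({v // v ≠ u} ⊕ X)) {z w : X} {y : {v // v ≠ u}},
      (del Γ' S).Reachable (.inr z) (.inr w) → Γ'.Adj (.inr w) (.inl y) → .inr w ∉ S →
      .inl y ∉ S → ∃ y, .inl y ∉ S ∧ (del Γ' S).Reachable (.inr z) (.inl y) :=
    fun S z w y h hwy hw hy => ⟨y, hy, h.trans (Adj.reachable (G := del Γ' S) ⟨hwy, hw, hy⟩)⟩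
  -- One deleted vertex on each side: the fields `tx`, `sx`, `st` of `IsPole` provide an exit when
  -- `q` is `a`, when `q` is `b`, and in all other cases.
  have mixed : ∀ (q : {v // v ≠ u}) (p : X) (S : Set ({v // v ≠ u} ⊕ X)),
      (∀ v, v ∈ S ↔ v = .inl q ∨ v = .inr p) →
      ∀ v w, v ∉ S → w ∉ S → (del Γ' S).Reachable v w := by
    intro q p S hS
    have hSl : ∀ y, .inl y ∈ S ↔ y = q := fun y => by simp [hS]
    have hSr : ∀ y, .inr y ∈ S ↔ y = p := fun y => by simp [hS]
    refine combine S (fun y y' hy hy' => glue_reachable_inl hΓ (q := q) (fun y h => (hSl y).1 h)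
      (fun h => hy ((hSl y).2 h)) (fun h => hy' ((hSl y').2 h))) fun z hz => ?_
    rw [hSr] at hz
    have hT : ∀ z, .inr z ∈ S → z ∈ ({p} : Set X) := fun z h => (hSr z).1 h
    by_cases hqa : q.1 = a
    · obtain ⟨w, hw, hwp, hzw⟩ := hG.tx p z hz
      have hzw' := glue_reachable_inr (R := link a b c s t x ε) (Γ := Γ) hT hzw
      rcases hw with rfl | rfl
      · refine exit S hzw' lbt (by rwa [hSr]) (by rw [hSl]; rintro rfl; exact hab hqa.symm)
      · refine exit S hzw' lcx (by rwa [hSr]) (by rw [hSl]; rintro rfl; exact hac hqa.symm)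
    · have hSa : .inl ⟨a, hua⟩ ∉ S := by rw [hSl]; rintro rfl; exact hqa rfl
      by_cases hqb : q.1 = b
      -- When `b` is deleted and `ε` holds, `t` still has its link to `a`, so `st` does the work of
      -- `sx`.
      · by_cases hε : ε
        · obtain ⟨w, hw, hwp, hzw⟩ := hG.st p z hz
          have hzw' := glue_reachable_inr (R := link a b c s t x ε) (Γ := Γ) hT hzw
          rcases hw with rfl | rfl
          · exact exit S hzw' las (by rwa [hSr]) hSa
          · exact exit S hzw' (lat hε) (by rwa [hSr]) hSa
        · obtain ⟨w, hw, hwp, hzw⟩ := hG.sx hε p z hz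
          have hzw' := glue_reachable_inr (R := link a b c s t x ε) (Γ := Γ) hT hzw
          rcases hw with rfl | rfl
          · exact exit S hzw' las (by rwa [hSr]) hSa
          · exact exit S hzw' lcx (by rwa [hSr]) (by rw [hSl]; rintro rfl; exact hbc hqb.symm)
      · obtain ⟨w, hw, hwp, hzw⟩ := hG.st p z hz
        have hzw' := glue_reachable_inr (R := link a b c s t x ε) (Γ := Γ) hT hzw
        rcases hw with rfl | rfl
        · exact exit S hzw' las (by rwa [hSr]) hSa
        · exact exit S hzw' lbt (by rwa [hSr]) (by rw [hSl]; rintro rfl; exact hqb rfl)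
  rintro (p | p) (q | q) v w hvp hvq hwp hwq
  · have hX : ∀ z, (del Γ' {.inl p, .inl q}).Reachable (.inr z) (.inr s) := by
      intro z
      refine glue_reachable_inr (T := ∅) (by simp) ?_
      exact (hG.reachable z s).mono fun _ _ h => ⟨h, by simp, by simp⟩
    let f : V → {v // v ≠ u} ⊕ X := fun v => if h : v = u then .inr s else .inl ⟨v, h⟩
    have key : ∀ v, v ≠ p.1 → v ≠ q.1 → (del Γ' {.inl p, .inl q}).Reachable (f v) (.inr s) := by
      intro v hvp hvq
      have := reachable_map (H := del Γ' {.inl p, .inl q}) f ?_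
        (hΓ p q v u hvp hvq p.2.symm q.2.symm)
      · simpa [f] using this
      · intro v w ⟨h, hv, hw⟩
        have aux : ∀ v (hv : v ≠ u), v ≠ p.1 → v ≠ q.1 → Γ.Adj v u →
            (del Γ' {.inl p, .inl q}).Reachable (.inl ⟨v, hv⟩) (.inr s) := by
          intro v hv h1 h2 h
          have h3 : (.inl ⟨v, hv⟩ : {v // v ≠ u} ⊕ X) ∉ ({.inl p, .inl q} : Set _) := by
            simp [Subtype.ext_iff, h1, h2]
          rcases (hn' v).1 h with rfl | rfl | rfl
          · exact Adj.reachable (G := del Γ' _) ⟨las.symm, h3, by simp⟩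
          · exact (Adj.reachable (G := del Γ' _) ⟨lbt.symm, h3, by simp⟩).trans (hX t)
          · exact (Adj.reachable (G := del Γ' _) ⟨lcx.symm, h3, by simp⟩).trans (hX x)
        simp only [Set.mem_insert_iff, Set.mem_singleton_iff, not_or] at hv hw
        by_cases hvu : v = u
        · by_cases hwu : w = u
          · rw [hvu, hwu]
          · subst hvu
            simpa [f, hwu] using (aux _ hwu hw.1 hw.2 h.symm).symm
        · by_cases hwu : w = u
          · subst hwu
            simpa [f, hvu] using aux _ hvu hv.1 hv.2 h
          · simp only [f, hvu, hwu, dite_false]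
            exact Adj.reachable (G := del Γ' _)
              ⟨h, by simp [Subtype.ext_iff, hv], by simp [Subtype.ext_iff, hw]⟩
    have key' : ∀ v, v ≠ .inl p → v ≠ .inl q →
        (del Γ' {.inl p, .inl q}).Reachable v (.inr s) := by
      rintro (y | z) h1 h2
      · have := key y (fun h => h1 (congrArg _ (Subtype.ext h)))
          (fun h => h2 (congrArg _ (Subtype.ext h)))
        simpa [f, y.2] using this
      · exact hX z
    exact (key' v hvp hvq).trans (key' w hwp hwq).symm
  · exact mixed p q _ (by simp) v w (by simp [hvp, hvq]) (by simp [hwp, hwq])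
  · exact mixed q p _ (by simp [or_comm]) v w (by simp [hvp, hvq]) (by simp [hwp, hwq])
  · refine combine {.inr p, .inr q} (fun y y' _ _ => glue_reachable_inl' hΓ (by simp) y y')
      (fun z hz => ?_) v w (by simp [hvp, hvq]) (by simp [hwp, hwq])
    simp only [Set.mem_insert_iff, Sum.inr.injEq, Set.mem_singleton_iff, not_or] at hz
    obtain ⟨w, hw, hwp, hwq, hzw⟩ := hG.stx p q z hz.1 hz.2
    have hzw' := glue_reachable_inr (R := link a b c s t x ε) (Γ := Γ) (u := u) (S := {.inr p, .inr q})
      (by simp) hzw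
    have hwS : (.inr w : {v // v ≠ u} ⊕ X) ∉ ({.inr p, .inr q} : Set _) := by simp [hwp, hwq]
    rcases hw with rfl | rfl | rfl
    · exact exit _ hzw' las hwS (by simp)
    · exact exit _ hzw' lbt hwS (by simp)
    · exact exit _ hzw' lcx hwS (by simp)

/-! ### Degrees after a replacement -/

section

variable [Finite V] [Finite X] {Γ : SimpleGraph V} {u : V} {G : SimpleGraph X}
  {R : V → X → Prop}

lemma deg_glue_inl (y : {v // v ≠ u}) :
    deg (glue Γ u G R) (.inl y) = {v | v ≠ u ∧ Γ.Adj y v}.ncard + {z | R y z}.ncard := by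
  have : (glue Γ u G R).neighborSet (.inl y) =
      Sum.inl '' {v | Γ.Adj y v.1} ∪ Sum.inr '' {z | R y z} := by
    ext (v | z) <;> simp
  rw [deg, this, Set.ncard_union_eq (by
    rw [Set.disjoint_left]; rintro _ ⟨v, -, rfl⟩ ⟨z, -, h⟩; cases h) (Set.toFinite _)
    (Set.toFinite _), Set.ncard_image_of_injective _ Sum.inl_injective,
    Set.ncard_image_of_injective _ Sum.inr_injective,
    ← Set.ncard_image_of_injective _ Subtype.val_injective]
  congr 2
  ext v
  simp [and_comm]

lemma deg_glue_inr (z : X) :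
    deg (glue Γ u G R) (.inr z) = deg G z + {y | y ≠ u ∧ R y z}.ncard := by
  have : (glue Γ u G R).neighborSet (.inr z) =
      Sum.inl '' {v | R v.1 z} ∪ Sum.inr '' G.neighborSet z := by
    ext (v | z) <;> simp
  rw [deg, this, Set.ncard_union_eq (by
    rw [Set.disjoint_left]; rintro _ ⟨v, -, rfl⟩ ⟨z, -, h⟩; cases h) (Set.toFinite _)
    (Set.toFinite _), Set.ncard_image_of_injective _ Sum.inl_injective,
    Set.ncard_image_of_injective _ Sum.inr_injective,
    ← Set.ncard_image_of_injective _ Subtype.val_injective, add_comm, deg]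
  congr 2
  ext v
  simp [and_comm]

end

/-- The degrees of the vertices outside of the pole. -/
lemma deg_glue_link_inl [Finite V] [Finite X] {Γ : SimpleGraph V} {u a b c : V}
    {G : SimpleGraph X} {s t x : X} {ε : Prop}
    (hn : ∀ v, Γ.Adj u v ↔ v = a ∨ v = b ∨ v = c) (hab : a ≠ b) (hac : a ≠ c) (hbc : b ≠ c)
    (y : {v // v ≠ u}) (hy : ¬(ε ∧ y.1 = a)) :
    deg (glue Γ u G (link a b c s t x ε)) (.inl y) = deg Γ y := by
  rw [deg_glue_inl]
  by_cases hu : Γ.Adj y u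
  · have hz : ∃ z, {z | link a b c s t x ε y z} = {z} := by
      rcases (hn _).1 hu.symm with h | h | h
      · exact ⟨s, by ext z; simp only [Set.mem_ofPred_eq, Set.mem_singleton_iff, link]; grind⟩
      · exact ⟨t, by ext z; simp only [Set.mem_ofPred_eq, Set.mem_singleton_iff, link]; grind⟩
      · exact ⟨x, by ext z; simp only [Set.mem_ofPred_eq, Set.mem_singleton_iff, link]; grind⟩
    obtain ⟨z, hz⟩ := hz
    rw [hz, Set.ncard_singleton, deg, ← Set.ncard_insert_of_notMem (a := u) (by simp)
      (Set.toFinite _)]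
    congr 1
    ext v
    simp only [Set.mem_insert_iff, Set.mem_ofPred_eq, mem_neighborSet]
    grind
  · have hz : {z | link a b c s t x ε y z} = ∅ := by
      ext z
      have : ¬ (y.1 = a ∨ y.1 = b ∨ y.1 = c) := fun h => hu ((hn _).2 h).symm
      simp only [Set.mem_ofPred_eq, Set.mem_empty_iff_false, link]
      grind
    rw [hz, Set.ncard_empty, deg, add_zero]
    congr 1
    ext v
    simp only [Set.mem_ofPred_eq, mem_neighborSet]
    grind

/-- The degree of the vertex that is linked to the pole twice. -/
lemma deg_glue_link_twice [Finite V] [Finite X] {Γ : SimpleGraph V} {u a b c : V}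
    {G : SimpleGraph X} {s t x : X} {ε : Prop}
    (hn : ∀ v, Γ.Adj u v ↔ v = a ∨ v = b ∨ v = c) (hab : a ≠ b) (hac : a ≠ c)
    (hst : s ≠ t) (hε : ε) (ha : a ≠ u) :
    deg (glue Γ u G (link a b c s t x ε)) (.inl ⟨a, ha⟩) = deg Γ a + 1 := by
  have hu : Γ.Adj a u := ((hn a).2 (Or.inl rfl)).symm
  rw [deg_glue_inl]
  have hz : {z | link a b c s t x ε a z} = {s, t} := by
    ext z; simp only [Set.mem_ofPred_eq, Set.mem_singleton_iff, Set.mem_insert_iff, link]; grind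
  rw [hz, Set.ncard_pair hst, deg,
    show Γ.neighborSet a = insert u {v | v ≠ u ∧ Γ.Adj a v} by
      ext v
      simp only [Set.mem_insert_iff, Set.mem_ofPred_eq, mem_neighborSet]
      grind, Set.ncard_insert_of_notMem (a := u) (by simp) (Set.toFinite _)]

open scoped Classical in
/-- The degrees of the vertices of the pole. -/
lemma deg_glue_link_inr [Finite V] [Finite X] {Γ : SimpleGraph V} {u a b c : V}
    {G : SimpleGraph X} {s t x : X} {ε : Prop}
    (hn : ∀ v, Γ.Adj u v ↔ v = a ∨ v = b ∨ v = c) (hab : a ≠ b)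
    (hst : s ≠ t) (hsx : s ≠ x) (htx : t ≠ x) (z : X) :
    deg (glue Γ u G (link a b c s t x ε)) (.inr z) = deg G z +
      if z = s then 1 else if z = t then (if ε then 2 else 1) else if z = x then 1 else 0 := by
  have hua : a ≠ u := ((hn a).2 (by simp)).ne'
  have hub : b ≠ u := ((hn b).2 (by simp)).ne'
  have huc : c ≠ u := ((hn c).2 (by simp)).ne'
  rw [deg_glue_inr]
  congr 1
  split_ifs with h1 h2 h3 h4
  · rw [Set.ncard_eq_one]
    exact ⟨a, by ext; simp only [Set.mem_ofPred_eq, Set.mem_singleton_iff, link]; grind⟩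
  · rw [← Set.ncard_pair hab]
    congr 1
    ext; simp only [Set.mem_ofPred_eq, Set.mem_singleton_iff, Set.mem_insert_iff, link]; grind
  · rw [Set.ncard_eq_one]
    exact ⟨b, by ext; simp only [Set.mem_ofPred_eq, Set.mem_singleton_iff, link]; grind⟩
  · rw [Set.ncard_eq_one]
    exact ⟨c, by ext; simp only [Set.mem_ofPred_eq, Set.mem_singleton_iff, link]; grind⟩
  · rw [Set.ncard_eq_zero (Set.toFinite _)]
    ext; simp only [Set.mem_ofPred_eq, Set.mem_empty_iff_false, link]; grind

/-! ### The poles that come from a seed -/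

/-- The hamiltonian path of `addVertex G {s, t}` from the new vertex to `t`. -/
def extendPath (P : SimpleGraph (Option X)) (s t : X) : SimpleGraph (Option (Option X)) :=
  addVertex (addVertex (P.comap some) {s}) {none, some t}

/-- A hamiltonian path from the new vertex to `t` cannot begin with the step to `t`, its last
vertex. So it steps to `s` and continues with a hamiltonian path from `s` to `t`. -/
lemma isUniquePath_extend [Finite X] {G : SimpleGraph X} {s t : X} {P : SimpleGraph (Option X)}
    (hst : s ≠ t) (hP : IsUniquePath G s t P) :
    IsUniquePath (addVertex G {s, t}) none (some t) (extendPath P s t) := by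
  have hPn := none_adj_iff (hP.ham.deg_eq none) hP.le
  have hPn' : ∀ v, P.Adj (some v) none ↔ v = s ∨ v = t := fun v => by
    rw [P.adj_comm, hPn]; simp
  -- The vertex `none` closes the path to a cycle, and `some none` is the new vertex of the pole.
  -- Merging them by `f` turns a cycle for the extended pole into one for the original pole.
  let f : Option (Option X) → Option X := fun o => o.getD none
  refine ⟨?_, ⟨?_, ?_⟩, ?_⟩
  · apply addVertex_mono _ subset_rfl
    exact addVertex_mono (fun v w h => hP.le (show P.Adj (some v) (some w) from h)) (by simp)
  · have hz : (extendPath P s t).Adj none (some none) := Or.inl rfl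
    have hzs : (extendPath P s t).Adj (some none) (some (some s)) := rfl
    have hnt : (extendPath P s t).Adj none (some (some t)) := Or.inr rfl
    have key : ∀ o, (extendPath P s t).Reachable o none := by
      have h1 : ∀ o : Option X, (extendPath P s t).Reachable
          (o.elim none fun v => some (some v)) none := by
        intro o
        refine reachable_map (H := extendPath P s t) (fun o : Option X =>
          o.elim none fun v => some (some v)) ?_ (hP.ham.reachable o none)
        rintro (_ | v) (_ | w) h
        · exact absurd rfl h.ne
        · rcases (hPn _).1 h with h | h
          · obtain rfl := Option.some_injective _ h
            exact hz.reachable.trans hzs.reachable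
          · obtain rfl := Option.some_injective _ h
            exact hnt.reachable
        · rcases (hPn' _).1 h with rfl | rfl
          · exact (hz.reachable.trans hzs.reachable).symm
          · exact hnt.reachable.symm
        · exact Adj.reachable (G := extendPath P s t) h
      rintro (_ | _ | v)
      · exact Reachable.refl _
      · exact hz.symm.reachable
      · exact h1 (some v)
    exact fun v w => (key v).trans (key w).symm
  · rintro (_ | _ | v)
    · exact deg_eq_two (p := some none) (q := some (some t)) (by simp) (by
        rintro (_ | _ | w) <;> simp [extendPath])
    · exact deg_eq_two (p := none) (q := some (some s)) (by simp) (by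
        rintro (_ | _ | w) <;> simp [extendPath])
    · rw [← hP.ham.deg_eq (some v)]
      have : quo f (extendPath P s t) = P := by
        ext p q
        constructor
        · rintro ⟨h0, (_ | _ | x), (_ | _ | y), rfl, rfl, h⟩
          · exact absurd rfl h0
          · exact absurd rfl h0
          · exact (hPn _).2 (Or.inr (congrArg some (by simpa [extendPath] using h)))
          · exact absurd rfl h0
          · exact absurd rfl h0
          · exact (hPn _).2 (Or.inl (congrArg some (by simpa [extendPath] using h)))
          · exact (hPn' _).2 (Or.inr (by simpa [extendPath] using h))
          · exact (hPn' _).2 (Or.inl (by simpa [extendPath] using h))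
          · exact h
        · intro h
          refine ⟨h.ne, ?_⟩
          rcases p with _ | p <;> rcases q with _ | q
          · exact absurd rfl h.ne
          · rcases (hPn _).1 h with h | h
            · exact ⟨some none, some (some q), rfl, rfl, Option.some_injective _ h⟩
            · exact ⟨none, some (some q), rfl, rfl, Or.inr h⟩
          · rcases (hPn' _).1 h with h | h
            · exact ⟨some (some p), some none, rfl, rfl, h⟩
            · exact ⟨some (some p), none, rfl, rfl, Or.inr (congrArg some h)⟩
          · exact ⟨some (some p), some (some q), rfl, rfl, h⟩
      have hd := congrArg (fun H => deg H (some v)) this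
      refine Eq.trans (Eq.symm (deg_quo (f := f) (x := some (some v)) ?_ ?_ ?_)) hd
      · rintro (_ | _ | x) y h _
        · cases h
        · cases h
        · exact congrArg some h
      · rintro (_ | _ | x) hx (_ | _ | y) hy h
        · rfl
        · have h1 : v = t := by simpa [extendPath] using hx
          have h2 : v = s := by simpa [extendPath] using hy
          exact absurd (h2.symm.trans h1) hst
        · cases h
        · have h1 : v = t := by simpa [extendPath] using hy
          have h2 : v = s := by simpa [extendPath] using hx
          exact absurd (h2.symm.trans h1) hst
        · rfl
        · cases h
        · cases h
        · cases h
        · exact congrArg some h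
      · rintro (_ | _ | x) hx h
        · cases h
        · cases h
        · have : x = v := Option.some_injective _ h
          exact hx.ne (by rw [this])
  · intro Q hle hQ
    have hQn := none_adj_iff (hQ.deg_eq none) hle
    have hQn' : ∀ v, Q.Adj v none ↔ v = some none ∨ v = some (some t) := fun v => by
      rw [Q.adj_comm, hQn]
    obtain ⟨v, hv⟩ : ∃ v, ∀ w, Q.Adj (some none) w ↔ w = none ∨ w = some (some v) := by
      obtain ⟨x, y, hxy, h⟩ := deg_eq_two_iff.1 (hQ.deg_eq (some none))
      have h0 := (h none).1 ((hQn' _).2 (Or.inl rfl))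
      have hx : ∀ z, Q.Adj (some none) z → z ≠ none → ∃ v, z = some (some v) := by
        rintro (_ | _ | v) h1 h2
        · exact absurd rfl h2
        · exact absurd rfl h1.ne
        · exact ⟨v, rfl⟩
      rcases h0 with rfl | rfl
      · obtain ⟨v, rfl⟩ := hx y ((h y).2 (Or.inr rfl)) hxy.symm
        exact ⟨v, h⟩
      · obtain ⟨v, rfl⟩ := hx x ((h x).2 (Or.inl rfl)) hxy
        exact ⟨v, fun w => by rw [h]; tauto⟩
    have hvst : v = s ∨ v = t := by
      simpa using hle ((hv _).2 (Or.inr rfl))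
    have hvs : v = s := by
      -- If `some none` were followed by `t`, then `none`, `some none` and `t` would form a triangle
      -- of `Q` that misses `s`.
      refine hvst.resolve_right ?_
      rintro rfl
      have hadj := adj_iff_of_deg_eq_two (hQ.deg_eq (some (some v))) (p := none) (q := some none)
        (by simp) ((hQn' _).2 (Or.inr rfl)) ((hv _).2 (Or.inr rfl)).symm
      have := mem_of_reachable ({none, some none, some (some v)} : Set (Option (Option X))) ?_
        (hQ.reachable none (some (some s))) (by simp)
      · simp [hst] at this
      · intro x y hxy hx
        simp only [Set.mem_insert_iff, Set.mem_singleton_iff] at hx ⊢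
        rcases hx with rfl | rfl | rfl
        · have := (hQn _).1 hxy; tauto
        · have := (hv _).1 hxy; tauto
        · have := (hadj _).1 hxy; tauto
    subst hvs
    have hzv : ∀ w, Q.Adj w (some none) ↔ w = none ∨ w = some (some v) := fun w => by
      rw [Q.adj_comm, hv]
    have hQss : ∀ x y, (quo f Q).Adj (some x) (some y) ↔ Q.Adj (some (some x)) (some (some y)) := by
      intro x y
      constructor
      · rintro ⟨h0, (_ | _ | a), (_ | _ | b), h1, h2, h⟩
        · cases h1
        · cases h1
        · cases h1
        · cases h1
        · cases h1
        · cases h1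
        · cases h2
        · cases h2
        · have h1 : a = x := Option.some_injective _ h1
          have h2 : b = y := Option.some_injective _ h2
          rwa [← h1, ← h2]
      · intro h
        exact ⟨by simpa using h.ne, _, _, rfl, rfl, h⟩
    have hQP : quo f Q = P := by
      apply hP.eq_of_le
      · rintro (_ | x) (_ | y) h
        · exact absurd rfl h.1
        · obtain ⟨h0, (_ | _ | a), (_ | _ | b), h1, h2, h⟩ := h
          · cases h2
          · cases h2
          · have h2 : b = y := Option.some_injective _ h2
            have := (hQn _).1 h
            simp only [reduceCtorEq, Option.some.injEq, false_or] at this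
            exact Or.inr (by simp [← h2, this])
          · cases h2
          · cases h2
          · have h2 : b = y := Option.some_injective _ h2
            have := (hv _).1 h
            simp only [reduceCtorEq, Option.some.injEq, false_or] at this
            exact Or.inl (by simp [← h2, this])
          · cases h1
          · cases h1
          · cases h1
        · obtain ⟨h0, (_ | _ | a), (_ | _ | b), h1, h2, h⟩ := h
          · cases h1
          · cases h1
          · cases h1
          · cases h1
          · cases h1
          · cases h1
          · have h1 : a = x := Option.some_injective _ h1
            have := (hQn' _).1 h
            simp only [reduceCtorEq, Option.some.injEq, false_or] at this
            exact Or.inr (by simp [← h1, this])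
          · have h1 : a = x := Option.some_injective _ h1
            have := (hzv _).1 h
            simp only [reduceCtorEq, Option.some.injEq, false_or] at this
            exact Or.inl (by simp [← h1, this])
          · cases h2
        · exact hle ((hQss _ _).1 h)
      · constructor
        · rintro v w
          have hf : ∀ o : Option X, ∃ x, f x = o := fun o => ⟨some o, rfl⟩
          obtain ⟨x, rfl⟩ := hf v
          obtain ⟨y, rfl⟩ := hf w
          exact quo_reachable f (hQ.reachable x y)
        · rintro (_ | x)
          · refine deg_eq_two (p := some v) (q := some t) (by simpa using hst) ?_
            intro w
            constructor
            · rintro ⟨h0, (_ | _ | a), (_ | _ | b), h1, rfl, h⟩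
              · exact absurd rfl h0
              · exact absurd rfl h0
              · have := (hQn _).1 h
                simp only [reduceCtorEq, Option.some.injEq, false_or] at this
                exact Or.inr (congrArg some this)
              · exact absurd rfl h0
              · exact absurd rfl h0
              · have := (hv _).1 h
                simp only [reduceCtorEq, Option.some.injEq, false_or] at this
                exact Or.inl (congrArg some this)
              · cases h1
              · cases h1
              · cases h1
            · rintro (rfl | rfl)
              · exact ⟨by simp, _, _, rfl, rfl, (hv _).2 (Or.inr rfl)⟩
              · exact ⟨by simp, none, _, rfl, rfl, (hQn _).2 (Or.inr rfl)⟩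
          · rw [← hQ.deg_eq (some (some x))]
            refine deg_quo (f := f) (x := some (some x)) ?_ ?_ ?_
            · rintro (_ | _ | a) y h _
              · cases h
              · cases h
              · exact congrArg some h
            · rintro (_ | _ | a) ha (_ | _ | b) hb h
              · rfl
              · have h1 := (hQn' _).1 ha
                have h2 := (hzv _).1 hb
                simp only [reduceCtorEq, Option.some.injEq, false_or] at h1 h2
                exact absurd (h2.symm.trans h1) hst
              · cases h
              · have h1 := (hQn' _).1 hb
                have h2 := (hzv _).1 ha
                simp only [reduceCtorEq, Option.some.injEq, false_or] at h1 h2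
                exact absurd (h2.symm.trans h1) hst
              · rfl
              · cases h
              · cases h
              · cases h
              · exact congrArg some h
            · rintro (_ | _ | a) ha h
              · cases h
              · cases h
              · have : a = x := Option.some_injective _ h
                exact ha.ne (by rw [this])
    ext p q
    rcases p with _ | _ | p <;> rcases q with _ | _ | q
    · simp
    · rw [hQn]; simp [extendPath]
    · rw [hQn]; simp [extendPath]
    · rw [hQn']; simp [extendPath]
    · simp
    · rw [hv]; simp [extendPath]
    · rw [hQn']; simp [extendPath]
    · rw [hzv]; simp [extendPath]
    · rw [← hQss, hQP]; simp [extendPath]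

/-- What is needed of a seed. -/
structure IsSeedPole (G : SimpleGraph X) (s t x : X) : Prop where
  hst : s ≠ t
  hsx : s ≠ x
  htx : t ≠ x
  deg_s : deg G s = 3
  deg_t : deg G t = 2
  deg_x : deg G x = 3
  deg_eq : ∀ v, v ≠ s → v ≠ t → v ≠ x → deg G v = 4
  path : ∃ P, IsUniquePath G s t P
  pole : IsPole G s t x True
  pole_extend : IsPole (addVertex G {s, t}) none (some t) (some x) False

/-- Here `some none` is the vertex `v`, joined to `t` and `x`, and `none` is `v'`, joined to `v`,
`s` and `t`. After two deletions each surviving vertex of `G` must still reach a surviving one of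
`v` and `v'`, and it can leave `G` only through an end. Deleting `v'` leaves the exits `t`, `x`;
deleting `v` leaves `s`, `t`. -/
lemma isPole_of_robust {G : SimpleGraph X} {s t x : X}
    (h : Robust (addVertex (addVertex G {t, x}) {none, some s, some t})) :
    IsPole G s t x True := by
  set W := addVertex (addVertex G {t, x}) {none, some s, some t} with hW
  let f : X → Option (Option X) := fun z => some (some z)
  have hadj : ∀ (y : X) (z : Option (Option X)), W.Adj (f y) z → z ∉ Set.range f →
      z = none ∧ (y = s ∨ y = t) ∨ z = some none ∧ (y = t ∨ y = x) := by
    rintro y (_ | _ | z) h1 h2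
    · exact Or.inl ⟨rfl, by simpa [f, hW] using h1⟩
    · exact Or.inr ⟨rfl, by simpa [f, hW] using h1⟩
    · exact absurd ⟨z, rfl⟩ h2
  have hn1 : (none : Option (Option X)) ∉ Set.range f := by simp [f]
  have hn2 : (some none : Option (Option X)) ∉ Set.range f := by simp [f]
  refine ⟨fun z w => ?_, fun p q z hzp hzq => ?_, fun p z hzp => ?_, fun p z hzp => ?_,
    fun h => absurd trivial h⟩
  · have := h none (some none) (f z) (f w) (by simp [f]) (by simp [f]) (by simp [f]) (by simp [f])
    refine reachable_map (fun o => (o.getD none).getD z) ?_ this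
    rintro (_ | _ | a) (_ | _ | b) ⟨h1, h2, h3⟩ <;> simp at h2 h3
    exact Adj.reachable (G := G) h1
  · obtain ⟨y, hy, w, hw, hyw⟩ := exists_exit (del W {f p, f q}) (del G {p, q}) f
      (fun x y hxy => ⟨hxy.1, fun h' => hxy.2.1 (by simpa [f] using h'),
        fun h' => hxy.2.2 (by simpa [f] using h')⟩)
      (h (f p) (f q) (f z) none (by simpa [f]) (by simpa [f]) (by simp [f]) (by simp [f])) hn1
    have h1 := hyw.2.1
    simp only [f, Set.mem_insert_iff, Option.some.injEq, Set.mem_singleton_iff, not_or] at h1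
    have h2 := hadj y w hyw.1 hw
    exact ⟨y, by tauto, h1.1, h1.2, hy⟩
  · obtain ⟨y, hy, w, hw, hyw⟩ := exists_exit (del W {f p, none}) (del G {p}) f
      (fun x y hxy => ⟨hxy.1, fun h' => hxy.2.1 (by simpa [f] using h'),
        fun h' => hxy.2.2 (by simpa [f] using h')⟩)
      (h (f p) none (f z) (some none) (by simpa [f]) (by simp [f]) (by simp [f]) (by simp)) hn2
    have h1 := hyw.2.1
    simp only [f, Set.mem_insert_iff, Option.some.injEq, Set.mem_singleton_iff, not_or] at h1
    have h2 := hadj y w hyw.1 hw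
    have h3 : w ≠ none := fun h' => hyw.2.2 (by simp [h'])
    exact ⟨y, by tauto, h1.1, hy⟩
  · obtain ⟨y, hy, w, hw, hyw⟩ := exists_exit (del W {f p, some none}) (del G {p}) f
      (fun x y hxy => ⟨hxy.1, fun h' => hxy.2.1 (by simpa [f] using h'),
        fun h' => hxy.2.2 (by simpa [f] using h')⟩)
      (h (f p) (some none) (f z) none (by simpa [f]) (by simp [f]) (by simp [f]) (by simp)) hn1
    have h1 := hyw.2.1
    simp only [f, Set.mem_insert_iff, Option.some.injEq, Set.mem_singleton_iff, not_or] at h1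
    have h2 := hadj y w hyw.1 hw
    have h3 : w ≠ some none := fun h' => hyw.2.2 (by simp [h'])
    exact ⟨y, by tauto, h1.1, hy⟩

/-- The extended pole is the 3-connected graph without `v`, hence it remains connected after one
deletion, and any surviving end will do. After two deletions, connection to `v` provides an exit,
since the neighbours of `v` are exactly the three ends. -/
lemma isPole_extend_of_robust {G : SimpleGraph X} {s t x : X} (htx : t ≠ x)
    (h : Robust (addVertex (addVertex G {t, x}) {none, some s, some t})) :
    IsPole (addVertex G {s, t}) none (some t) (some x) False := by
  set W := addVertex (addVertex G {t, x}) {none, some s, some t} with hW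
  let f : Option X → Option (Option X) := fun o => o.elim none fun z => some (some z)
  have hfi : Function.Injective f := by
    rintro (_ | a) (_ | b) hab <;> simp [f] at hab ⊢
    exact hab
  have hG : ∀ x y, W.Adj (f x) (f y) → (addVertex G {s, t}).Adj x y := by
    rintro (_ | a) (_ | b) hab
    · exact hab
    · simpa [f, hW] using hab
    · simpa [f, hW] using hab
    · exact hab
  have hn : (some none : Option (Option X)) ∉ Set.range f := by
    rintro ⟨(_ | z), hz⟩ <;> simp [f] at hz
  have hn' : ∀ z, f z ≠ some none := fun z hz => hn ⟨z, hz⟩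
  have hadj : ∀ (y : Option X) (z : Option (Option X)), W.Adj (f y) z → z ∉ Set.range f →
      y = none ∨ y = some t ∨ y = some x := by
    rintro y (_ | _ | z) h1 h2
    · exact absurd ⟨none, rfl⟩ h2
    · rcases y with _ | y
      · exact Or.inl rfl
      · right; simpa [f, hW] using h1
    · exact absurd ⟨some z, rfl⟩ h2
  have hall : ∀ p z w : Option X, z ≠ p → w ≠ p →
      (del (addVertex G {s, t}) {p}).Reachable z w := by
    intro p z w hz hw
    have := h (f p) (some none) (f z) (f w) (hfi.ne hz) (hn' z) (hfi.ne hw) (hn' w)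
    have h2 := reachable_map (H := del (addVertex G {s, t}) {p}) (fun o => o.getD none) ?_ this
    · rcases z with _ | z <;> rcases w with _ | w <;> exact h2
    · rintro a b ⟨h1, h2, h3⟩
      simp only [Set.mem_insert_iff, Set.mem_singleton_iff, not_or] at h2 h3
      have hr : ∀ o : Option (Option X), o ≠ some none → o = f (o.getD none) := by
        rintro (_ | _ | o) ho
        · rfl
        · exact absurd rfl ho
        · rfl
      rw [hr a h2.2, hr b h3.2] at h1
      refine Adj.reachable (G := del (addVertex G {s, t}) {p}) ⟨hG _ _ h1, ?_, ?_⟩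
      · rintro (rfl : _ = p); exact h2.1 (hr a h2.2)
      · rintro (rfl : _ = p); exact h3.1 (hr b h3.2)
  have hpick : ∀ (a b p z : Option X), a ≠ b → z ≠ p → ∃ w, (w = a ∨ w = b) ∧ w ≠ p ∧
      (del (addVertex G {s, t}) {p}).Reachable z w := by
    intro a b p z hab hz
    by_cases ha : a = p
    · exact ⟨b, Or.inr rfl, fun hb => hab (ha.trans hb.symm), hall p z b hz
        (fun hb => hab (ha.trans hb.symm))⟩
    · exact ⟨a, Or.inl rfl, ha, hall p z a hz ha⟩
  refine ⟨fun z w => ?_, fun p q z hzp hzq => ?_, fun p z hzp => ?_, fun p z hzp => ?_,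
    fun _ p z hzp => ?_⟩
  · have := h (some none) (some none) (f z) (f w) (hn' z) (hn' z) (hn' w) (hn' w)
    have h2 := reachable_map (H := addVertex G {s, t}) (fun o => o.getD none) ?_ this
    · rcases z with _ | z <;> rcases w with _ | w <;> exact h2
    · rintro (_ | _ | a) (_ | _ | b) ⟨h1, h2, h3⟩ <;> simp at h2 h3
      · exact absurd rfl h1.ne
      · exact (hG none (some b) h1).reachable
      · exact (hG (some a) none h1).reachable
      · exact (hG (some a) (some b) h1).reachable
  · obtain ⟨y, hy, w, hw, hyw⟩ := exists_exit (del W {f p, f q}) (del (addVertex G {s, t}) {p, q}) f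
      (fun x y hxy => ⟨hG _ _ hxy.1, fun h' => hxy.2.1 (by
          rcases h' with h' | h'
          · exact Or.inl (congrArg f h')
          · exact Or.inr (congrArg f h')),
        fun h' => hxy.2.2 (by
          rcases h' with h' | h'
          · exact Or.inl (congrArg f h')
          · exact Or.inr (congrArg f h'))⟩)
      (h (f p) (f q) (f z) (some none) (hfi.ne hzp) (hfi.ne hzq) (hn' p).symm (hn' q).symm) hn
    have h1 := hyw.2.1
    simp only [Set.mem_insert_iff, Set.mem_singleton_iff, not_or] at h1
    exact ⟨y, hadj y w hyw.1 hw, fun h' => h1.1 (congrArg f h'), fun h' => h1.2 (congrArg f h'), hy⟩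
  · exact hpick _ _ p z (by simpa using htx) hzp
  · exact hpick _ _ p z (by simp) hzp
  · exact hpick _ _ p z (by simp) hzp

/-- For `d = 4` there are two cubic vertices, `s` and `x`. A vertex other than `s`, `t`, `x` has the
same degree in the 3-connected extension, so its degree is at least 3; it is not 3 and at most 4. -/
theorem IsSeed.exists_isSeedPole [Fintype X] {G : SimpleGraph X} {s t : X} (h : IsSeed 4 G s t) :
    ∃ x, IsSeedPole G s t x := by
  classical
  have hdeg : ∀ v, G.degree v = deg G v := fun v => degree_eq_deg G v
  have hs : deg G s = 3 := by rw [← hdeg]; convert h.degree_s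
  have ht : deg G t = 2 := by rw [← hdeg]; convert (h.degree_eq_two_iff t).2 rfl
  have hst : s ≠ t := by rintro rfl; omega
  have hcard := h.card_degree_three
  have hmem : ∀ v, v ∈ verticesOfDegree G 3 ↔ deg G v = 3 := fun v => by
    rw [verticesOfDegree, Finset.mem_filter, ← hdeg]
    simp only [Finset.mem_univ, true_and]
  obtain ⟨x, hx, hsx, hx3⟩ : ∃ x, deg G x = 3 ∧ s ≠ x ∧ ∀ v, deg G v = 3 → v = s ∨ v = x := by
    obtain ⟨a, b, hab, he⟩ := Finset.card_eq_two.1 hcard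
    have ha := (hmem a).1 (by rw [he]; simp)
    have hb := (hmem b).1 (by rw [he]; simp)
    have hm : ∀ v, deg G v = 3 → v = a ∨ v = b := fun v hv => by
      have := (hmem v).2 hv
      rw [he] at this
      simpa using this
    rcases hm s hs with rfl | rfl
    · exact ⟨b, hb, hab, hm⟩
    · exact ⟨a, ha, hab.symm, fun v hv => (hm v hv).symm⟩
  have htx : t ≠ x := by rintro rfl; omega
  have hset : seedExtension G s t = addVertex G {t, x} := by
    rw [seedExtension]
    congr 1
    ext w
    simp only [Set.mem_ofPred_eq, Set.mem_insert_iff, Set.mem_singleton_iff]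
    refine or_congr_right ⟨fun hw => ?_, ?_⟩
    · have h2 := hw.2
      have h3 : deg G w = 3 := by rw [← hdeg]; convert h2
      exact (hx3 w h3).resolve_left hw.1
    · rintro rfl
      refine ⟨hsx.symm, ?_⟩
      rw [← hx, ← hdeg]
  have hconn := isKConnected_three_iff.1 h.connected
  rw [hset] at hconn
  refine ⟨x, hst, hsx, htx, hs, ht, hx, fun v hvs hvt hvx => ?_, exists_isUniquePath hst ?_,
    isPole_of_robust hconn.2, isPole_extend_of_robust htx hconn.2⟩
  · have h1 := hconn.2.three_le_deg hconn.1 (some (some v))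
    rw [deg_addVertex_of_notMem (by simp [hvs, hvt]), deg_addVertex_of_notMem
      (by simp [hvt, hvx])] at h1
    have h2 : deg G v ≤ 4 := by
      rw [← hdeg, ← h.maxDegree_eq]
      convert G.degree_le_maxDegree v
    have h3 : deg G v ≠ 3 := fun h3 => by
      rcases hx3 v h3 with h' | h'
      · exact hvs h'
      · exact hvx h'
    omega
  · convert h.unique_path

/-! ### Fans -/

lemma adj_iff_of_subset {G : SimpleGraph V} {v p q : V} (h : deg G v = 2)
    (hw : ∀ w, G.Adj v w → w = p ∨ w = q) (w : V) : G.Adj v w ↔ w = p ∨ w = q := by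
  obtain ⟨a, b, hab, h'⟩ := deg_eq_two_iff.1 h
  have ha := hw a ((h' a).2 (Or.inl rfl))
  have hb := hw b ((h' b).2 (Or.inr rfl))
  rw [h']
  grind

/-- A path with `k + 2` vertices and a further vertex, the hub, that is connected to all of
them. -/
def fan (k : ℕ) : SimpleGraph (Option (Fin (k + 2))) := addVertex (pathGraph (k + 2)) Set.univ

/-- The hamiltonian path of a fan from the hub to the last vertex. -/
def fanPath (k : ℕ) : SimpleGraph (Option (Option (Fin (k + 2)))) :=
  addVertex (addVertex (pathGraph (k + 2)) {0}) {none, some (Fin.last (k + 1))}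

lemma fanPath_isHamGraph (k : ℕ) : IsHamGraph (fanPath k) := by
  have hn : (fanPath k).Adj (some none) none := Or.inl rfl
  have h0 : (fanPath k).Adj (some none) (some (some 0)) := rfl
  have h1 : ∀ i : Fin (k + 2), (fanPath k).Reachable (some (some 0)) (some (some i)) := fun i =>
    reachable_map (fun i => some (some i)) (fun _ _ h => Adj.reachable (G := fanPath k) h)
      (pathGraph_preconnected (k + 2) 0 i)
  have key : ∀ o, (fanPath k).Reachable (some none) o := by
    rintro (_ | _ | i)
    · exact hn.reachable
    · exact Reachable.refl _
    · exact h0.reachable.trans (h1 i)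
  refine ⟨fun v w => (key v).symm.trans (key w), ?_⟩
  rintro (_ | _ | i)
  · exact deg_eq_two (p := some none) (q := some (some (Fin.last _))) (by simp) (by
      rintro (_ | _ | w) <;> simp [fanPath])
  · exact deg_eq_two (p := none) (q := some (some 0)) (by simp) (by
      rintro (_ | _ | w) <;> simp [fanPath])
  · obtain ⟨i, hi⟩ := i
    refine deg_eq_two
      (p := if h : i = 0 then some none else some (some ⟨i - 1, by omega⟩))
      (q := if h : i = k + 1 then none else some (some ⟨i + 1, by omega⟩)) ?_ ?_
    · split_ifs <;> simp
    · rintro (_ | _ | ⟨j, hj⟩)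
      · split_ifs <;> simp [fanPath, Fin.ext_iff] <;> omega
      · split_ifs <;> simp [fanPath, Fin.ext_iff] <;> omega
      · split_ifs <;> simp [fanPath, Fin.ext_iff, pathGraph_adj] <;> omega

/-- Apart from the hub, the path vertex `0` has one neighbour only and is not an end of the
hamiltonian path. This forces the edge from the hub to `0`. The hub is then saturated, and all edges
along the path are forced in turn. -/
lemma isUniquePath_fan (k : ℕ) :
    IsUniquePath (fan k) none (some (Fin.last (k + 1))) (fanPath k) := by
  refine ⟨addVertex_mono (addVertex_mono le_rfl (Set.subset_univ _)) subset_rfl,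
    fanPath_isHamGraph k, fun Q hQ hH => (hH.eq_of_le (fanPath_isHamGraph k) ?_).symm⟩
  have hn := none_adj_iff (hH.deg_eq none) hQ
  have h0 := adj_iff_of_subset (p := some none) (q := some (some 1)) (hH.deg_eq (some (some 0))) (by
    rintro (_ | _ | ⟨j, hj⟩) h
    · have := hQ h
      simp [Fin.ext_iff] at this
    · simp
    · have := hQ h
      simp [fan, pathGraph_adj] at this
      simp [Fin.ext_iff]; omega)
  have hh : ∀ w, Q.Adj (some none) w ↔ w = none ∨ w = some (some 0) :=
    adj_iff_of_deg_eq_two (hH.deg_eq _) (by simp) ((hn _).2 (Or.inl rfl)).symm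
      ((h0 _).2 (Or.inl rfl)).symm
  have hi : ∀ i : ℕ, ∀ hi : i + 1 < k + 2,
      Q.Adj (some (some ⟨i, by omega⟩)) (some (some ⟨i + 1, hi⟩)) := by
    intro i hi
    rcases i with _ | i
    · exact (h0 _).2 (Or.inr rfl)
    · refine (adj_iff_of_subset (p := some (some ⟨i, by omega⟩)) (hH.deg_eq _) ?_ _).2 (Or.inr rfl)
      rintro (_ | _ | ⟨j, hj⟩) h
      · have := hQ h
        simp [Fin.ext_iff] at this
        omega
      · have := (hh _).1 h.symm
        simp [Fin.ext_iff] at this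
      · have := hQ h
        simp [fan, pathGraph_adj] at this
        simp; omega
  rintro (_ | _ | ⟨i, hi'⟩) (_ | _ | ⟨j, hj⟩) h
  · cases h
  · exact (hn _).2 (Or.inl rfl)
  · exact (hn _).2 (Or.inr (congrArg some (by simpa [fanPath] using h)))
  · exact ((hn _).2 (Or.inl rfl)).symm
  · cases h
  · exact (hh _).2 (Or.inr (congrArg some (congrArg some (by simpa [fanPath] using h))))
  · exact ((hn _).2 (Or.inr (congrArg some (by simpa [fanPath] using h)))).symm
  · exact ((hh _).2 (Or.inr (congrArg some (congrArg some (by simpa [fanPath] using h))))).symm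
  · simp only [fanPath, addVertex_some_some, pathGraph_adj] at h
    rcases h with h | h
    · subst h; exact hi _ _
    · subst h; exact (hi _ _).symm

/-- While the hub survives it is adjacent to every survivor. When it is deleted, a path with at most
one more vertex deleted is left, and every remaining piece contains `0` or the last vertex. -/
lemma isPole_fan (k : ℕ) : IsPole (fan k) none (some (Fin.last (k + 1))) (some 0) False := by
  have up : ∀ (S : Set (Option (Fin (k + 2)))) (i : Fin (k + 2)), (∀ j, i ≤ j → some j ∉ S) →
      (del (fan k) S).Reachable (some i) (some (Fin.last (k + 1))) := by
    intro S i
    induction i using Fin.reverseInduction with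
    | last => exact fun _ => Reachable.refl _
    | cast i ih =>
      intro h
      refine Reachable.trans (Adj.reachable ?_) (ih fun j hj => h j ?_)
      · exact ⟨by simp [fan, pathGraph_adj], h _ le_rfl, h _ i.castSucc_lt_succ.le⟩
      · exact i.castSucc_lt_succ.le.trans hj
  have down : ∀ (S : Set (Option (Fin (k + 2)))) (i : Fin (k + 2)), (∀ j, j ≤ i → some j ∉ S) →
      (del (fan k) S).Reachable (some i) (some 0) := by
    intro S i
    induction i using Fin.induction with
    | zero => exact fun _ => Reachable.refl _
    | succ i ih =>
      intro h
      refine Reachable.trans (Adj.reachable ?_) (ih fun j hj => h j ?_)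
      · exact ⟨by simp [fan, pathGraph_adj], h _ le_rfl, h _ i.castSucc_lt_succ.le⟩
      · exact hj.trans i.castSucc_lt_succ.le
  have hub : ∀ (S : Set (Option (Fin (k + 2)))) z, z ∉ S → none ∉ S →
      (del (fan k) S).Reachable z none := by
    rintro S (_ | i) h1 h2
    · exact Reachable.refl _
    · exact Adj.reachable ⟨trivial, h1, h2⟩
  have path : ∀ (p : Option (Fin (k + 2))) (i : Fin (k + 2)), some i ≠ p →
      ∃ w, (w = some (Fin.last (k + 1)) ∨ w = some 0) ∧ w ≠ p ∧
        (∀ q, q = none ∨ q = p → (del (fan k) {p, q}).Reachable (some i) w) := by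
    rintro (_ | j) i hij
    · exact ⟨_, Or.inl rfl, by simp, fun q hq => up _ _ fun j _ => by
        rcases hq with rfl | rfl <;> simp⟩
    · have hij : i ≠ j := fun h => hij (congrArg some h)
      rcases lt_or_gt_of_ne hij with h | h
      · refine ⟨_, Or.inr rfl, ?_, fun q hq => down _ _ fun l hl => ?_⟩
        · simp [Fin.ext_iff]; omega
        · have : l ≠ j := (hl.trans_lt h).ne
          rcases hq with rfl | rfl <;> simp [this]
      · refine ⟨_, Or.inl rfl, ?_, fun q hq => up _ _ fun l hl => ?_⟩
        · have := Fin.le_last i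
          simp only [ne_eq, Option.some.injEq]
          exact (h.trans_le this).ne'
        · have : l ≠ j := (h.trans_le hl).ne'
          rcases hq with rfl | rfl <;> simp [this]
  have single : ∀ p w : Option (Fin (k + 2)), ∀ i, (del (fan k) {p, p}).Reachable i w →
      (del (fan k) {p}).Reachable i w := fun p w i h => by simpa using h
  refine ⟨fun z w => ?_, fun p q z hp hq => ?_, fun p z hp => ?_, fun p z hp => ?_,
    fun _ p z hp => ?_⟩
  · have h := fun z => hub ∅ z (by simp) (by simp)
    exact ((h z).trans (h w).symm).mono (show del (fan k) ∅ ≤ fan k from fun _ _ h => h.1)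
  · by_cases hpn : p = none
    · subst hpn
      obtain ⟨i, rfl⟩ := Option.ne_none_iff_exists'.1 hp
      obtain ⟨w, h1, h2, h3⟩ := path q i hq
      refine ⟨w, Or.inr h1, ?_, h2, ?_⟩
      · rcases h1 with rfl | rfl <;> simp
      · rw [Set.pair_comm]; exact h3 none (Or.inl rfl)
    by_cases hqn : q = none
    · subst hqn
      obtain ⟨i, rfl⟩ := Option.ne_none_iff_exists'.1 hq
      obtain ⟨w, h1, h2, h3⟩ := path p i hp
      refine ⟨w, Or.inr h1, h2, ?_, h3 none (Or.inl rfl)⟩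
      rcases h1 with rfl | rfl <;> simp
    · exact ⟨none, Or.inl rfl, Ne.symm hpn, Ne.symm hqn, hub _ _ (by simp [hp, hq])
        (by simp [Ne.symm hpn, Ne.symm hqn])⟩
  · rcases z with _ | i
    · by_cases hp0 : p = some 0
      · refine ⟨some (Fin.last (k + 1)), Or.inl rfl, ?_, Reachable.symm (hub _ _ ?_ ?_)⟩ <;>
          simp [hp0, Fin.ext_iff]
      · exact ⟨some 0, Or.inr rfl, Ne.symm hp0, (hub _ _ (by simpa using Ne.symm hp0)
          (by simpa using hp)).symm⟩
    · obtain ⟨w, h1, h2, h3⟩ := path p i hp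
      exact ⟨w, h1, h2, single _ _ _ (h3 p (Or.inr rfl))⟩
  · by_cases hpn : p = none
    · subst hpn
      obtain ⟨i, rfl⟩ := Option.ne_none_iff_exists'.1 hp
      exact ⟨_, Or.inr rfl, by simp, up _ _ (by simp)⟩
    · exact ⟨none, Or.inl rfl, Ne.symm hpn, hub _ _ (by simpa using hp)
        (by simpa using Ne.symm hpn)⟩
  · by_cases hpn : p = none
    · subst hpn
      obtain ⟨i, rfl⟩ := Option.ne_none_iff_exists'.1 hp
      exact ⟨_, Or.inr rfl, by simp, down _ _ (by simp)⟩
    · exact ⟨none, Or.inl rfl, Ne.symm hpn, hub _ _ (by simpa using hp)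
        (by simpa using Ne.symm hpn)⟩

lemma deg_fan_none (k : ℕ) : deg (fan k) none = k + 2 := by
  rw [fan, deg_addVertex_none, Set.ncard_univ, Nat.card_fin]

lemma deg_pathGraph (k : ℕ) (i : Fin (k + 2)) :
    deg (pathGraph (k + 2)) i = if i = 0 ∨ i = Fin.last (k + 1) then 1 else 2 := by
  obtain ⟨i, hi⟩ := i
  by_cases h0 : i = 0
  · rw [if_pos (Or.inl (Fin.ext h0)), deg, Set.ncard_eq_one]
    exact ⟨⟨1, by omega⟩, by ext ⟨j, hj⟩; simp [pathGraph_adj]; omega⟩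
  by_cases h1 : i = k + 1
  · rw [if_pos (Or.inr (Fin.ext h1)), deg, Set.ncard_eq_one]
    exact ⟨⟨k, by omega⟩, by ext ⟨j, hj⟩; simp [pathGraph_adj]; omega⟩
  · rw [if_neg (by simp [Fin.ext_iff, h0, h1])]
    exact deg_eq_two (p := ⟨i - 1, by omega⟩) (q := ⟨i + 1, by omega⟩) (by simp) (by
      rintro ⟨j, hj⟩; simp [pathGraph_adj]; omega)

lemma deg_fan_some (k : ℕ) (i : Fin (k + 2)) :
    deg (fan k) (some i) = if i = 0 ∨ i = Fin.last (k + 1) then 2 else 3 := by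
  rw [fan, deg_addVertex_of_mem (Set.mem_univ _), deg_pathGraph]
  split_ifs <;> rfl

/-! ### Counting the vertices of a given degree -/

/-- The number of vertices of degree `d`. -/
noncomputable def cnt (G : SimpleGraph V) (d : ℕ) : ℕ := {v | deg G v = d}.ncard

lemma cnt_sum [Finite V] [Finite X] {u : V} (G : SimpleGraph ({v // v ≠ u} ⊕ X)) (d : ℕ) :
    cnt G d = {y | deg G (.inl y) = d}.ncard + {z | deg G (.inr z) = d}.ncard := by
  rw [cnt, show {v | deg G v = d} = Sum.inl '' {y | deg G (.inl y) = d} ∪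
      Sum.inr '' {z | deg G (.inr z) = d} by ext (y | z) <;> simp,
    Set.ncard_union_eq (by rw [Set.disjoint_left]; rintro _ ⟨v, -, rfl⟩ ⟨z, -, h⟩; cases h)
      (Set.toFinite _), Set.ncard_image_of_injective _ Sum.inl_injective,
    Set.ncard_image_of_injective _ Sum.inr_injective]

open scoped Classical in
lemma ncard_ne_add [Finite V] (G : SimpleGraph V) (u : V) (d : ℕ) :
    {y : {v // v ≠ u} | deg G y = d}.ncard + (if deg G u = d then 1 else 0) = cnt G d := by
  have h : (Subtype.val '' {y : {v // v ≠ u} | deg G y = d}) = {v | deg G v = d} \ {u} := by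
    ext v; simp [and_comm]
  rw [← Set.ncard_image_of_injective _ Subtype.val_injective, h, cnt]
  split_ifs with hu
  · exact Set.ncard_sdiff_singleton_add_one hu
  · rw [Set.sdiff_singleton_eq_self (show u ∉ {v | deg G v = d} from hu), add_zero]

section

variable [Finite V] [Finite X] {Γ : SimpleGraph V} {u : V} {G : SimpleGraph X} {R : V → X → Prop}
  {d : ℕ}

open scoped Classical in
lemma cnt_glue (h : ∀ y, deg (glue Γ u G R) (.inl y) = d ↔ deg Γ y = d) :
    cnt (glue Γ u G R) d + (if deg Γ u = d then 1 else 0) =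
      cnt Γ d + {z | deg (glue Γ u G R) (.inr z) = d}.ncard := by
  rw [cnt_sum, ← ncard_ne_add Γ u d]
  simp only [h]
  omega

open scoped Classical in
lemma cnt_glue_le (h : ∀ y, deg (glue Γ u G R) (.inl y) = d → deg Γ y = d) :
    cnt (glue Γ u G R) d + (if deg Γ u = d then 1 else 0) ≤
      cnt Γ d + {z | deg (glue Γ u G R) (.inr z) = d}.ncard := by
  rw [cnt_sum, ← ncard_ne_add Γ u d]
  have := Set.ncard_le_ncard (s := {y | deg (glue Γ u G R) (.inl y) = d})
    (t := {y : {v // v ≠ u} | deg Γ y = d}) (fun y hy => h y hy) (Set.toFinite _)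
  omega

lemma card_glue (X : Type*) [Finite X] (u : V) :
    Nat.card ({v // v ≠ u} ⊕ X) + 1 = Nat.card V + Nat.card X := by
  have := Fintype.ofFinite V
  have := Fintype.ofFinite X
  classical
  have h := Fintype.card_subtype_compl (fun v => v = u)
  have h0 : 0 < Fintype.card V := Fintype.card_pos_iff.2 ⟨u⟩
  rw [Fintype.card_subtype_eq] at h
  rw [Nat.card_sum, Nat.card_eq_fintype_card, Nat.card_eq_fintype_card, Nat.card_eq_fintype_card]
  have h' : Fintype.card {v // v ≠ u} = Fintype.card V - 1 := by convert h
  omega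

end

/-! ### Pairs of cubic vertices -/

/-- The cycle neighbour in the role of `a` can be prescribed. This directs the first link of a pole
to the partner of `u` in the pairing. -/
lemma exists_isSite [Finite V] {Γ C : SimpleGraph V} {u p : V} (hle : C ≤ Γ) (hC : deg C u = 2)
    (hΓ : deg Γ u = 3) (hp : C.Adj u p) : ∃ b c, IsSite Γ C u p b c := by
  obtain ⟨b, hpb, hb⟩ : ∃ b, p ≠ b ∧ ∀ v, C.Adj u v ↔ v = p ∨ v = b := by
    obtain ⟨x, y, hxy, h⟩ := deg_eq_two_iff.1 hC
    rcases (h p).1 hp with rfl | rfl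
    · exact ⟨y, hxy, h⟩
    · exact ⟨x, hxy.symm, fun v => (h v).trans or_comm⟩
  have hsub : ({p, b} : Set V) ⊆ Γ.neighborSet u := by
    rintro v (rfl | rfl)
    · exact hle hp
    · exact hle ((hb _).2 (Or.inr rfl))
  have h1 : (Γ.neighborSet u \ {p, b}).ncard = 1 := by
    have := Set.ncard_sdiff_add_ncard_of_subset hsub
    rw [Set.ncard_pair hpb, ← deg, hΓ] at this
    omega
  obtain ⟨c, hc⟩ := Set.ncard_eq_one.1 h1
  have hc' : c ∈ Γ.neighborSet u \ {p, b} := hc ▸ rfl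
  have hne : c ≠ p ∧ c ≠ b := by simpa using hc'.2
  refine ⟨b, c, fun v => ⟨fun hv => ?_, ?_⟩, hb, hpb, hne.1.symm, hne.2.symm⟩
  · by_cases hv' : v ∈ ({p, b} : Set V)
    · rcases hv' with rfl | rfl <;> simp
    · have : v ∈ ({c} : Set V) := hc ▸ ⟨hv, hv'⟩
      exact Or.inr (Or.inr this)
  · rintro (rfl | rfl | rfl)
    · exact hsub (Or.inl rfl)
    · exact hsub (Or.inr rfl)
    · exact hc'.1

lemma IsSite.swap {Γ C : SimpleGraph V} {u a b c : V} (h : IsSite Γ C u a b c) :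
    IsSite Γ C u b a c :=
  ⟨fun v => (h.adj_iff v).trans (by tauto), fun v => (h.cycle_adj_iff v).trans or_comm,
    h.hab.symm, h.hbc, h.hac⟩

/-- The vertices of degree three outside of `E` can be divided into pairs that are joined by edges
of `C`. -/
def IsMatched (Γ C : SimpleGraph V) (E : Set V) : Prop :=
  ∃ M ≤ C, (∀ v w, M.Adj v w → deg Γ v = 3 ∧ v ∉ E) ∧
    ∀ v, deg Γ v = 3 → v ∉ E → ∃! w, M.Adj v w

/-- A pair is treated by replacing its two vertices one after the other, so both are put into the
exceptional set `E` for the meantime. -/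
lemma IsMatched.exists_unpair {Γ C : SimpleGraph V} {E : Set V} (h : IsMatched Γ C E) {u : V}
    (hu : deg Γ u = 3) (huE : u ∉ E) :
    ∃ p, C.Adj u p ∧ deg Γ p = 3 ∧ IsMatched Γ C (E ∪ {u, p}) := by
  obtain ⟨M, hM, h1, h2⟩ := h
  obtain ⟨p, hp, -⟩ := h2 u hu huE
  have hinj : ∀ v w w', M.Adj v w → M.Adj v w' → w = w' := fun v w w' h h' => by
    obtain ⟨x, -, hx⟩ := h2 v (h1 _ _ h).1 (h1 _ _ h).2
    exact (hx w h).trans (hx w' h').symm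
  refine ⟨p, hM hp, (h1 _ _ hp.symm).1, del M {u, p}, fun v w h => hM h.1, fun v w h => ?_,
    fun v hv hvE => ?_⟩
  · refine ⟨(h1 _ _ h.1).1, ?_⟩
    rintro (h' | h')
    · exact (h1 _ _ h.1).2 h'
    · exact h.2.1 h'
  · simp only [Set.mem_union, not_or] at hvE
    obtain ⟨w, hw, hw'⟩ := h2 v hv hvE.1
    refine ⟨w, ⟨hw, hvE.2, ?_⟩, fun w' h => hw' _ h.1⟩
    rintro (rfl | rfl)
    · exact hvE.2 (Or.inr (hinj _ _ _ hw.symm hp))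
    · exact hvE.2 (Or.inl (hinj _ _ _ hw.symm hp.symm))

lemma IsMatched.pair {Γ C : SimpleGraph V} {E : Set V} (h : IsMatched Γ C E) {v w : V}
    (hv : deg Γ v = 3) (hw : deg Γ w = 3) (hvE : v ∈ E) (hwE : w ∈ E) (hvw : C.Adj v w) :
    IsMatched Γ C (E \ {v, w}) := by
  obtain ⟨M, hM, h1, h2⟩ := h
  refine ⟨M ⊔ edge v w, ?_, ?_, ?_⟩
  · rintro x y (h | h)
    · exact hM h
    · rw [edge_adj] at h
      rcases h.1 with ⟨rfl, rfl⟩ | ⟨rfl, rfl⟩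
      · exact hvw
      · exact hvw.symm
  · rintro x y (h | h)
    · exact ⟨(h1 _ _ h).1, fun h' => (h1 _ _ h).2 h'.1⟩
    · rw [edge_adj] at h
      rcases h.1 with ⟨rfl, rfl⟩ | ⟨rfl, rfl⟩
      · exact ⟨hv, fun h => h.2 (Or.inl rfl)⟩
      · exact ⟨hw, fun h => h.2 (Or.inr rfl)⟩
  · intro x hx hxE
    by_cases hxE' : x ∈ E
    · have hM' : ∀ y, ¬ M.Adj x y := fun y h => (h1 _ _ h).2 hxE'
      have hx' : x = v ∨ x = w := by
        by_contra hc
        exact hxE ⟨hxE', hc⟩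
      have hne := hvw.ne
      rcases hx' with rfl | rfl
      · refine ⟨w, Or.inr (by simp [edge_adj, hne]), ?_⟩
        rintro y (h | h)
        · exact absurd h (hM' y)
        · rw [edge_adj] at h
          grind
      · refine ⟨v, Or.inr (by simp [edge_adj, hne.symm]), ?_⟩
        rintro y (h | h)
        · exact absurd h (hM' y)
        · rw [edge_adj] at h
          grind
    · obtain ⟨y, hy, hy'⟩ := h2 x hx hxE'
      refine ⟨y, Or.inl hy, ?_⟩
      rintro y' (h | h)
      · exact hy' _ h
      · rw [edge_adj] at h
        rcases h.1 with ⟨rfl, rfl⟩ | ⟨rfl, rfl⟩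
        · exact absurd hvE hxE'
        · exact absurd hwE hxE'

lemma IsMatched.congr {Γ C : SimpleGraph V} {E E' : Set V} (h : IsMatched Γ C E)
    (hE : ∀ v, deg Γ v = 3 → (v ∈ E ↔ v ∈ E')) : IsMatched Γ C E' := by
  obtain ⟨M, hM, h1, h2⟩ := h
  refine ⟨M, hM, fun v w h => ?_, fun v hv hvE => h2 v hv ((hE v hv).not.2 hvE)⟩
  have := h1 v w h
  exact ⟨this.1, (hE v this.1).not.1 this.2⟩

lemma IsMatched.glue {Γ C : SimpleGraph V} {u a b : V} {G : SimpleGraph X} {R : V → X → Prop}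
    {s t : X} {P : SimpleGraph (Option X)} {E : Set V} (h : IsMatched Γ C E) (hu : u ∈ E)
    (hdeg : ∀ y : {v // v ≠ u}, y.1 ∉ E → deg (glue Γ u G R) (.inl y) = deg Γ y)
    (N : SimpleGraph X) (F : Set X) (hN : N ≤ P.comap some)
    (h1 : ∀ z z', N.Adj z z' → deg (UniqHam.glue Γ u G R) (.inr z) = 3 ∧ z ∉ F)
    (h2 : ∀ z, deg (UniqHam.glue Γ u G R) (.inr z) = 3 → z ∉ F → ∃! z', N.Adj z z') :
    IsMatched (UniqHam.glue Γ u G R) (glueCycle C u a b s t P)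
      {w | Sum.elim (fun y => y.1 ∈ E) (fun z => z ∈ F) w} := by
  obtain ⟨M, hM, hM1, hM2⟩ := h
  refine ⟨UniqHam.glue M u N fun _ _ => False, ?_, ?_, ?_⟩
  · rintro (y | z) (y' | z') h
    · exact hM h
    · exact h.elim
    · exact h.elim
    · exact hN h
  · rintro (y | z) (y' | z') h
    · have := hM1 _ _ h
      exact ⟨(hdeg y this.2).trans this.1, this.2⟩
    · exact h.elim
    · exact h.elim
    · exact h1 _ _ h
  · rintro (y | z) hd hE
    · obtain ⟨w, hw, hw'⟩ := hM2 y ((hdeg y hE).symm.trans hd) hE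
      have hwu : w ≠ u := fun h => (hM1 _ _ hw.symm).2 (h ▸ hu)
      refine ⟨.inl ⟨w, hwu⟩, hw, ?_⟩
      rintro (y' | z') h
      · exact congrArg _ (Subtype.ext (hw' _ h))
      · exact h.elim
    · obtain ⟨w, hw, hw'⟩ := h2 z hd hE
      refine ⟨.inr w, hw, ?_⟩
      rintro (y' | z') h
      · exact h.elim
      · exact congrArg _ (hw' _ h)

lemma IsUnique.mono {G C : SimpleGraph V} {Z Z' : Set V} (h : IsUnique G Z C) (hZ : Z' ⊆ Z) :
    IsUnique G Z' C :=
  ⟨h.le, h.ham, fun D hD hoff => h.eq_of_le D hD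
    ⟨hoff.reachable, fun v => (hoff.deg_eq v).imp_right fun h => ⟨hZ h.1, h.2⟩⟩⟩

/-! ### Replacing a cubic vertex by a fan -/

/-- `Γ` with the cubic vertex `u` replaced by a fan. -/
def glueFan (Γ : SimpleGraph V) (u a b c : V) (k : ℕ) :
    SimpleGraph ({v // v ≠ u} ⊕ Option (Fin (k + 2))) :=
  glue Γ u (fan k) (link a b c none (some (Fin.last (k + 1))) (some 0) False)

/-- The hamiltonian cycle after the replacement of a vertex by a fan. -/
def glueFanCycle (C : SimpleGraph V) (u a b : V) (k : ℕ) :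
    SimpleGraph ({v // v ≠ u} ⊕ Option (Fin (k + 2))) :=
  glueCycle C u a b none (some (Fin.last (k + 1))) (fanPath k)

lemma Robust.glueFan {Γ C : SimpleGraph V} {u a b c : V} (h : Robust Γ) (hs : IsSite Γ C u a b c)
    (k : ℕ) : Robust (glueFan Γ u a b c k) :=
  h.glue hs.adj_iff hs.hab hs.hac hs.hbc (isPole_fan k)

section

variable [Finite V] {Γ C : SimpleGraph V} {u a b c : V}

lemma IsUnique.glueFan (h : IsUnique Γ ∅ C) (hs : IsSite Γ C u a b c) (k : ℕ) :
    IsUnique (glueFan Γ u a b c k) ∅ (glueFanCycle C u a b k) :=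
  (h.glue hs (by simp) (isUniquePath_fan k) False.elim (by simp)).mono (Set.empty_subset _)

lemma deg_glueFan_inl (hs : IsSite Γ C u a b c) (k : ℕ) (y : {v // v ≠ u}) :
    deg (glueFan Γ u a b c k) (.inl y) = deg Γ y :=
  deg_glue_link_inl hs.adj_iff hs.hab hs.hac hs.hbc y (by simp)

lemma deg_glueFan_none (hs : IsSite Γ C u a b c) (k : ℕ) :
    deg (glueFan Γ u a b c k) (.inr none) = k + 3 := by
  rw [glueFan, deg_glue_link_inr hs.adj_iff hs.hab (by simp) (by simp) (by simp [Fin.ext_iff]),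
    if_pos rfl, deg_fan_none]

lemma deg_glueFan_some (hs : IsSite Γ C u a b c) (k : ℕ) (i : Fin (k + 2)) :
    deg (glueFan Γ u a b c k) (.inr (some i)) = 3 := by
  rw [glueFan, deg_glue_link_inr hs.adj_iff hs.hab (by simp) (by simp) (by simp [Fin.ext_iff]),
    deg_fan_some]
  by_cases h0 : i = 0
  · subst h0
    simp [Fin.ext_iff]
  · by_cases h1 : i = Fin.last (k + 1) <;> simp [h0, h1]

/-- The `k + 2` path vertices are paired as `2l`, `2l + 1`, along edges of the cycle. For odd `k`
the last one is left over. The hub is always exempted, as it is cubic only for `k = 0`. -/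
lemma IsMatched.glueFan {E : Set V} (h : IsMatched Γ C E) (hs : IsSite Γ C u a b c) (hu : u ∈ E)
    (k : ℕ) : IsMatched (glueFan Γ u a b c k) (glueFanCycle C u a b k)
      {w | Sum.elim (fun y => y.1 ∈ E)
        (fun z => z = none ∨ z = some (Fin.last (k + 1)) ∧ Odd k) w} := by
  let N : SimpleGraph (Option (Fin (k + 2))) :=
    { Adj := fun z z' => ∃ i j, z = some i ∧ z' = some j ∧ i ≠ j ∧ i.val / 2 = j.val / 2
      symm := ⟨fun _ _ ⟨i, j, h1, h2, h3, h4⟩ => ⟨j, i, h2, h1, h3.symm, h4.symm⟩⟩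
      loopless := ⟨fun _ ⟨i, j, h1, h2, h3, _⟩ => h3 (Option.some_injective _ (h1.symm.trans h2))⟩ }
  refine h.glue hu (fun y _ => deg_glueFan_inl hs k y) N
    {z | z = none ∨ z = some (Fin.last (k + 1)) ∧ Odd k} ?_ ?_ ?_
  · rintro _ _ ⟨⟨i, hi⟩, ⟨j, hj⟩, rfl, rfl, hij, h⟩
    simp only [comap_adj, fanPath, addVertex_some_some, pathGraph_adj]
    simp only [ne_eq, Fin.mk.injEq] at hij h
    omega
  · rintro _ _ ⟨⟨i, hi⟩, ⟨j, hj⟩, rfl, rfl, hij, h⟩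
    refine ⟨deg_glueFan_some hs k _, ?_⟩
    simp only [ne_eq, Fin.mk.injEq] at hij h
    simp only [Set.mem_ofPred_eq, reduceCtorEq, Option.some.injEq, Fin.ext_iff, Fin.val_last,
      false_or, not_and]
    rintro rfl ⟨l, rfl⟩
    omega
  · rintro (_ | ⟨i, hi⟩) - hF
    · simp at hF
    · simp only [Set.mem_ofPred_eq, reduceCtorEq, Option.some.injEq, Fin.ext_iff, Fin.val_last,
        false_or, not_and, Nat.not_odd_iff] at hF
      rcases Nat.even_or_odd' i with ⟨l, rfl | rfl⟩
      · refine ⟨some ⟨2 * l + 1, by omega⟩, ⟨_, _, rfl, rfl, by simp, by simp; omega⟩, ?_⟩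
        rintro _ ⟨_, ⟨j, hj⟩, h, rfl, hne, h'⟩
        obtain rfl := Option.some_injective _ h
        simp only [ne_eq, Fin.mk.injEq] at hne h'
        simp only [Option.some.injEq, Fin.mk.injEq]
        omega
      · refine ⟨some ⟨2 * l, by omega⟩, ⟨_, _, rfl, rfl, by simp, by simp; omega⟩, ?_⟩
        rintro _ ⟨_, ⟨j, hj⟩, h, rfl, hne, h'⟩
        obtain rfl := Option.some_injective _ h
        simp only [ne_eq, Fin.mk.injEq] at hne h'
        simp only [Option.some.injEq, Fin.mk.injEq]
        omega

lemma cnt_glueFan (hs : IsSite Γ C u a b c) (hu : deg Γ u = 3) (k : ℕ) {d : ℕ} (hd : d ≠ 3) :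
    cnt (glueFan Γ u a b c k) d = cnt Γ d + if d = k + 3 then 1 else 0 := by
  have h := cnt_glue (Γ := Γ) (u := u) (G := fan k)
    (R := link a b c none (some (Fin.last (k + 1))) (some 0) False) (d := d)
    fun y => by rw [← deg_glueFan_inl hs k y]; rfl
  rw [hu, if_neg hd.symm, add_zero] at h
  refine h.trans (congrArg _ ?_)
  have h0 := deg_glueFan_none hs k
  have h1 := deg_glueFan_some hs k
  rw [glueFan] at h0 h1
  split_ifs with hk
  · refine Set.ncard_eq_one.2 ⟨none, ?_⟩
    ext (_ | i)
    · simpa [hk] using h0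
    · simpa using fun h' => hd (h'.symm.trans (h1 i))
  · refine (Set.ncard_eq_zero).2 ?_
    ext (_ | i)
    · simpa using fun h' => hk (h'.symm.trans h0)
    · simpa using fun h' => hd (h'.symm.trans (h1 i))

end

/-! ### Increasing the number of vertices of a given degree -/

/-- A uniquely hamiltonian graph whose cubic vertices can be removed in pairs. -/
structure IsState (Γ C : SimpleGraph V) : Prop where
  robust : Robust Γ
  three_lt : 3 < Nat.card V
  unique : IsUnique Γ ∅ C
  matched : IsMatched Γ C ∅

/-- A fan replacing `u` gives a hub of degree `k + 3`, but the partner `p` of `u` has to be provided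
for. For odd `k` the last path vertex is also unpaired, and it is linked to `p`. For even `k` all
path vertices are paired, so `p` is replaced by a fan as well, which gives two hubs. -/
theorem IsState.exists_addDegree {V : Type} [Finite V] {Γ C : SimpleGraph V} (h : IsState Γ C)
    (h3 : ∃ v, deg Γ v = 3) (k : ℕ) :
    ∃ (V' : Type) (_ : Finite V') (Γ' C' : SimpleGraph V'), IsState Γ' C' ∧
      (∃ v, deg Γ' v = 3) ∧ Nat.card V < Nat.card V' ∧ Nat.card V' ≤ Nat.card V + 2 * (k + 3) ∧
      ∃ n, 1 ≤ n ∧ n ≤ 2 ∧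
        ∀ d, d ≠ 3 → cnt Γ' d = cnt Γ d + if d = k + 3 then n else 0 := by
  obtain ⟨u, hu⟩ := h3
  obtain ⟨p, hup, hp, hM⟩ := h.matched.exists_unpair hu (Set.notMem_empty u)
  have hV := h.three_lt
  have hcard := card_glue (Option (Fin (k + 2))) u
  rw [Finite.card_option, Nat.card_fin] at hcard
  obtain ⟨b, c, hs⟩ := exists_isSite h.unique.le (h.unique.ham.deg_eq u) hu hup
  have hpu : p ≠ u := hup.ne'
  rcases Nat.even_or_odd k with hk | hk
  · have hR1 := h.robust.glueFan hs k
    have hU1 := h.unique.glueFan hs k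
    have hM1 := hM.glueFan hs (by simp) k
    have hcnt1 := fun {d : ℕ} => cnt_glueFan hs hu k (d := d)
    have hp1 : deg (UniqHam.glueFan Γ u p b c k) (.inl ⟨p, hpu⟩) = 3 :=
      (deg_glueFan_inl hs k _).trans hp
    have hn1 := deg_glueFan_none hs k
    -- With the first hub as the vertex `a` of the second replacement, the two hubs become
    -- neighbours on the cycle. For `k = 0` they are cubic and form a pair.
    have hC1 : (glueFanCycle C u p b k).Adj (.inl ⟨p, hpu⟩) (.inr none) := Or.inl ⟨rfl, rfl⟩
    obtain ⟨b', c', hs'⟩ := exists_isSite hU1.le (hU1.ham.deg_eq _) hp1 hC1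
    have hM2 := hM1.glueFan hs' (by simp) k
    have hcard' := card_glue (Option (Fin (k + 2))) (Sum.inl (β := Option (Fin (k + 2)))
      (⟨p, hpu⟩ : {v // v ≠ u}))
    rw [Finite.card_option, Nat.card_fin] at hcard'
    refine ⟨_, inferInstance, UniqHam.glueFan (UniqHam.glueFan Γ u p b c k) (.inl ⟨p, hpu⟩)
      (.inr none) b' c' k, _, ⟨hR1.glueFan hs' k, by omega, hU1.glueFan hs' k, ?_⟩,
      ⟨_, deg_glueFan_some hs' k 0⟩, by omega, by omega, 2, by norm_num, le_rfl, fun d hd => ?_⟩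
    · have hn2 : deg (UniqHam.glueFan (UniqHam.glueFan Γ u p b c k) (.inl ⟨p, hpu⟩)
        (.inr none) b' c' k) (.inl ⟨.inr none, by simp⟩) = k + 3 :=
        (deg_glueFan_inl hs' k _).trans hn1
      have hn2' := deg_glueFan_none hs' k
      by_cases hk0 : k = 0
      · subst hk0
        refine (hM2.pair hn2 hn2' (by simp) (by simp) (Or.inl ⟨rfl, rfl⟩)).congr ?_
        rintro (⟨⟨y, hy⟩ | (_ | z), hy'⟩ | (_ | z)) hd
        · have : y ≠ p := fun h => hy' (by simp [h])
          simp [hy, this]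
        · simp
        · simp
        · simp
        · simp
      · refine hM2.congr ?_
        rintro (⟨⟨y, hy⟩ | (_ | z), hy'⟩ | (_ | z)) hd
        · have : y ≠ p := fun h => hy' (by simp [h])
          simp [hy, this]
        · rw [hn2] at hd; omega
        · simp [Nat.not_odd_iff_even.2 hk]
        · rw [hn2'] at hd; omega
        · simp [Nat.not_odd_iff_even.2 hk]
    · rw [cnt_glueFan hs' hp1 k hd, hcnt1 hd]
      split_ifs <;> omega
  -- After the swap `p` is the vertex linked to the last path vertex instead of the hub.
  · have hs := hs.swap
    have hM1 := hM.glueFan hs (by simp) k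
    have hp1 : deg (UniqHam.glueFan Γ u b p c k) (.inl ⟨p, hpu⟩) = 3 :=
      (deg_glueFan_inl hs k _).trans hp
    refine ⟨_, inferInstance, UniqHam.glueFan Γ u b p c k, _,
      ⟨h.robust.glueFan hs k, by omega, h.unique.glueFan hs k, ?_⟩,
      ⟨_, deg_glueFan_some hs k 0⟩, by omega, by omega, 1, le_rfl, by norm_num,
      fun d hd => cnt_glueFan hs hu k hd⟩
    refine (hM1.pair hp1 (deg_glueFan_some hs k (Fin.last (k + 1))) (by simp) (by simp [hk])
      (Or.inr ⟨rfl, rfl⟩)).congr ?_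
    rintro (⟨y, hy⟩ | (_ | z)) hd
    · simp [hy]
    · rw [deg_glueFan_none hs k] at hd
      have := hk.pos
      omega
    · simp [hk]

/-! ### Replacing pairs of cubic vertices by seeds -/

/-- The two seeds and the auxiliary vertex `none` of the first pole all end up with degree four.
Outside of them all degrees and the pairing are unchanged. -/
theorem IsState.exists_removePair {V X : Type} [Finite V] [Finite X] {Γ C : SimpleGraph V}
    (h : IsState Γ C) {S : SimpleGraph X} {s t x : X} (hS : IsSeedPole S s t x)
    (h3 : ∃ v, deg Γ v = 3) :
    ∃ (V' : Type) (_ : Finite V') (Γ' C' : SimpleGraph V'), IsState Γ' C' ∧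
      cnt Γ' 3 < cnt Γ 3 ∧ Nat.card V' < Nat.card V + 2 * Nat.card X ∧
      Nat.card V ≤ Nat.card V' ∧ (∃ v, deg Γ' v = 4) ∧
      ∀ d, d ≠ 3 → d ≠ 4 → cnt Γ' d = cnt Γ d := by
  classical
  obtain ⟨u, hu⟩ := h3
  obtain ⟨p, hup, hp, hM⟩ := h.matched.exists_unpair hu (Set.notMem_empty u)
  have hV := h.three_lt
  have hcard := card_glue (Option X) u
  rw [Finite.card_option] at hcard
  have hX : 0 < Nat.card X := Nat.card_pos_iff.2 ⟨⟨s⟩, inferInstance⟩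
  obtain ⟨b, c, hs⟩ := exists_isSite h.unique.le (h.unique.ham.deg_eq u) hu hup
  have hpu : p ≠ u := hup.ne'
  have hst := hS.hst
  have hsx := hS.hsx
  have htx := hS.htx
  obtain ⟨P, hP⟩ := hS.path
  -- The partner `p` is linked to the new vertex `none`, which thus has degree 3, whereas all other
  -- vertices of this pole have degree 4.
  let Γ₁ := glue Γ u (addVertex S {s, t}) (link p b c none (some t) (some x) False)
  let C₁ := glueCycle C u p b none (some t) (extendPath P s t)
  have hR1 : Robust Γ₁ := h.robust.glue hs.adj_iff hs.hab hs.hac hs.hbc hS.pole_extend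
  have hU1 : IsUnique Γ₁ _ C₁ := h.unique.glue hs (by simp) (isUniquePath_extend hst hP) False.elim
    (by simp)
  have hd1 : ∀ y, deg Γ₁ (.inl y) = deg Γ y := fun y =>
    deg_glue_link_inl hs.adj_iff hs.hab hs.hac hs.hbc y (by simp)
  have hd1' : ∀ z, deg Γ₁ (.inr z) = if z = none then 3 else 4 := by
    intro z
    rw [deg_glue_link_inr hs.adj_iff hs.hab (by simp) (by simp) (by simpa using htx)]
    rcases z with _ | z
    · simp [deg_addVertex_none, Set.ncard_pair hst]
    · by_cases hzs : z = s
      · subst hzs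
        rw [deg_addVertex_of_mem (by simp), hS.deg_s]
        simp [hst, hsx]
      by_cases hzt : z = t
      · subst hzt
        rw [deg_addVertex_of_mem (by simp), hS.deg_t]
        simp
      rw [deg_addVertex_of_notMem (by simp [hzs, hzt])]
      by_cases hzx : z = x
      · subst hzx
        simp [hS.deg_x, hzt]
      · simp [hS.deg_eq z hzs hzt hzx, hzt, hzx]
  have hM1 : IsMatched Γ₁ C₁ 
      {w | Sum.elim (fun y => y.1 ∈ (∅ ∪ {u, p} : Set V)) (fun z => z ∈ ({none} : Set (Option X)))
        w} := by
    refine hM.glue (by simp) (fun y _ => hd1 y) ⊥ {none} bot_le (fun _ _ h => h.elim) ?_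
    intro z hz hz'
    have := (hd1' z).symm.trans hz
    rw [if_neg (by simpa using hz')] at this
    omega
  have hp1 : deg Γ₁ (.inl ⟨p, hpu⟩) = 3 := (hd1 _).trans hp
  have hC1 : C₁.Adj (.inl ⟨p, hpu⟩) (.inr none) := Or.inl ⟨rfl, rfl⟩
  obtain ⟨b', c', hs'⟩ := exists_isSite hU1.le (hU1.ham.deg_eq _) hp1 hC1
  have hcard' := card_glue X (Sum.inl (β := Option X) (⟨p, hpu⟩ : {v // v ≠ u}))
  -- Now `ε` holds: `none` is linked to `s` and `t` in place of `p`, which raises its degree to 4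
  -- and gives `t` the degree 2 + 2.
  let Γ₂ := glue Γ₁ (.inl ⟨p, hpu⟩) S (link (.inr none) b' c' s t x True)
  let C₂ := glueCycle C₁ (.inl ⟨p, hpu⟩) (.inr none) b' s t P
  have hR2 : Robust Γ₂ := hR1.glue hs'.adj_iff hs'.hab hs'.hac hs'.hbc hS.pole
  -- In `Γ₁` uniqueness persists for cycles that may skip `none`, as the double link at `none`
  -- requires. The vertex `b'` differs from `none`, so it cannot be skipped.
  have hU2 : IsUnique Γ₂ ∅ C₂ := by
    refine (hU1.glue hs' hst hP (fun _ => ?_) ?_).mono (Set.empty_subset _)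
    · exact ⟨rfl, not_false⟩
    · intro hb
      rcases b' with y | z
      · exact hb
      · exact hs'.hab (congrArg Sum.inr (Eq.symm hb.1))
  have hd2 : ∀ y, y.1 ≠ .inr none → deg Γ₂ (.inl y) = deg Γ₁ y := fun y hy =>
    deg_glue_link_inl hs'.adj_iff hs'.hab hs'.hac hs'.hbc y (by simp [hy])
  have hdn : ∀ hn, deg Γ₂ (.inl ⟨.inr none, hn⟩) = 4 := fun hn => by
    rw [deg_glue_link_twice hs'.adj_iff hs'.hab hs'.hac hst trivial, hd1', if_pos rfl]
  have hd2' : ∀ z, deg Γ₂ (.inr z) = 4 := by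
    intro z
    rw [deg_glue_link_inr hs'.adj_iff hs'.hab hst hsx htx]
    by_cases hzs : z = s
    · subst hzs
      simp [hS.deg_s]
    by_cases hzt : z = t
    · subst hzt
      simp [hS.deg_t, hzs]
    by_cases hzx : z = x
    · subst hzx
      simp [hS.deg_x, hzt, hzs]
    · simp [hS.deg_eq z hzs hzt hzx, hzt, hzx, hzs]
  have hM2 : IsMatched Γ₂ C₂ ∅ := by
    refine (hM1.glue (G := S) (R := link (.inr none) b' c' s t x True) (by simp)
      (fun y hy => hd2 y ?_) ⊥ ∅ bot_le (fun _ _ h => h.elim) ?_).congr ?_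
    · intro h
      exact hy (by simp [h])
    · intro z hz
      have := (hd2' z).symm.trans hz
      omega
    · rintro (⟨⟨y, hy⟩ | (_ | z), hy'⟩ | z) hd
      · have : y ≠ p := fun h => hy' (by simp [h])
        simp [hy, this]
      · have := (hdn _).symm.trans hd
        omega
      · simp
      · simp
  refine ⟨_, inferInstance, Γ₂, C₂, ⟨hR2, by omega, hU2, hM2⟩, ?_, by omega, by omega, ⟨_, hd2' s⟩,
    fun d hd hd' => ?_⟩
  · have h1 : cnt Γ₁ 3 + 1 = cnt Γ 3 + 1 := by
      have := cnt_glue (Γ := Γ) (u := u) (G := addVertex S {s, t})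
        (R := link p b c none (some t) (some x) False) (d := 3) fun y => by rw [← hd1 y]
      rw [if_pos hu] at this
      refine this.trans (congrArg _ (Set.ncard_eq_one.2 ⟨none, ?_⟩))
      ext z
      change deg Γ₁ (.inr z) = 3 ↔ z = none
      rw [hd1']
      split_ifs with h <;> simp [h]
    -- The loss of `p` is enough for the strict decrease; that `none` ceases to be cubic is not
    -- counted.
    have h2 : cnt Γ₂ 3 + 1 ≤ cnt Γ₁ 3 + 0 := by
      have := cnt_glue_le (Γ := Γ₁) (u := .inl ⟨p, hpu⟩) (G := S)
        (R := link (.inr none) b' c' s t x True) (d := 3) fun y hy => by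
          by_cases hn : y.1 = .inr none
          · obtain ⟨y, hy1⟩ := y
            dsimp only at hn
            subst hn
            have := (hdn hy1).symm.trans hy
            omega
          · exact (hd2 y hn).symm.trans hy
      rw [if_pos hp1] at this
      refine this.trans_eq (congrArg _ ((Set.ncard_eq_zero).2 ?_))
      ext z
      change deg Γ₂ (.inr z) = 3 ↔ False
      rw [hd2']
      simp
    omega
  · have h1 : cnt Γ₁ d = cnt Γ d := by
      have := cnt_glue (Γ := Γ) (u := u) (G := addVertex S {s, t})
        (R := link p b c none (some t) (some x) False) (d := d) fun y => by rw [← hd1 y]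
      rw [if_neg (by omega), add_zero] at this
      refine this.trans (Nat.add_eq_left.2 ((Set.ncard_eq_zero).2 ?_))
      ext z
      change deg Γ₁ (.inr z) = d ↔ False
      rw [hd1']
      split_ifs with h <;> simp <;> omega
    have h2 : cnt Γ₂ d = cnt Γ₁ d := by
      have := cnt_glue (Γ := Γ₁) (u := .inl ⟨p, hpu⟩) (G := S)
        (R := link (.inr none) b' c' s t x True) (d := d) fun y => by
          by_cases hn : y.1 = .inr none
          · obtain ⟨y, hy1⟩ := y
            dsimp only at hn
            subst hn
            have h4 := hdn hy1
            have h3 := hd1' none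
            rw [if_pos rfl] at h3
            change deg Γ₂ _ = d ↔ _
            rw [h4, h3]
            omega
          · rw [← hd2 y hn]
      rw [if_neg (by omega), add_zero] at this
      refine this.trans (Nat.add_eq_left.2 ((Set.ncard_eq_zero).2 ?_))
      ext z
      change deg Γ₂ (.inr z) = d ↔ False
      rw [hd2']
      simp
      omega
    exact h2.trans h1

theorem IsState.exists_removeAll {X : Type} [Finite X] {S : SimpleGraph X} {s t x : X}
    (hS : IsSeedPole S s t x) : ∀ (n : ℕ) {V : Type} [Finite V] {Γ C : SimpleGraph V},
    IsState Γ C → (∃ v, deg Γ v = 4) → cnt Γ 3 = n →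
    ∃ (V' : Type) (_ : Finite V') (Γ' C' : SimpleGraph V'), IsState Γ' C' ∧ cnt Γ' 3 = 0 ∧
      Nat.card V' ≤ Nat.card V + n * (2 * Nat.card X) ∧ Nat.card V ≤ Nat.card V' ∧
      (∃ v, deg Γ' v = 4) ∧ ∀ d, d ≠ 3 → d ≠ 4 → cnt Γ' d = cnt Γ d := by
  intro n
  induction n using Nat.strong_induction_on with
  | _ n ih =>
    intro V _ Γ C h h4 hn
    by_cases h0 : n = 0
    · exact ⟨V, inferInstance, Γ, C, h, hn.trans h0, by omega, le_rfl, h4, fun _ _ _ => rfl⟩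
    · have h3 : ∃ v, deg Γ v = 3 := by
        by_contra! hc
        refine h0 (hn.symm.trans ((Set.ncard_eq_zero).2 ?_))
        ext v
        simpa using hc v
      obtain ⟨V', _, Γ', C', h', hlt, hc1, hc2, h4', hd⟩ := h.exists_removePair hS h3
      obtain ⟨V₂, _, Γ₂, C₂, h₂, hz, hc3, hc4, h4₂, hd₂⟩ := ih _ (hn ▸ hlt) h' h4' rfl
      refine ⟨V₂, inferInstance, Γ₂, C₂, h₂, hz, ?_, hc2.trans hc4, h4₂,
        fun d h3 h4 => (hd₂ d h3 h4).trans (hd d h3 h4)⟩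
      have : (cnt Γ' 3 + 1) * (2 * Nat.card X) ≤ n * (2 * Nat.card X) :=
        Nat.mul_le_mul_right _ (by omega)
      rw [add_mul, one_mul] at this
      omega

/-! ### Searching for hamiltonian cycles -/

/-- The edge `e` contains the vertex `v`. -/
def Inc (v : ℕ) (e : ℕ × ℕ) : Bool := e.1.beq v || e.2.beq v

lemma inc_iff {v : ℕ} {e : ℕ × ℕ} : Inc v e = true ↔ e.1 = v ∨ e.2 = v := by
  simp [Inc, Nat.beq_eq]

/-- Both entries `a` and `b` of a list are decreased by one. -/
def dec (l : List ℕ) (a b : ℕ) : List ℕ := (l.modify a (· - 1)).modify b (· - 1)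

lemma getD_modify (l : List ℕ) (a v : ℕ) :
    (l.modify a (· - 1)).getD v 0 = l.getD v 0 - if a = v then 1 else 0 := by
  rw [List.getD_eq_getElem?_getD, List.getD_eq_getElem?_getD, List.getElem?_modify]
  cases l[v]? with
  | none => simp
  | some n => split_ifs <;> simp

lemma getD_dec (l : List ℕ) {a b : ℕ} (hab : a ≠ b) (v : ℕ) :
    (dec l a b).getD v 0 = l.getD v 0 - if Inc v (a, b) then 1 else 0 := by
  rw [dec, getD_modify, getD_modify]
  simp only [inc_iff]
  split_ifs <;> omega

lemma ofDigits_modify (b : ℕ) {l : List ℕ} {a : ℕ} (ha : l.getD a 0 ≠ 0) :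
    Nat.ofDigits b (l.modify a (· - 1)) + b ^ a = Nat.ofDigits b l := by
  induction l generalizing a with
  | nil => simp at ha
  | cons d l ih =>
    rcases a with _ | a
    · simp only [List.getD_cons_zero] at ha
      simp only [List.modify_zero_cons, Nat.ofDigits_cons, pow_zero]
      omega
    · rw [List.getD_cons_succ] at ha
      rw [List.modify_succ_cons, Nat.ofDigits_cons, Nat.ofDigits_cons, ← ih ha]
      ring

/-- The digit of `n` with the index `v` in base four. -/
def digit (n v : ℕ) : ℕ := (n.div (Nat.pow 4 v)).mod 4

lemma digit_ofDigits {l : List ℕ} (hl : ∀ v, l.getD v 0 < 4) (v : ℕ) :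
    digit (Nat.ofDigits 4 l) v = l.getD v 0 := by
  change Nat.ofDigits 4 l / 4 ^ v % 4 = _
  induction l generalizing v with
  | nil => simp
  | cons d l ih =>
    have hd : d < 4 := hl 0
    rw [Nat.ofDigits_cons]
    rcases v with _ | v
    · rw [List.getD_cons_zero, pow_zero]
      omega
    · rw [List.getD_cons_succ, ← ih (fun v => hl (v + 1)) v, pow_succ', ← Nat.div_div_eq_div_mul,
        show (d + 4 * Nat.ofDigits 4 l) / 4 = Nat.ofDigits 4 l by omega]

/-- The number with the digits one at the ends of `e`. -/
def weight (e : ℕ × ℕ) : ℕ := Nat.add (Nat.pow 4 e.1) (Nat.pow 4 e.2)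

lemma ofDigits_dec {l : List ℕ} {e : ℕ × ℕ} (he : e.1 ≠ e.2) (h1 : l.getD e.1 0 ≠ 0)
    (h2 : l.getD e.2 0 ≠ 0) :
    (Nat.ofDigits 4 l).sub (weight e) = Nat.ofDigits 4 (dec l e.1 e.2) := by
  have h := ofDigits_modify 4 h1
  have h' := ofDigits_modify 4 (l := l.modify e.1 (· - 1)) (a := e.2)
    (by rw [getD_modify, if_neg he]; exact h2)
  change Nat.ofDigits 4 l - (4 ^ e.1 + 4 ^ e.2) = Nat.ofDigits 4 ((l.modify e.1 _).modify e.2 _)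
  omega

/-- The value of `f` at `n`, written such that `n` is evaluated first. -/
def force (n : ℕ) (f : ℕ → Bool) : Bool := Nat.rec (f 0) (fun k _ => f k.succ) n

lemma force_eq (n : ℕ) (f : ℕ → Bool) : force n f = f n := by cases n <;> rfl

/-- All sets of edges in which every vertex `v` is contained in `need v` edges and not contained in
`slack v` of the edges through `v` have the property `leaf`. Both functions are encoded by digits
in base four. -/
def search (leaf : List (ℕ × ℕ) → Bool) : List (ℕ × ℕ) → ℕ → ℕ → List (ℕ × ℕ) → Bool
  | [], _, _, ch => leaf ch
  | e :: es, need, slack, ch =>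
    ((digit need e.1).beq 0 || ((digit need e.2).beq 0 ||
      force (need.sub (weight e)) fun need => search leaf es need slack (e :: ch))) &&
    ((digit slack e.1).beq 0 || ((digit slack e.2).beq 0 ||
      force (slack.sub (weight e)) fun slack => search leaf es need slack ch))

/-- The set sought is given by `x`. At each edge the branch that agrees with `x` is not pruned,
because the edge still contributes to the need, respectively to the slack, of both its ends.
Following these branches leads to the leaf for this set. -/
lemma search_sound (x : ℕ × ℕ → Bool) (leaf : List (ℕ × ℕ) → Bool) :
    ∀ (es : List (ℕ × ℕ)) (need slack : List ℕ) (ch : List (ℕ × ℕ)), (∀ e ∈ es, e.1 ≠ e.2) →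
    (∀ v, need.getD v 0 < 4) → (∀ v, slack.getD v 0 < 4) →
    (∀ v, es.countP (fun e => Inc v e && x e) = need.getD v 0) →
    (∀ v, es.countP (fun e => Inc v e && !x e) = slack.getD v 0) →
    search leaf es (Nat.ofDigits 4 need) (Nat.ofDigits 4 slack) ch = true →
    ∃ ch', leaf ch' = true ∧ ∀ e, e ∈ ch' ↔ e ∈ ch ∨ e ∈ es ∧ x e = true := by
  intro es
  induction es with
  | nil => exact fun _ _ ch _ _ _ _ _ h => ⟨ch, h, by simp⟩
  | cons e es ih =>
    intro need slack ch hne hn4 hs4 hneed hslack h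
    have he := hne e List.mem_cons_self
    have hne' : ∀ e ∈ es, e.1 ≠ e.2 := fun e' h' => hne e' (List.mem_cons_of_mem _ h')
    have dec4 : ∀ l : List ℕ, (∀ v, l.getD v 0 < 4) → ∀ v, (dec l e.1 e.2).getD v 0 < 4 :=
      fun l hl v => by
        rw [getD_dec _ he]
        exact (Nat.sub_le _ _).trans_lt (hl v)
    simp only [search, Bool.and_eq_true, Bool.or_eq_true, Nat.beq_eq, digit_ofDigits hn4,
      digit_ofDigits hs4, force_eq] at h
    have i1 : Inc e.1 e = true := inc_iff.2 (Or.inl rfl)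
    have i2 : Inc e.2 e = true := inc_iff.2 (Or.inr rfl)
    cases hx : x e with
    | true =>
      have h1 := hneed e.1
      have h2 := hneed e.2
      rw [List.countP_cons_of_pos (by simp [i1, hx])] at h1
      rw [List.countP_cons_of_pos (by simp [i2, hx])] at h2
      rw [ofDigits_dec he (by omega) (by omega)] at h
      obtain ⟨ch', hl, hch⟩ := ih (dec need e.1 e.2) slack (e :: ch) hne' (dec4 _ hn4) hs4
        (fun v => by
          rw [getD_dec _ he, ← hneed v, List.countP_cons]
          cases hi : Inc v e <;> simp [hx]) (fun v => by
          rw [← hslack v, List.countP_cons_of_neg (by simp [hx])])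
          ((h.1.resolve_left (by omega)).resolve_left (by omega))
      refine ⟨ch', hl, fun e' => (hch e').trans ?_⟩
      simp only [List.mem_cons]
      constructor
      · rintro ((rfl | h) | h)
        · exact Or.inr ⟨Or.inl rfl, hx⟩
        · exact Or.inl h
        · exact Or.inr ⟨Or.inr h.1, h.2⟩
      · rintro (h | ⟨rfl | h, h'⟩)
        · exact Or.inl (Or.inr h)
        · exact Or.inl (Or.inl rfl)
        · exact Or.inr ⟨h, h'⟩
    | false =>
      have h1 := hslack e.1
      have h2 := hslack e.2
      rw [List.countP_cons_of_pos (by simp [i1, hx])] at h1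
      rw [List.countP_cons_of_pos (by simp [i2, hx])] at h2
      rw [ofDigits_dec (l := slack) he (by omega) (by omega)] at h
      obtain ⟨ch', hl, hch⟩ := ih need (dec slack e.1 e.2) ch hne' hn4 (dec4 _ hs4) (fun v => by
          rw [← hneed v, List.countP_cons_of_neg (by simp [hx])]) (fun v => by
          rw [getD_dec _ he, ← hslack v, List.countP_cons]
          cases hi : Inc v e <;> simp [hx])
          ((h.2.resolve_left (by omega)).resolve_left (by omega))
      refine ⟨ch', hl, fun e' => (hch e').trans (or_congr_right ?_)⟩
      simp only [List.mem_cons]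
      constructor
      · exact fun h => ⟨Or.inr h.1, h.2⟩
      · rintro ⟨rfl | h, h'⟩
        · rw [hx] at h'; cases h'
        · exact ⟨h, h'⟩

/-! ### Graphs given by lists of edges -/

/-- The graph on `Fin n` with the edges in `E`. -/
def ofList (n : ℕ) (E : List (ℕ × ℕ)) : SimpleGraph (Fin n) where
  Adj v w := v ≠ w ∧ ((v.val, w.val) ∈ E ∨ (w.val, v.val) ∈ E)
  symm := ⟨fun _ _ h => ⟨h.1.symm, h.2.symm⟩⟩
  loopless := ⟨fun _ h => h.1 rfl⟩

/-- The end of `e` different from `v`. -/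
def other (v : ℕ) (e : ℕ × ℕ) : ℕ := if e.1 = v then e.2 else e.1

open scoped Classical in
lemma deg_eq_countP {n : ℕ} {E : List (ℕ × ℕ)} {D : SimpleGraph (Fin n)} (hD : D ≤ ofList n E)
    (v : Fin n) (hnd : ((E.filter (Inc v)).map (other v)).Nodup) :
    deg D v = E.countP fun e => Inc v e && decide (∃ h1 h2, D.Adj ⟨e.1, h1⟩ ⟨e.2, h2⟩) := by
  set l := (E.filter fun e => Inc v e && decide (∃ h1 h2, D.Adj ⟨e.1, h1⟩ ⟨e.2, h2⟩)).map (other v)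
    with hl
  have hlnd : l.Nodup := by
    refine hnd.sublist ((List.monotone_filter_right _ fun e he => ?_).map _)
    exact (Bool.and_eq_true_iff.1 he).1
  have himg : Fin.val '' D.neighborSet v = (l.toFinset : Set ℕ) := by
    ext w
    simp only [Set.mem_image, mem_neighborSet, List.coe_toFinset, Set.mem_ofPred_eq, hl,
      List.mem_map, List.mem_filter, Bool.and_eq_true, inc_iff, decide_eq_true_eq]
    constructor
    · rintro ⟨w, hw, rfl⟩
      rcases (hD hw).2 with h | h
      · exact ⟨_, ⟨h, Or.inl rfl, v.2, w.2, hw⟩, by simp [other]⟩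
      · exact ⟨_, ⟨h, Or.inr rfl, w.2, v.2, hw.symm⟩, by simp [other, Fin.val_inj, hw.ne']⟩
    · rintro ⟨e, ⟨-, h, h1, h2, hadj⟩, rfl⟩
      rcases h with h | h
      · exact ⟨⟨e.2, h2⟩, by convert hadj using 1; exact Fin.ext h.symm, by simp [other, h]⟩
      · refine ⟨⟨e.1, h1⟩, by convert hadj.symm using 1; exact Fin.ext h.symm, ?_⟩
        rw [other, if_neg]
        intro h'
        exact hadj.ne (Fin.ext (h'.trans h.symm))
  rw [deg, ← Set.ncard_image_of_injective _ Fin.val_injective, himg, Set.ncard_coe_finset,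
    List.toFinset_card_of_nodup hlnd, hl, List.length_map, List.countP_eq_length_filter]

/-! ### A uniquely hamiltonian graph with paired cubic vertices -/

/-- The edges of the graph `base`, in the order of the search for hamiltonian cycles. -/
def baseEdges : List (ℕ × ℕ) :=
  [(1, 5), (0, 1), (1, 2), (4, 5), (5, 6), (6, 25), (6, 7), (2, 7), (2, 3), (7, 8), (3, 4), (3, 25),
   (4, 12), (0, 25), (0, 24), (24, 25), (8, 21), (8, 9), (10, 24), (23, 24), (9, 10), (10, 11),
   (9, 13), (12, 13), (11, 12), (11, 21), (13, 14), (14, 15), (14, 18), (15, 16), (15, 20),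
   (16, 17), (16, 23), (17, 18), (17, 22), (18, 19), (19, 23), (19, 20), (22, 23), (20, 21),
   (21, 22), (20, 22)]

/-- A graph with 20 vertices of degree three and 6 vertices of degree four. -/
def base : SimpleGraph (Fin 26) := ofList 26 baseEdges

/-- The edge `e` belongs to the hamiltonian cycle `0, 1, …, 25`. -/
def isCycleEdge (e : ℕ × ℕ) : Bool := (e.1 + 1).beq e.2 || (e.1.beq 0 && e.2.beq 25)

/-- The hamiltonian cycle of `base`. -/
def baseCycle : SimpleGraph (Fin 26) := ofList 26 (baseEdges.filter isCycleEdge)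

/-- The bit of `m` with the index `v`. -/
def bit (m v : ℕ) : Bool := ((m.shiftRight v).mod 2).beq 1

/-- If the edge `e` meets the bit set `m`, then its ends are added to `m`. -/
def spread (e : ℕ × ℕ) (k : ℕ → Bool) (m : ℕ) : Bool :=
  bif bit m e.1 then bif bit m e.2 then k m else force (m.add (Nat.shiftLeft 1 e.2)) k
  else bif bit m e.2 then force (m.add (Nat.shiftLeft 1 e.1)) k else k m

/-- The bit set `m` witnesses that the edges in `ch` do not connect all vertices below 26. -/
def separates (ch : List (ℕ × ℕ)) (m : ℕ) : Bool :=
  bit m 0 && (ch.all (fun e => bit m e.1 == bit m e.2) &&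
    (List.range 26).any fun v => !bit m v)

/-- All edges in `ch` lie on the hamiltonian cycle of `base`, or a set of vertices that is found by
spreading from `0` along the edges in `ch` is separated. -/
def baseLeaf (ch : List (ℕ × ℕ)) : Bool :=
  ch.all isCycleEdge ||
    ch.foldr spread (ch.reverse.foldr spread
      (ch.foldr spread (ch.reverse.foldr spread (separates ch)))) 1

/-- Correctness rests on the final test `separates` alone. The order and number of the spreading
passes only affect whether that test succeeds. -/
lemma exists_separates {ch : List (ℕ × ℕ)} {k : ℕ → Bool} {m : ℕ} (es : List (ℕ × ℕ))
    (hk : ∀ m, k m = true → ∃ m', separates ch m' = true)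
    (h : es.foldr spread k m = true) : ∃ m', separates ch m' = true := by
  induction es generalizing m with
  | nil => exact hk m h
  | cons e es ih =>
    simp only [List.foldr_cons, spread, force_eq] at h
    cases h1 : bit m e.1 <;> cases h2 : bit m e.2 <;>
      simp only [h1, h2, cond_true, cond_false] at h <;> exact ih h

/-- A hamiltonian cycle uses two edges at every vertex, so the slack is the degree minus two: 1 at
the first 20 vertices and 2 at the last six. -/
lemma search_base : search baseLeaf baseEdges (Nat.ofDigits 4 (List.replicate 26 2))
    (Nat.ofDigits 4 (List.replicate 20 1 ++ List.replicate 6 2)) [] = true := by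
  decide +kernel

instance (n : ℕ) (E : List (ℕ × ℕ)) : DecidableRel (ofList n E).Adj := fun v w =>
  inferInstanceAs (Decidable (v ≠ w ∧ ((v.val, w.val) ∈ E ∨ (w.val, v.val) ∈ E)))

lemma deg_ofList {n : ℕ} {E : List (ℕ × ℕ)} (hE : ∀ e ∈ E, e.1 < n ∧ e.2 < n ∧ e.1 ≠ e.2)
    (v : Fin n) (hnd : ((E.filter (Inc v)).map (other v)).Nodup) :
    deg (ofList n E) v = E.countP (Inc v) := by
  classical
  rw [deg_eq_countP le_rfl v hnd]
  refine List.countP_congr fun e he => ?_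
  have := hE e he
  simp only [Bool.and_eq_true, decide_eq_true_eq, and_iff_left_iff_imp]
  exact fun _ => ⟨this.1, this.2.1, fun h => this.2.2 (congrArg Fin.val h), Or.inl he⟩

lemma baseEdges_lt : ∀ e ∈ baseEdges, e.1 < 26 ∧ e.2 < 26 ∧ e.1 ≠ e.2 := by decide

lemma baseEdges_nodup : ∀ v : Fin 26, ((baseEdges.filter (Inc v)).map (other v)).Nodup := by
  decide +kernel

lemma deg_base (v : Fin 26) : deg base v = if v.val < 20 then 3 else 4 := by
  rw [base, deg_ofList baseEdges_lt v (baseEdges_nodup v)]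
  revert v
  decide +kernel

lemma baseCycle_le : baseCycle ≤ base := fun _ _ h =>
  ⟨h.1, h.2.imp (fun h => (List.mem_filter.1 h).1) fun h => (List.mem_filter.1 h).1⟩

lemma baseCycle_adj_succ : ∀ i : Fin 25, baseCycle.Adj i.castSucc i.succ := by
  unfold baseCycle
  decide +kernel

lemma baseCycle_isHamGraph : IsHamGraph baseCycle := by
  constructor
  · have key : ∀ i : Fin 26, baseCycle.Reachable 0 i := by
      intro i
      induction i using Fin.induction with
      | zero => exact Reachable.refl _
      | succ i ih => exact ih.trans (baseCycle_adj_succ i).reachable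
    exact fun v w => (key v).symm.trans (key w)
  · intro v
    rw [baseCycle, deg_ofList (fun e he => baseEdges_lt e (List.mem_filter.1 he).1) v
      ((baseEdges_nodup v).sublist ((List.filter_sublist.filter _).map _))]
    revert v
    decide +kernel

lemma exists_not_reachable {D : SimpleGraph (Fin 26)} {ch : List (ℕ × ℕ)} {m : ℕ}
    (hD : ∀ v w, D.Adj v w → (v.val, w.val) ∈ ch ∨ (w.val, v.val) ∈ ch)
    (h : separates ch m = true) : ∃ w, ¬ D.Reachable 0 w := by
  simp only [separates, Bool.and_eq_true, List.all_eq_true, List.any_eq_true, List.mem_range,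
    beq_iff_eq, Bool.not_eq_true'] at h
  obtain ⟨h2, h1, w, hw, h3⟩ := h
  refine ⟨⟨w, hw⟩, fun hr => ?_⟩
  have := mem_of_reachable {v : Fin 26 | bit m v = true} (fun v w hvw hv => ?_) hr h2
  · exact Bool.false_ne_true (h3.symm.trans this)
  · rcases hD v w hvw with h | h
    · exact (h1 _ h).symm.trans hv
    · exact (h1 _ h).trans hv

/-- Apply the search to the edges of `D`. The leaf reached shows either that `D` lies in
`baseCycle`, hence equals it, or that some set containing `0` is cut off from the rest, which
connectivity of `D` excludes. -/
lemma base_eq_of_le {D : SimpleGraph (Fin 26)} (hD : D ≤ base) (hH : IsHamGraph D) :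
    D = baseCycle := by
  classical
  let x : ℕ × ℕ → Bool := fun e => decide (∃ h1 h2, D.Adj ⟨e.1, h1⟩ ⟨e.2, h2⟩)
  have hout : ∀ v, ¬ v < 26 → baseEdges.countP (Inc v) = 0 := by
    intro v hv
    rw [List.countP_eq_zero]
    intro e he hi
    have := baseEdges_lt e he
    rcases inc_iff.1 hi with h | h <;> omega
  have hneed : ∀ v, baseEdges.countP (fun e => Inc v e && x e) =
      (List.replicate 26 2).getD v 0 := by
    intro v
    by_cases hv : v < 26
    · rw [← deg_eq_countP hD ⟨v, hv⟩ (baseEdges_nodup ⟨v, hv⟩), hH.deg_eq,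
        List.getD_eq_getElem _ _ (by simpa using hv), List.getElem_replicate]
    · have : baseEdges.countP (fun e => Inc v e && x e) ≤ baseEdges.countP (Inc v) :=
        List.countP_mono_left fun e _ he => (Bool.and_eq_true_iff.1 he).1
      rw [hout v hv] at this
      simpa [List.getD_eq_getElem?_getD, hv] using this
  have hslack : ∀ v, baseEdges.countP (fun e => Inc v e && !x e) =
      (List.replicate 20 1 ++ List.replicate 6 2).getD v 0 := by
    intro v
    have hsum : baseEdges.countP (fun e => Inc v e && x e) +
        baseEdges.countP (fun e => Inc v e && !x e) = baseEdges.countP (Inc v) := by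
      induction baseEdges with
      | nil => rfl
      | cons e es ih =>
        simp only [List.countP_cons]
        rw [← ih]
        cases Inc v e <;> cases x e <;> simp <;> omega
    rw [hneed] at hsum
    by_cases hv : v < 26
    · have hd := deg_base ⟨v, hv⟩
      rw [base, deg_ofList baseEdges_lt ⟨v, hv⟩ (baseEdges_nodup ⟨v, hv⟩)] at hd
      dsimp only at hd
      rw [hd] at hsum
      have : ∀ v : Fin 26, (if v.val < 20 then 3 else 4) = (List.replicate 26 2).getD v 0 +
          (List.replicate 20 1 ++ List.replicate 6 2).getD v 0 := by decide
      have := this ⟨v, hv⟩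
      dsimp only at this
      omega
    · rw [hout v hv] at hsum
      have : (List.replicate 20 1 ++ List.replicate 6 2).getD v 0 = 0 := by
        rw [List.getD_eq_default]
        simpa using hv
      omega
  have lt : ∀ l : List ℕ, (∀ d ∈ l, d < 4) → ∀ v, l.getD v 0 < 4 := fun l hl v => by
    by_cases hv : v < l.length
    · rw [List.getD_eq_getElem _ _ hv]
      exact hl _ (List.getElem_mem hv)
    · rw [List.getD_eq_default _ _ (by omega)]
      norm_num
  obtain ⟨ch, hl, hch⟩ := search_sound x baseLeaf baseEdges _ _ []
    (fun e he => (baseEdges_lt e he).2.2) (lt _ (by decide)) (lt _ (by decide)) hneed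
    hslack search_base
  have hDch : ∀ v w, D.Adj v w → (v.val, w.val) ∈ ch ∨ (w.val, v.val) ∈ ch := by
    intro v w h
    rcases (hD h).2 with h' | h'
    · exact Or.inl ((hch _).2 (Or.inr ⟨h', decide_eq_true ⟨v.2, w.2, h⟩⟩))
    · exact Or.inr ((hch _).2 (Or.inr ⟨h', decide_eq_true ⟨w.2, v.2, h.symm⟩⟩))
  rcases Bool.or_eq_true_iff.1 hl with h | h
  · refine baseCycle_isHamGraph.eq_of_le hH fun v w hvw => ⟨hvw.ne, ?_⟩
    have hmem : ∀ e ∈ ch, e ∈ baseEdges.filter isCycleEdge := fun e he =>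
      List.mem_filter.2 ⟨by simpa using ((hch e).1 he).imp_right And.left,
        List.all_eq_true.1 h e he⟩
    exact (hDch v w hvw).imp (hmem _) (hmem _)
  · obtain ⟨m, hm⟩ := exists_separates _ (fun _ => exists_separates _ fun _ =>
      exists_separates _ fun _ => exists_separates _ fun m hm => ⟨m, hm⟩) h
    obtain ⟨w, hw⟩ := exists_not_reachable hDch hm
    exact absurd (hH.reachable 0 w) hw

lemma base_isUnique : IsUnique base ∅ baseCycle :=
  ⟨baseCycle_le, baseCycle_isHamGraph, fun D hD hoff => base_eq_of_le hD
    ⟨fun v w => hoff.reachable v w (by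
      rcases hoff.deg_eq v with h | h
      · omega
      · exact absurd h.1 (Set.notMem_empty v)) (by
      rcases hoff.deg_eq w with h | h
      · omega
      · exact absurd h.1 (Set.notMem_empty w)), fun v => by
      rcases hoff.deg_eq v with h | h
      · exact h
      · exact absurd h.1 (Set.notMem_empty v)⟩⟩

/-! ### Connectivity and pairing of the starting graph -/

/-- Two vertices split the cycle `0, 1, …, 25` into two arcs. When both are nonempty, some edge
joins them, so deleting any two vertices leaves the graph connected. -/
lemma base_chord : ∀ p q : Fin 26, p.val + 1 < q → 0 < p.val ∨ q.val < 25 →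
    ∃ e ∈ baseEdges, p.val < e.1 ∧ e.1 < q ∧ (e.2 < p.val ∨ q.val < e.2) ∨
      p.val < e.2 ∧ e.2 < q ∧ (e.1 < p.val ∨ q.val < e.1) := by
  decide +kernel

lemma base_robust : Robust base := by
  have hsucc : ∀ i (hi : i + 1 < 26), base.Adj ⟨i, by omega⟩ ⟨i + 1, hi⟩ := fun i hi =>
    baseCycle_le (baseCycle_adj_succ ⟨i, by omega⟩)
  have hlast : base.Adj ⟨25, by omega⟩ ⟨0, by omega⟩ := by
    unfold base
    decide
  have path : ∀ (S : Set (Fin 26)) (i j : ℕ) (hi : i < 26) (hj : j < 26), i ≤ j →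
      (∀ l (hl : l < 26), i ≤ l → l ≤ j → (⟨l, hl⟩ : Fin 26) ∉ S) →
      (del base S).Reachable ⟨i, hi⟩ ⟨j, hj⟩ := by
    intro S i j hi hj hij
    induction j, hij using Nat.le_induction with
    | base => exact fun _ => Reachable.refl _
    | succ j hij ih =>
      intro h
      exact (ih (by omega) fun l hl h1 h2 => h l hl h1 (by omega)).trans (Adj.reachable
        ⟨hsucc j hj, h _ _ hij (by omega), h _ _ (by omega) le_rfl⟩)
  have main : ∀ p q : Fin 26, p ≤ q → ∃ r, ∀ v, v ≠ p → v ≠ q →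
      (del base {p, q}).Reachable v r := by
    rintro ⟨p, hp⟩ ⟨q, hq⟩ hpq
    have hpq : p ≤ q := hpq
    have path' : ∀ (i j : ℕ) (hi : i < 26) (hj : j < 26),
        (i < p ↔ j < p) → (i < q ↔ j < q) → i ≠ p → i ≠ q → j ≠ p → j ≠ q →
        (del base {⟨p, hp⟩, ⟨q, hq⟩}).Reachable ⟨i, hi⟩ ⟨j, hj⟩ := by
      intro i j hi hj h1 h2 h3 h4 h5 h6
      rcases le_total i j with h | h
      · refine path _ i j hi hj h fun l hl h7 h8 => ?_
        simp only [Set.mem_insert_iff, Set.mem_singleton_iff, Fin.mk.injEq]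
        omega
      · refine (path _ j i hj hi h fun l hl h7 h8 => ?_).symm
        simp only [Set.mem_insert_iff, Set.mem_singleton_iff, Fin.mk.injEq]
        omega
    have outer : ∀ (i j : ℕ) (hi : i < 26) (hj : j < 26), i < p ∨ q < i → j < p ∨ q < j →
        (del base {⟨p, hp⟩, ⟨q, hq⟩}).Reachable ⟨i, hi⟩ ⟨j, hj⟩ := by
      have h0 : ∀ (i j : ℕ) (hi : i < 26) (hj : j < 26), i < p → q < j →
          (del base {⟨p, hp⟩, ⟨q, hq⟩}).Reachable ⟨i, hi⟩ ⟨j, hj⟩ := by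
        intro i j hi hj h1 h2
        have h3 := path' i 0 hi (by omega) (by omega) (by omega) (by omega) (by omega) (by omega)
          (by omega)
        have h4 := path' 25 j (by omega) hj (by omega) (by omega) (by omega) (by omega) (by omega)
          (by omega)
        refine (h3.trans (Adj.reachable ⟨hlast.symm, ?_, ?_⟩)).trans h4 <;>
        · simp only [Set.mem_insert_iff, Set.mem_singleton_iff, Fin.mk.injEq]
          omega
      intro i j hi hj h1 h2
      rcases h1 with h1 | h1 <;> rcases h2 with h2 | h2
      · exact path' i j hi hj (by omega) (by omega) (by omega) (by omega) (by omega) (by omega)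
      · exact h0 i j hi hj h1 h2
      · exact (h0 j i hj hi h2 h1).symm
      · exact path' i j hi hj (by omega) (by omega) (by omega) (by omega) (by omega) (by omega)
    by_cases hmid : p + 1 < q
    · by_cases hout : 0 < p ∨ q < 25
      · obtain ⟨i, j, hi, hj, hadj, h1, h2, h3⟩ : ∃ (i j : ℕ) (hi : i < 26) (hj : j < 26),
            base.Adj ⟨i, hi⟩ ⟨j, hj⟩ ∧ p < i ∧ i < q ∧ (j < p ∨ q < j) := by
          obtain ⟨e, he, h⟩ := base_chord ⟨p, hp⟩ ⟨q, hq⟩ hmid hout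
          obtain ⟨h1, h2, h3⟩ := baseEdges_lt e he
          rcases h with h | h
          · exact ⟨e.1, e.2, h1, h2, ⟨by simpa using h3, Or.inl he⟩, h⟩
          · exact ⟨e.2, e.1, h2, h1, ⟨by simpa using h3.symm, Or.inr he⟩, h⟩
        refine ⟨⟨i, hi⟩, ?_⟩
        rintro ⟨v, hv⟩ hvp hvq
        have hvp : v ≠ p := fun h => hvp (Fin.ext h)
        have hvq : v ≠ q := fun h => hvq (Fin.ext h)
        by_cases hv' : v < p ∨ q < v
        · refine (outer v j hv hj hv' h3).trans (Adj.reachable ⟨hadj.symm, ?_, ?_⟩) <;>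
          · simp only [Set.mem_insert_iff, Set.mem_singleton_iff, Fin.mk.injEq]
            omega
        · exact path' v i hv hi (by omega) (by omega) hvp hvq (by omega) (by omega)
      · refine ⟨⟨1, by omega⟩, ?_⟩
        rintro ⟨v, hv⟩ hvp hvq
        have hvp : v ≠ p := fun h => hvp (Fin.ext h)
        have hvq : v ≠ q := fun h => hvq (Fin.ext h)
        exact path' v 1 hv (by omega) (by omega) (by omega) hvp hvq (by omega) (by omega)
    · obtain ⟨r, hr, hr'⟩ : ∃ r, r < 26 ∧ (r < p ∨ q < r) := by
        by_cases h0 : 0 < p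
        · exact ⟨0, by omega, Or.inl h0⟩
        · exact ⟨25, by omega, Or.inr (by omega)⟩
      refine ⟨⟨r, hr⟩, ?_⟩
      rintro ⟨v, hv⟩ hvp hvq
      have hvp : v ≠ p := fun h => hvp (Fin.ext h)
      have hvq : v ≠ q := fun h => hvq (Fin.ext h)
      exact outer v r hv hr (by omega) hr'
  intro p q v w hvp hvq hwp hwq
  rcases le_total p q with h | h
  · obtain ⟨r, hr⟩ := main p q h
    exact (hr v hvp hvq).trans (hr w hwp hwq).symm
  · obtain ⟨r, hr⟩ := main q p h
    rw [Set.pair_comm]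
    exact (hr v hvq hvp).trans (hr w hwq hwp).symm

lemma base_matched : IsMatched base baseCycle ∅ := by
  -- The pairs are `2i`, `2i + 1` for `i < 10`, consecutive vertices of the cycle.
  let M : SimpleGraph (Fin 26) :=
    { Adj := fun v w => v ≠ w ∧ v.val < 20 ∧ v.val / 2 = w.val / 2
      symm := ⟨fun v w h => ⟨h.1.symm, by omega, h.2.2.symm⟩⟩
      loopless := ⟨fun v h => h.1 rfl⟩ }
  refine ⟨M, ?_, fun v w h => ⟨by rw [deg_base, if_pos h.2.1], by simp⟩, fun v hv _ => ?_⟩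
  · have hlt : ∀ v w : Fin 26, v < w → M.Adj v w → baseCycle.Adj v w := by
      rintro ⟨v, hv⟩ ⟨w, hw⟩ hlt ⟨-, -, h⟩
      have hlt : v < w := hlt
      have : w = v + 1 := by dsimp only at h; omega
      subst this
      exact baseCycle_adj_succ ⟨v, by omega⟩
    intro v w h
    rcases lt_or_gt_of_ne h.1 with h' | h'
    · exact hlt v w h' h
    · exact (hlt w v h' h.symm).symm
  · have hv20 : v.val < 20 := by
      rw [deg_base] at hv
      split_ifs at hv with h
      · exact h
      · omega
    obtain ⟨v, hv'⟩ := v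
    dsimp only at hv20
    refine ⟨⟨if v % 2 = 0 then v + 1 else v - 1, by split_ifs <;> omega⟩, ?_, ?_⟩
    · refine ⟨?_, hv20, ?_⟩
      · simp only [ne_eq, Fin.mk.injEq]; split_ifs <;> omega
      · dsimp only; split_ifs <;> omega
    · rintro ⟨w, hw⟩ ⟨h1, -, h2⟩
      simp only [ne_eq, Fin.mk.injEq] at h1 h2 ⊢
      split_ifs <;> omega

lemma base_isState : IsState base baseCycle :=
  ⟨base_robust, by simp, base_isUnique, base_matched⟩

lemma cnt_base_le {d : ℕ} (hd : d ≠ 3) : cnt base d ≤ if d = 4 then 26 else 0 := by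
  split_ifs with hd'
  · refine (Set.ncard_le_card _).trans_eq (by simp)
  · rw [Nat.le_zero, cnt, Set.ncard_eq_zero]
    ext v
    have := deg_base v
    simp only [Set.mem_ofPred_eq, Set.mem_empty_iff_false, iff_false]
    split_ifs at this <;> omega

/-! ### Graphs with prescribed degrees of at least three -/

lemma cnt_pos_iff [Finite V] {G : SimpleGraph V} {d : ℕ} : 0 < cnt G d ↔ ∃ v, deg G v = d :=
  Set.ncard_pos

/-- One use of `IsState.exists_addDegree` for every entry of `L`. The factor 2 allows for the two
hubs that appear for odd degrees, and 26 is a crude bound for the vertices of degree 4 in `base`. -/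
lemma exists_state (L : List ℕ) (hL : ∀ d ∈ L, 3 ≤ d) :
    ∃ (V : Type) (_ : Finite V) (Γ C : SimpleGraph V), IsState Γ C ∧ (∃ v, deg Γ v = 3) ∧
      L.length ≤ Nat.card V ∧ Nat.card V ≤ 26 + 2 * L.sum ∧
      ∀ d, d ≠ 3 → (if d = 4 then 1 else 0) + L.count d ≤ cnt Γ d ∧
        cnt Γ d ≤ (if d = 4 then 26 else 0) + 2 * L.count d := by
  induction L with
  | nil =>
    refine ⟨Fin 26, inferInstance, base, baseCycle, base_isState, ⟨0, deg_base 0⟩, by simp,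
      by simp, fun d hd => ⟨?_, by simpa using cnt_base_le hd⟩⟩
    split_ifs with h
    · subst h
      exact cnt_pos_iff.2 ⟨25, deg_base 25⟩
    · simp
  | cons d L ih =>
    obtain ⟨V, _, Γ, C, h, h3, hc1, hc2, hd⟩ := ih fun d hd => hL d (List.mem_cons_of_mem _ hd)
    have hd3 := hL d List.mem_cons_self
    obtain ⟨V', _, Γ', C', h', h3', hc3, hc4, n, hn1, hn2, hd'⟩ := h.exists_addDegree h3 (d - 3)
    rw [Nat.sub_add_cancel hd3] at hc4 hd'
    refine ⟨V', inferInstance, Γ', C', h', h3', ?_, ?_, fun e he => ?_⟩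
    · rw [List.length_cons]; omega
    · rw [List.sum_cons]; omega
    · have h1 := hd e he
      rw [hd' e he, List.count_cons]
      simp only [beq_iff_eq, eq_comm (a := d)]
      split_ifs at h1 ⊢ <;> omega

lemma card_verticesOfDegree [Fintype V] (G : SimpleGraph V) (d : ℕ) :
    (verticesOfDegree G d).card = cnt G d := by
  classical
  rw [cnt, ← Set.ncard_coe_finset]
  congr 1
  ext v
  simp [verticesOfDegree, degree_eq_deg]

lemma mem_degreeSet_iff [Fintype V] {G : SimpleGraph V} {d : ℕ} :
    d ∈ degreeSet G ↔ 0 < cnt G d := by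
  classical
  rw [cnt_pos_iff, degreeSet, Set.mem_range]
  simp only [degree_eq_deg]

lemma IsState.isKConnected [Fintype V] {Γ C : SimpleGraph V} (h : IsState Γ C) :
    IsKConnected 3 Γ :=
  isKConnected_three_iff.2 ⟨Nat.card_eq_fintype_card (α := V) ▸ h.three_lt, h.robust⟩

lemma IsState.isUniquelyHamiltonian [Finite V] {Γ C : SimpleGraph V} (h : IsState Γ C) :
    IsUniquelyHamiltonian Γ := by
  have : Nonempty V := (Nat.card_pos_iff.1 (by have := h.three_lt; omega)).1
  exact isUniquelyHamiltonian_iff.2 ⟨C, h.unique⟩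

lemma IsState.realizes [Fintype V] {Γ C : SimpleGraph V} (h : IsState Γ C) {M : Finset ℕ}
    (h2 : 2 ∉ M) (hM : ∀ d, 0 < cnt Γ d ↔ d ∈ M) : Realizes Γ M := by
  refine ⟨?_, h.isUniquelyHamiltonian, by rw [if_neg h2]; exact h.isKConnected⟩
  ext d
  rw [mem_degreeSet_iff, hM, Finset.mem_coe]

/-- A property of arbitrarily large finite graphs is shared by infinitely many pairwise
nonisomorphic graphs. -/
lemma exists_sequence (Q : ∀ (V : Type) [Fintype V], SimpleGraph V → Prop)
    (h : ∀ n, ∃ (V : Type) (_ : Fintype V) (G : SimpleGraph V), Q V G ∧ n ≤ Fintype.card V) :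
    ∃ (V : ℕ → Type) (_ : ∀ i, Fintype (V i)) (G : ∀ i, SimpleGraph (V i)),
      (∀ i, Q (V i) (G i)) ∧ ∀ i j, i ≠ j → IsEmpty (G i ≃g G j) := by
  have hS : {n | ∃ (V : Type) (_ : Fintype V) (G : SimpleGraph V),
      Q V G ∧ Fintype.card V = n}.Infinite :=
    Set.infinite_of_forall_exists_gt fun n => by
      obtain ⟨V, i, G, hG, hn⟩ := h (n + 1)
      exact ⟨_, ⟨V, i, G, hG, rfl⟩, hn⟩
  choose V i G hG hc using fun n => (hS.natEmbedding _ n).2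
  refine ⟨V, i, G, hG, fun m n hmn => ⟨fun f => hmn ?_⟩⟩
  apply (hS.natEmbedding _).injective
  apply Subtype.ext
  rw [← hc, ← hc]
  exact Fintype.card_congr f.toEquiv

lemma exists_four_regular {X : Type} [Finite X] {S : SimpleGraph X} {s t x : X}
    (hS : IsSeedPole S s t x) (n : ℕ) :
    ∃ (V : Type) (_ : Fintype V) (G : SimpleGraph V),
      IsThreeConnectedUH4Regular G ∧ n ≤ Fintype.card V := by
  classical
  obtain ⟨V, _, Γ, C, h, -, hn, -, hd⟩ := exists_state (List.replicate n 4)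
    (fun d hd => by rw [List.eq_of_mem_replicate hd]; norm_num)
  obtain ⟨V', _, Γ', C', h', h0, -, hn', -, hd'⟩ := h.exists_removeAll hS _
    (cnt_pos_iff.1 (by have := (hd 4 (by norm_num)).1; rw [if_pos rfl] at this; omega)) rfl
  have := Fintype.ofFinite V'
  rw [List.length_replicate] at hn
  refine ⟨V', inferInstance, Γ', ⟨h'.isKConnected, h'.isUniquelyHamiltonian, fun v => ?_⟩,
    Nat.card_eq_fintype_card (α := V') ▸ hn.trans hn'⟩
  rw [degree_eq_deg]
  by_contra h4
  have h1 : 0 < cnt Γ' (deg Γ' v) := cnt_pos_iff.2 ⟨v, rfl⟩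
  have h3 : deg Γ' v ≠ 3 := fun h => by rw [h] at h1; omega
  have h2 := (hd _ h3).2
  rw [hd' _ h3 h4] at h1
  rw [if_neg h4, List.count_replicate, if_neg (by simpa using Ne.symm h4)] at h2
  omega

/-- Degrees in `D₁` are entered once, which gives at most 26 + 2 = 28 vertices. Degrees in `D₂` are
entered `i + 1` times, while the number of vertices is at most a constant times `i + 1`. -/
lemma exists_realizes {X : Type} [Finite X] {S : SimpleGraph X} {s t x : X}
    (hS : IsSeedPole S s t x) {M D₁ D₂ : Finset ℕ} {d₀ : ℕ} (h4 : 4 ∈ M)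
    (hd₀ : IsLeast (M : Set ℕ) d₀) (h3 : 3 ≤ d₀) (hdis : Disjoint D₁ D₂)
    (hun : D₁ ∪ D₂ = M.erase d₀) :
    ∃ K, 0 < K ∧ ∀ i, ∃ (V : Type) (_ : Fintype V) (G : SimpleGraph V),
      (Realizes G M ∧ (∀ d ∈ D₁, cnt G d ≤ 28) ∧ ∀ d ∈ D₂, Fintype.card V ≤ K * cnt G d) ∧
        i ≤ Fintype.card V := by
  classical
  have h2M : 2 ∉ M := fun h => by have := hd₀.2 h; omega
  have hD₁ : ∀ d ∈ D₁, d ∈ M ∧ d ≠ d₀ ∧ d ∉ D₂ := fun d hd => by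
    have h := Finset.mem_erase.1 (hun ▸ Finset.mem_union_left _ hd)
    exact ⟨h.2, h.1, Finset.disjoint_left.1 hdis hd⟩
  have hD₂ : ∀ d ∈ D₂, d ∈ M ∧ d ≠ d₀ := fun d hd => by
    have h := Finset.mem_erase.1 (hun ▸ Finset.mem_union_right _ hd)
    exact ⟨h.2, h.1⟩
  -- The copies of `d₀`, whose frequency is not restricted, make the graphs large even if `D₂` is
  -- empty.
  let L : ℕ → List ℕ := fun i =>
    M.toList ++ ((List.replicate i D₂.toList).flatten ++ List.replicate i d₀)
  have hLmem : ∀ i d, d ∈ L i → d ∈ M := by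
    intro i d hd
    simp only [L, List.mem_append, List.mem_flatten, List.mem_replicate, Finset.mem_toList] at hd
    rcases hd with h | ⟨l, ⟨-, rfl⟩, h⟩ | ⟨-, rfl⟩
    · exact h
    · exact (hD₂ d (Finset.mem_toList.1 h)).1
    · exact hd₀.1
  have hcount : ∀ i d, (L i).count d =
      (if d ∈ M then 1 else 0) + i * (if d ∈ D₂ then 1 else 0) + if d = d₀ then i else 0 := by
    intro i d
    simp only [L, List.count_append, List.count_flatten, List.map_replicate, List.sum_replicate,
      List.count_replicate, beq_iff_eq, smul_eq_mul, (Finset.nodup_toList _).count,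
      Finset.mem_toList, eq_comm (a := d₀)]
    omega
  have hsum : ∀ i, (L i).sum ≤ (i + 1) * (M.toList.sum + D₂.toList.sum + d₀) := by
    intro i
    simp only [L, List.sum_append, List.sum_flatten, List.map_replicate, List.sum_replicate,
      smul_eq_mul]
    nlinarith [Nat.zero_le (D₂.toList.sum), Nat.zero_le d₀, Nat.zero_le (i * M.toList.sum)]
  obtain ⟨K₀, hK₀⟩ : ∃ K₀, K₀ = 26 + 2 * (M.toList.sum + D₂.toList.sum + d₀) := ⟨_, rfl⟩
  have hcardK : ∀ i c, c ≤ 26 + 2 * (L i).sum → c ≤ K₀ * (i + 1) := by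
    intro i c hc
    have := hsum i
    rw [hK₀]
    nlinarith
  have key : ∀ i, ∃ (V : Type) (_ : Finite V) (G C : SimpleGraph V), IsState G C ∧
      (∀ d, 0 < cnt G d ↔ d ∈ M) ∧ i ≤ Nat.card V ∧
      Nat.card V ≤ K₀ * (i + 1) * (1 + 2 * Nat.card X) ∧
      ∀ d, d ≠ d₀ → (L i).count d ≤ cnt G d ∧
        cnt G d ≤ (if d = 4 then 26 else 0) + 2 * (L i).count d := by
    intro i
    obtain ⟨V, _, Γ, C, h, hcub, hc1, hc2, hd⟩ := exists_state (L i)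
      (fun d hd => h3.trans (hd₀.2 (hLmem i d hd)))
    have hi : i ≤ Nat.card V := by
      refine le_trans ?_ hc1
      simp only [L, List.length_append, List.length_replicate]
      omega
    have hc2 := hcardK i _ hc2
    have hmem : ∀ d, d ≠ 3 → (0 < cnt Γ d ↔ d ∈ M) := by
      intro d hd3
      have h1 := hd d hd3
      constructor
      · intro hpos
        by_contra hdM
        have hd4 : d ≠ 4 := fun h => hdM (h ▸ h4)
        have := List.count_eq_zero.2 fun h => hdM (hLmem i d h)
        rw [this, if_neg hd4, if_neg hd4] at h1
        omega
      · intro hdM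
        have := hcount i d
        rw [if_pos hdM] at this
        omega
    -- As `4 ∈ M`, the least element is 3 or 4. In the first case the cubic vertices are kept. In
    -- the second they are all removed with seeds, which enlarges the graph by at most the factor `1
    -- + 2 * Nat.card X`.
    by_cases h30 : d₀ = 3
    · refine ⟨V, inferInstance, Γ, C, h, fun d => ?_, hi, hc2.trans (Nat.le_mul_of_pos_right _
        (by omega)), fun d hd' => ⟨?_, (hd d (h30 ▸ hd')).2⟩⟩
      · by_cases hd3 : d = 3
        · subst hd3
          exact iff_of_true (cnt_pos_iff.2 hcub) (h30 ▸ hd₀.1)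
        · exact hmem d hd3
      · have := (hd d (h30 ▸ hd')).1
        omega
    · have h40 : d₀ = 4 := by have := hd₀.2 h4; omega
      have h3M : 3 ∉ M := fun h => by have := hd₀.2 h; omega
      obtain ⟨V', _, Γ', C', h', h0, hc3, hc4, hq, hd'⟩ := h.exists_removeAll hS _
        (cnt_pos_iff.1 ((hmem 4 (by norm_num)).2 h4)) rfl
      refine ⟨V', inferInstance, Γ', C', h', fun d => ?_, hi.trans hc4, ?_, fun d hd4 => ?_⟩
      · by_cases hd3 : d = 3
        · subst hd3
          exact iff_of_false (by omega) h3M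
        · by_cases hd4 : d = 4
          · subst hd4
            exact iff_of_true (cnt_pos_iff.2 hq) h4
          · rw [hd' d hd3 hd4, hmem d hd3]
      · refine hc3.trans ?_
        have : cnt Γ 3 ≤ Nat.card V := Set.ncard_le_card _
        nlinarith [Nat.zero_le (Nat.card X)]
      · by_cases hd3 : d = 3
        · subst hd3
          rw [h0, List.count_eq_zero.2 fun h => h3M (hLmem i 3 h)]
          simp
        · rw [hd' d hd3 (h40 ▸ hd4)]
          have := hd d hd3
          omega
  refine ⟨K₀ * (1 + 2 * Nat.card X), by rw [hK₀]; positivity, fun i => ?_⟩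
  obtain ⟨V, _, G, C, h, hmem, hi, hc, hd⟩ := key i
  have := Fintype.ofFinite V
  rw [Nat.card_eq_fintype_card (α := V)] at hi hc
  refine ⟨V, inferInstance, G, ⟨h.realizes h2M hmem, fun d hd1 => ?_, fun d hd2 => ?_⟩, hi⟩
  · obtain ⟨hdM, hdd₀, hdD₂⟩ := hD₁ d hd1
    have h1 := (hd d hdd₀).2
    rw [hcount, if_pos hdM, if_neg hdD₂, if_neg hdd₀] at h1
    split_ifs at h1 <;> omega
  · obtain ⟨hdM, hdd₀⟩ := hD₂ d hd2
    have h1 := (hd d hdd₀).1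
    rw [hcount, if_pos hdM, if_pos hd2, if_neg hdd₀] at h1
    have h2 : i + 1 ≤ cnt G d := by omega
    calc Fintype.card V ≤ K₀ * (1 + 2 * Nat.card X) * (i + 1) := hc.trans_eq (by ring)
      _ ≤ _ := Nat.mul_le_mul_left _ h2

/-- Strong realizability follows if there are arbitrarily large graphs with the required
frequencies of degrees. -/
lemma isStronglyUhcRealizable_of {M : Finset ℕ} (hM : 2 ≤ M.card)
    (h : ∀ d₀, IsLeast (M : Set ℕ) d₀ → ∀ D₁ D₂ : Finset ℕ, Disjoint D₁ D₂ →
      D₁ ∪ D₂ = M.erase d₀ → ∃ c K, 0 < K ∧ ∀ i, ∃ (V : Type) (_ : Fintype V) (G : SimpleGraph V),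
        (Realizes G M ∧ (∀ d ∈ D₁, cnt G d ≤ c) ∧ ∀ d ∈ D₂, Fintype.card V ≤ K * cnt G d) ∧
          i ≤ Fintype.card V) : IsStronglyUhcRealizable M := by
  refine ⟨hM, fun d₀ hd₀ D₁ D₂ hdis hun => ?_⟩
  obtain ⟨c, K, hK, hi⟩ := h d₀ hd₀ D₁ D₂ hdis hun
  obtain ⟨V, _, G, hG, hiso⟩ := exists_sequence (fun V _ G =>
    Realizes G M ∧ (∀ d ∈ D₁, cnt G d ≤ c) ∧ ∀ d ∈ D₂, Fintype.card V ≤ K * cnt G d) hi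
  have hK' : (0 : ℝ) < K := by exact_mod_cast hK
  refine ⟨c, (K : ℝ)⁻¹, by positivity, V, inferInstance, G, fun i => (hG i).1, hiso,
    fun i d hd => ?_, fun i d hd => ?_⟩
  · rw [card_verticesOfDegree]
    exact (hG i).2.1 d hd
  · rw [card_verticesOfDegree, inv_mul_le_iff₀ hK']
    exact_mod_cast (hG i).2.2 d hd

/-! ### Graphs with vertices of degree two -/

/-- A cycle in which every second vertex has degree two and the other vertices form the graph
`H`. -/
def spaced {m : ℕ} (H : SimpleGraph (Fin (m + 2))) :
    SimpleGraph (Fin (m + 2) ⊕ Fin (m + 2)) where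
  Adj
    | .inl i, .inl j => H.Adj i j
    | .inl i, .inr j => i = j ∨ i = j + 1
    | .inr j, .inl i => i = j ∨ i = j + 1
    | .inr _, .inr _ => False
  symm := ⟨by
    rintro (i | i) (j | j) h
    · exact Adj.symm (G := H) h
    · exact h
    · exact h
    · exact h⟩
  loopless := ⟨by
    rintro (i | i) h
    · exact H.loopless.irrefl _ h
    · exact h⟩

section

variable {m : ℕ} (H : SimpleGraph (Fin (m + 2)))

lemma deg_spaced_inr (j : Fin (m + 2)) : deg (spaced H) (.inr j) = 2 :=
  deg_eq_two (p := .inl j) (q := .inl (j + 1)) (by simp) (by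
    rintro (i | i) <;> simp [spaced])

lemma deg_spaced_inl (i : Fin (m + 2)) : deg (spaced H) (.inl i) = deg H i + 2 := by
  have : (spaced H).neighborSet (.inl i) = Sum.inl '' H.neighborSet i ∪ Sum.inr '' {i, i - 1} := by
    ext (j | j)
    · simp [spaced]
    · simp [spaced, eq_sub_iff_add_eq, eq_comm]
  rw [deg, this, Set.ncard_union_eq (by
    rw [Set.disjoint_left]; rintro _ ⟨v, -, rfl⟩ ⟨z, -, h⟩; cases h) (Set.toFinite _)
    (Set.toFinite _), Set.ncard_image_of_injective _ Sum.inl_injective,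
    Set.ncard_image_of_injective _ Sum.inr_injective, deg, Set.ncard_pair]
  intro h
  have := sub_eq_self.1 h.symm
  simp at this

lemma spaced_bot_le : spaced ⊥ ≤ spaced H := by
  rintro (i | i) (j | j) h
  · exact h.elim
  · exact h
  · exact h
  · exact h

lemma spaced_bot_isHamGraph : IsHamGraph (spaced (m := m) ⊥) := by
  constructor
  · have h1 : ∀ i : Fin (m + 2), (spaced (m := m) ⊥).Reachable (.inr i) (.inl i) := fun i =>
      Adj.reachable (Or.inl rfl)
    have h2 : ∀ i : Fin (m + 2), (spaced (m := m) ⊥).Reachable (.inl 0) (.inl i) := by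
      intro i
      induction i using Fin.induction with
      | zero => exact Reachable.refl _
      | succ i ih =>
        refine (ih.trans (h1 _).symm).trans (Adj.reachable (Or.inr ?_))
        exact (Fin.coeSucc_eq_succ).symm
    have key : ∀ o, (spaced (m := m) ⊥).Reachable (.inl 0) o := by
      rintro (i | i)
      · exact h2 i
      · exact (h2 i).trans (h1 i).symm
    exact fun v w => (key v).symm.trans (key w)
  · rintro (i | i)
    · rw [deg_spaced_inl, deg]
      simp
    · exact deg_spaced_inr _ i

/-- A hamiltonian cycle contains both edges at each vertex of degree two, and these edges already
form the hamiltonian cycle `spaced ⊥`. -/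
lemma spaced_isUniquelyHamiltonian : IsUniquelyHamiltonian (spaced H) := by
  refine isUniquelyHamiltonian_iff.2 ⟨spaced ⊥, spaced_bot_le H, spaced_bot_isHamGraph,
    fun D hD hoff => ?_⟩
  have hH : IsHamGraph D := by
    have hdeg : ∀ v, deg D v = 2 := fun v => (hoff.deg_eq v).resolve_right fun h => h.1
    exact ⟨fun v w => hoff.reachable v w (by rw [hdeg]; norm_num) (by rw [hdeg]; norm_num), hdeg⟩
  refine (hH.eq_of_le spaced_bot_isHamGraph ?_).symm
  have key : ∀ i j, (spaced (m := m) ⊥).Adj (.inr j) (.inl i) → D.Adj (.inr j) (.inl i) := by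
    intro i j h
    refine (adj_iff_of_subset (hH.deg_eq (.inr j)) (p := .inl j) (q := .inl (j + 1)) ?_ _).2
      (h.imp (congrArg _) (congrArg _))
    rintro (k | k) hk
    · exact (hD hk).imp (congrArg _) (congrArg _)
    · exact (hD hk).elim
  rintro (i | i) (j | j) h
  · exact h.elim
  · exact (key i j h).symm
  · exact key j i h
  · exact h.elim

lemma spaced_isKConnected : IsKConnected 2 (spaced H) := by
  refine isKConnected_two (by simp; omega) fun p v w hv hw => ?_
  exact (spaced_bot_isHamGraph.del_reachable p hv hw).mono
    (show del (spaced ⊥) {p} ≤ del (spaced H) {p} from fun _ _ h => ⟨spaced_bot_le H h.1, h.2⟩)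

end

/-- A disjoint union of `mult d` complete graphs with `d - 1` vertices for every `d` in `M`. -/
def cliques (M : Finset ℕ) (mult : ℕ → ℕ) :
    SimpleGraph (Σ d : M, Fin (mult d) × Fin (d - 1)) where
  Adj v w := ∃ d j x y, x ≠ y ∧ v = ⟨d, j, x⟩ ∧ w = ⟨d, j, y⟩
  symm := ⟨fun _ _ ⟨d, j, x, y, h, hv, hw⟩ => ⟨d, j, y, x, h.symm, hw, hv⟩⟩
  loopless := ⟨fun _ ⟨d, j, x, y, h, hv, hw⟩ => h (by simpa using hv.symm.trans hw)⟩

/-- Together with the two cycle edges that `spaced` adds, a vertex of a clique on `d - 1` vertices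
gets degree `d`. -/
lemma deg_cliques (M : Finset ℕ) (mult : ℕ → ℕ) (v : Σ d : M, Fin (mult d) × Fin (d - 1)) :
    deg (cliques M mult) v = v.1 - 2 := by
  obtain ⟨d, j, x⟩ := v
  have hinj : Function.Injective fun y : Fin (d.1 - 1) =>
      (⟨d, j, y⟩ : Σ d : M, Fin (mult d) × Fin (d - 1)) := fun y y' h => by simpa using h
  have : (cliques M mult).neighborSet ⟨d, j, x⟩ =
      (fun y => (⟨d, j, y⟩ : Σ d : M, Fin (mult d) × Fin (d - 1))) '' {x}ᶜ := by
    ext w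
    simp only [mem_neighborSet, Set.mem_image, Set.mem_compl_iff, Set.mem_singleton_iff]
    constructor
    · rintro ⟨d', j', x', y', hne, h, rfl⟩
      obtain ⟨rfl, h⟩ := Sigma.mk.inj_iff.1 h
      obtain ⟨rfl, rfl⟩ := Prod.ext_iff.1 (eq_of_heq h)
      exact ⟨y', hne.symm, rfl⟩
    · rintro ⟨y, hy, rfl⟩
      exact ⟨d, j, x, y, Ne.symm hy, rfl, rfl⟩
  rw [deg, this, Set.ncard_image_of_injective _ hinj, Set.ncard_compl, Set.ncard_singleton,
    Nat.card_fin]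
  dsimp only
  omega

lemma deg_comap_equiv (e : V ≃ W) (H : SimpleGraph W) (v : V) :
    deg (H.comap e) v = deg H (e v) := by
  rw [deg, deg, ← Set.ncard_image_of_injective _ e.injective]
  congr 1
  ext w
  simp [Set.mem_image_equiv]

lemma exists_realizes_two {M D₁ D₂ : Finset ℕ} (h4 : 4 ∈ M) (h2 : IsLeast (M : Set ℕ) 2)
    (hun : D₁ ∪ D₂ = M.erase 2) (hdis : Disjoint D₁ D₂) :
    ∃ c K, 0 < K ∧ ∀ i, ∃ (V : Type) (_ : Fintype V) (G : SimpleGraph V),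
      (Realizes G M ∧ (∀ d ∈ D₁, cnt G d ≤ c) ∧ ∀ d ∈ D₂, Fintype.card V ≤ K * cnt G d) ∧
        i ≤ Fintype.card V := by
  classical
  have hle : ∀ d ∈ M, d ≤ ∑ d ∈ M, d := fun d hd =>
    Finset.single_le_sum (f := fun d => d) (fun _ _ => Nat.zero_le _) hd
  have hD : ∀ d ∈ D₁ ∪ D₂, d ∈ M ∧ 3 ≤ d := fun d hd => by
    have h := Finset.mem_erase.1 (hun ▸ hd)
    have := h2.2 h.2
    have := h.1
    exact ⟨h.2, by omega⟩
  -- A degree in `D₁` occurs `d - 1` times. There are twice as many vertices as clique vertices,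
  -- hence at most `2 * (i + 1) * ∑ d ∈ M, d`, and a degree in `D₂` occurs at least `i + 1` times.
  refine ⟨∑ d ∈ M, d, 2 * ∑ d ∈ M, d, by have := hle 4 h4; omega, fun i => ?_⟩
  -- The degree 2 also gets `i + 1` copies, as single vertices; this makes the graph large for every
  -- choice of `D₁` and `D₂`.
  let mult : ℕ → ℕ := fun d => if d ∈ D₁ then 1 else i + 1
  have hmult : ∀ d, 0 < mult d ∧ mult d ≤ i + 1 := fun d => by
    simp only [mult]; split_ifs <;> omega
  let W := Σ d : M, Fin (mult d) × Fin (d - 1)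
  have hW : Fintype.card W = ∑ d ∈ M, mult d * (d - 1) := by
    simp only [W, Fintype.card_sigma, Fintype.card_prod, Fintype.card_fin]
    exact Finset.sum_coe_sort M fun d => mult d * (d - 1)
  have hWle : Fintype.card W ≤ (i + 1) * ∑ d ∈ M, d := by
    rw [hW, Finset.mul_sum]
    exact Finset.sum_le_sum fun d _ => Nat.mul_le_mul (hmult d).2 (Nat.sub_le _ _)
  have hWge : ∀ d ∈ M, mult d * (d - 1) ≤ Fintype.card W := fun d hd => by
    rw [hW]
    exact Finset.single_le_sum (f := fun d => mult d * (d - 1)) (fun _ _ => Nat.zero_le _) hd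
  obtain ⟨m, hm⟩ : ∃ m, Fintype.card W = m + 2 := by
    have h := hWge 4 h4
    have := (hmult 4).1
    exact ⟨Fintype.card W - 2, by omega⟩
  let e : Fin (m + 2) ≃ W := (Fintype.equivFinOfCardEq hm).symm
  let G := spaced ((cliques M mult).comap e)
  have hdl : ∀ j, deg G (.inl j) = (e j).1 := fun j => by
    have := h2.2 (e j).1.2
    rw [deg_spaced_inl, deg_comap_equiv, deg_cliques]
    omega
  have hdr : ∀ j, deg G (.inr j) = 2 := deg_spaced_inr _
  have hcnt : ∀ d ∈ D₁ ∪ D₂, cnt G d = mult d * (d - 1) := by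
    intro d hd
    obtain ⟨hdM, hd3⟩ := hD d hd
    have hinj : Function.Injective fun y : Fin (mult d) × Fin (d - 1) =>
        (Sum.inl (e.symm ⟨⟨d, hdM⟩, y⟩) : Fin (m + 2) ⊕ Fin (m + 2)) := fun y y' h => by
      have h := e.symm.injective (Sum.inl_injective h)
      exact eq_of_heq (Sigma.mk.inj_iff.1 h).2
    have : {v | deg G v = d} = Set.range fun y : Fin (mult d) × Fin (d - 1) =>
        (Sum.inl (e.symm ⟨⟨d, hdM⟩, y⟩) : Fin (m + 2) ⊕ Fin (m + 2)) := by
      ext (j | j)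
      · simp only [Set.mem_ofPred_eq, hdl, Set.mem_range, Sum.inl.injEq, e.symm_apply_eq]
        constructor
        · intro h
          rcases hej : e j with ⟨⟨d', hd'⟩, y⟩
          rw [hej] at h
          dsimp only at h
          subst h
          exact ⟨y, rfl⟩
        · rintro ⟨y, hy⟩
          rw [← hy]
      · simp only [Set.mem_ofPred_eq, hdr, Set.mem_range, reduceCtorEq, exists_false, iff_false]
        omega
    rw [cnt, this, ← Set.image_univ, Set.ncard_image_of_injective _ hinj, Set.ncard_univ,
      Nat.card_prod, Nat.card_fin, Nat.card_fin]
  have hV : Fintype.card (Fin (m + 2) ⊕ Fin (m + 2)) = 2 * Fintype.card W := by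
    rw [Fintype.card_sum, Fintype.card_fin, hm, two_mul]
  refine ⟨Fin (m + 2) ⊕ Fin (m + 2), inferInstance, G, ⟨⟨?_, spaced_isUniquelyHamiltonian _, ?_⟩,
    fun d hd => ?_, fun d hd => ?_⟩, ?_⟩
  · ext d
    rw [mem_degreeSet_iff, cnt_pos_iff]
    constructor
    · rintro ⟨j | j, rfl⟩
      · rw [hdl]; exact (e j).1.2
      · rw [hdr]; exact h2.1
    · intro hd
      by_cases hd2 : d = 2
      · subst hd2
        exact ⟨.inr 0, hdr 0⟩
      · have hd' : d ∈ D₁ ∪ D₂ := hun ▸ Finset.mem_erase.2 ⟨hd2, hd⟩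
        rw [← cnt_pos_iff, hcnt d hd']
        have := (hD d hd').2
        exact Nat.mul_pos (hmult d).1 (by omega)
  · rw [if_pos (show 2 ∈ M from h2.1)]
    exact spaced_isKConnected _
  · have hd' := Finset.mem_union_left D₂ hd
    rw [hcnt d hd']
    have := hle d (hD d hd').1
    simp only [mult, if_pos hd]
    omega
  · have hd' := Finset.mem_union_right D₁ hd
    have hd3 := (hD d hd').2
    have : i + 1 ≤ cnt G d := by
      rw [hcnt d hd']
      simp only [mult, if_neg (Finset.disjoint_right.1 hdis hd)]
      exact Nat.le_mul_of_pos_right _ (by omega)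
    calc _ = 2 * Fintype.card W := hV
      _ ≤ 2 * ((i + 1) * ∑ d ∈ M, d) := Nat.mul_le_mul_left _ hWle
      _ = (2 * ∑ d ∈ M, d) * (i + 1) := by ring
      _ ≤ _ := Nat.mul_le_mul_left _ this
  · have h := hWge 2 h2.1
    have h2' : 2 ∉ D₁ := fun h => by
      have := (hD 2 (Finset.mem_union_left _ h)).2
      omega
    simp only [mult, if_neg h2'] at h
    omega

/-! ### From a 4-regular graph to a seed -/

lemma deg_sup_edge [Finite V] {D : SimpleGraph V} {s t : V} (hst : s ≠ t) (h : ¬ D.Adj s t)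
    (v : V) : deg (D ⊔ edge s t) v = deg (addVertex D {s, t}) (some v) := by
  have key : ∀ {v w : V}, v ≠ w → ¬ D.Adj v w → (∀ y, (D ⊔ edge s t).Adj v y ↔ D.Adj v y ∨ y = w) →
      deg (D ⊔ edge s t) v = deg D v + 1 := by
    intro v w hvw hD hadj
    rw [deg, deg, ← Set.ncard_insert_of_notMem (s := D.neighborSet v) (a := w) hD (Set.toFinite _)]
    congr 1
    ext y
    rw [mem_neighborSet, hadj, Set.mem_insert_iff, mem_neighborSet, or_comm]
  by_cases hs : v = s
  · subst hs
    rw [deg_addVertex_of_mem (by simp), key hst h fun y => by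
      rw [sup_adj, edge_adj]; grind]
  by_cases ht : v = t
  · subst ht
    rw [deg_addVertex_of_mem (by simp), key hst.symm (fun h' => h h'.symm) fun y => by
      rw [sup_adj, edge_adj]; grind]
  rw [deg_addVertex_of_notMem (by simp [hs, ht]), deg, deg]
  congr 1
  ext y
  simp [edge_adj, hs, ht]

/-- The left graph is the right one with the edge between `s` and `t` subdivided by the new vertex.
-/
lemma isHamGraph_addVertex_iff [Finite V] {D : SimpleGraph V} {s t : V} (hst : s ≠ t)
    (h : ¬ D.Adj s t) : IsHamGraph (addVertex D {s, t}) ↔ IsHamGraph (D ⊔ edge s t) := by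
  have hedge : (D ⊔ edge s t).Adj s t := Or.inr (by simp [edge_adj, hst])
  constructor
  · intro hQ
    refine ⟨fun v w => ?_, fun v => (deg_sup_edge hst h v).trans (hQ.deg_eq _)⟩
    refine reachable_map (fun o => o.getD s) ?_ (hQ.reachable (some v) (some w))
    have h0 : ∀ x ∈ ({s, t} : Set V), (D ⊔ edge s t).Reachable s x := by
      rintro x (rfl | rfl)
      · exact Reachable.refl _
      · exact hedge.reachable
    rintro (_ | a) (_ | b) hab
    · exact Reachable.refl _
    · exact h0 b hab
    · exact (h0 a hab).symm
    · exact Adj.reachable (Or.inl hab)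
  · intro hD
    have hs : (addVertex D {s, t}).Adj none (some s) := Or.inl rfl
    have ht : (addVertex D {s, t}).Adj none (some t) := Or.inr rfl
    have key : ∀ v w, (addVertex D {s, t}).Reachable (some v) (some w) := fun v w => by
      refine reachable_map some (fun a b hab => ?_) (hD.reachable v w)
      rcases hab with hab | hab
      · exact Adj.reachable (G := addVertex D {s, t}) hab
      · rw [edge_adj] at hab
        rcases hab.1 with ⟨rfl, rfl⟩ | ⟨rfl, rfl⟩
        · exact hs.symm.reachable.trans ht.reachable
        · exact ht.symm.reachable.trans hs.reachable
    have key' : ∀ o, (addVertex D {s, t}).Reachable o (some s) := by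
      rintro (_ | v)
      · exact hs.reachable
      · exact key v s
    refine ⟨fun v w => (key' v).trans (key' w).symm, ?_⟩
    rintro (_ | v)
    · rw [deg_addVertex_none, Set.ncard_pair hst]
    · rw [← deg_sup_edge hst h, hD.deg_eq]

/-- The hamiltonian cycles through an edge correspond to the hamiltonian paths between its ends. -/
lemma existsUnique_hamiltonian_path [Finite V] [DecidableEq V] {H C : SimpleGraph V} {s t x : V}
    (hC : IsUnique H ∅ C) (hst : C.Adj s t) (htx : ¬ C.Adj t x) :
    ∃! p : (H.deleteEdges {s(s, t), s(t, x)}).Walk s t, p.IsHamiltonian := by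
  have hne := hst.ne
  set G := H.deleteEdges {s(s, t), s(t, x)} with hG
  have hGst : ¬ G.Adj s t := by simp [hG]
  -- A hamiltonian path from `s` to `t` becomes a hamiltonian cycle of `H` when the deleted edge
  -- `st` is restored, hence it is `C` without `st`.
  have heq : ∀ D ≤ G, IsHamGraph (addVertex D {s, t}) → D = C.deleteEdges {s(s, t)} := by
    intro D hD hH
    have hDst : ¬ D.Adj s t := fun h => hGst (hD h)
    have h1 := hC.eq_of_le (D ⊔ edge s t) (sup_le (hD.trans (deleteEdges_le _))
      ((edge_le_iff _).2 (Or.inr (hC.le hst))))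
      (((isHamGraph_addVertex_iff hne hDst).1 hH).isCycleOff ∅)
    rw [← h1]
    ext v w
    simp only [deleteEdges_adj, sup_adj, edge_adj, Set.mem_singleton_iff, Sym2.eq_iff]
    constructor
    · intro h
      refine ⟨Or.inl h, ?_⟩
      rintro (⟨rfl, rfl⟩ | ⟨rfl, rfl⟩)
      · exact hDst h
      · exact hDst h.symm
    · rintro ⟨h | h, h'⟩
      · exact h
      · exact absurd h.1 h'
  have hC' : C.deleteEdges {s(s, t)} ⊔ edge s t = C := by
    ext v w
    simp only [deleteEdges_adj, sup_adj, edge_adj, Set.mem_singleton_iff, Sym2.eq_iff]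
    constructor
    · rintro (h | ⟨⟨rfl, rfl⟩ | ⟨rfl, rfl⟩, -⟩)
      · exact h.1
      · exact hst
      · exact hst.symm
    · intro h
      have := h.ne
      tauto
  -- That `tx` is not an edge of `C` is what lets the path survive its deletion.
  have hle : C.deleteEdges {s(s, t)} ≤ G := by
    intro v w h
    simp only [deleteEdges_adj, Set.mem_singleton_iff, hG, Set.mem_insert_iff] at h ⊢
    refine ⟨hC.le h.1, ?_⟩
    rintro (h' | h')
    · exact h.2 h'
    · rcases Sym2.eq_iff.1 h' with ⟨rfl, rfl⟩ | ⟨rfl, rfl⟩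
      · exact htx h.1
      · exact htx h.1.symm
  have hQ : IsHamGraph (addVertex (C.deleteEdges {s(s, t)}) {s, t}) := by
    rw [isHamGraph_addVertex_iff hne (by simp), hC']
    exact hC.ham
  obtain ⟨p, hp, hps, hpe⟩ := exists_isPath_of_isHamGraph hne hQ
    (addVertex_mono hle subset_rfl)
  refine ⟨p, (Walk.IsPath.isHamiltonian_iff hp).2 hps, fun q hq => ?_⟩
  have hqH := isHamGraph_closeWalk hne hq.isPath hq.mem_support
  have hqle := (closeWalk q).toSubgraph.spanningCoe_le
  have hqe := eq_addVertex (hqH.deg_eq none) hqle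
  have h1 := heq ((closeWalk q).toSubgraph.spanningCoe.comap some)
    (fun v w h => hqle (v := some v) (w := some w) h) (hqe ▸ hqH)
  refine isPath_eq_of_edges hq.isPath hp fun e => ?_
  induction e with
  | _ v w =>
    rw [← hpe, addVertex_some_some, ← h1, ← mem_edges_closeWalk, ← Walk.mem_edges_toSubgraph]
    rfl

lemma robust_of_ne [Fintype V] {G : SimpleGraph V} (hc : 3 < Fintype.card V)
    (h : ∀ p q v w, p ≠ q → v ≠ p → v ≠ q → w ≠ p → w ≠ q → (del G {p, q}).Reachable v w) :
    Robust G := by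
  classical
  intro p q v w hvp hvq hwp hwq
  by_cases hpq : p = q
  · subst hpq
    obtain ⟨q, hq⟩ : ∃ q, q ∉ ({p, v, w} : Finset V) := by
      by_contra! hc'
      have := Finset.card_le_card (fun v _ => hc' v : Finset.univ ⊆ {p, v, w})
      rw [Finset.card_univ] at this
      have := Finset.card_le_three (a := p) (b := v) (c := w)
      omega
    simp only [Finset.mem_insert, Finset.mem_singleton, not_or] at hq
    exact del_mono (by simp) (h p q v w (Ne.symm hq.1) hvp (Ne.symm hq.2.1) hwp (Ne.symm hq.2.2))
  · exact h p q v w hpq hvp hvq hwp hwq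

/-- Subdividing two edges at a vertex of degree at least four and joining the two new vertices
keeps a graph robust. -/
lemma Robust.subdivide [Fintype V] {H : SimpleGraph V} (hH : Robust H)
    (hdeg : ∀ v, deg H v = 4) {s t x : V} (hst : s ≠ t) (hsx : s ≠ x) (htx : t ≠ x) :
    Robust (addVertex (addVertex (H.deleteEdges {s(s, t), s(t, x)}) {t, x})
      {none, some s, some t}) := by
  classical
  set G := H.deleteEdges {s(s, t), s(t, x)} with hG
  set W := addVertex (addVertex G {t, x}) {none, some s, some t} with hW
  let f : V → Option (Option V) := fun v => some (some v)
  have hf : Function.Injective f := fun v w h => Option.some_injective _ (Option.some_injective _ h)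
  have hGadj : ∀ v w, G.Adj v w ↔ H.Adj v w ∧ s(v, w) ≠ s(s, t) ∧ s(v, w) ≠ s(t, x) := by
    intro v w
    simp [hG]
  have e0 : W.Adj none (some none) := Or.inl rfl
  have es : W.Adj none (f s) := Or.inr (Or.inl rfl)
  have et : W.Adj none (f t) := Or.inr (Or.inr rfl)
  have et' : W.Adj (some none) (f t) := Or.inl rfl
  have ex : W.Adj (some none) (f x) := Or.inr rfl
  -- `none` subdivides `st` and `some none` subdivides `tx`. A walk of `H` lifts to `W` by detours
  -- through these vertices, provided that the subdividing vertex survives or the walk avoids an end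
  -- of the subdivided edge.
  have lift : ∀ (S : Set (Option (Option V))) (T : Set V), (∀ y, f y ∈ S → y ∈ T) →
      (none ∉ S ∨ s ∈ T ∨ t ∈ T) → (some none ∉ S ∨ t ∈ T ∨ x ∈ T) →
      ∀ {y z}, (del H T).Reachable y z → (del W S).Reachable (f y) (f z) := by
    intro S T hS h1 h2 y z hr
    refine reachable_map f (fun a b hab => ?_) hr
    have ha : f a ∉ S := fun h => hab.2.1 (hS a h)
    have hb : f b ∉ S := fun h => hab.2.2 (hS b h)
    by_cases h3 : s(a, b) = s(s, t)
    · have hn : none ∉ S := by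
        refine h1.resolve_right ?_
        rcases Sym2.eq_iff.1 h3 with ⟨rfl, rfl⟩ | ⟨rfl, rfl⟩
        · exact not_or.2 ⟨hab.2.1, hab.2.2⟩
        · exact not_or.2 ⟨hab.2.2, hab.2.1⟩
      rcases Sym2.eq_iff.1 h3 with ⟨rfl, rfl⟩ | ⟨rfl, rfl⟩
      · exact (Adj.reachable (G := del W S) ⟨es.symm, ha, hn⟩).trans (Adj.reachable ⟨et, hn, hb⟩)
      · exact (Adj.reachable (G := del W S) ⟨et.symm, ha, hn⟩).trans (Adj.reachable ⟨es, hn, hb⟩)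
    by_cases h4 : s(a, b) = s(t, x)
    · have hn : some none ∉ S := by
        refine h2.resolve_right ?_
        rcases Sym2.eq_iff.1 h4 with ⟨rfl, rfl⟩ | ⟨rfl, rfl⟩
        · exact not_or.2 ⟨hab.2.1, hab.2.2⟩
        · exact not_or.2 ⟨hab.2.2, hab.2.1⟩
      rcases Sym2.eq_iff.1 h4 with ⟨rfl, rfl⟩ | ⟨rfl, rfl⟩
      · exact (Adj.reachable (G := del W S) ⟨et'.symm, ha, hn⟩).trans (Adj.reachable ⟨ex, hn, hb⟩)
      · exact (Adj.reachable (G := del W S) ⟨ex.symm, ha, hn⟩).trans (Adj.reachable ⟨et', hn, hb⟩)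
    · exact Adj.reachable ⟨(hGadj a b).2 ⟨hab.1, h3, h4⟩, ha, hb⟩
  have nbr : ∀ u (A : Finset V), A.card ≤ 3 → ∃ w, H.Adj u w ∧ w ∉ A := by
    intro u A hA
    by_contra! hc
    have h1 := Set.ncard_le_ncard (s := H.neighborSet u) (t := A) hc (Set.toFinite _)
    rw [Set.ncard_coe_finset, ← deg, hdeg] at h1
    omega
  have hcardV : 3 < Fintype.card V := by
    have h1 := Set.ncard_le_card (H.neighborSet t)
    rw [← deg, hdeg, Nat.card_eq_fintype_card] at h1
    exact h1
  have fresh : ∀ A : Finset V, A.card ≤ 3 → ∃ r, r ∉ A := by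
    intro A hA
    by_contra! hc
    have := Finset.card_le_card (fun v _ => hc v : Finset.univ ⊆ A)
    rw [Finset.card_univ] at this
    omega
  have old : ∀ p q : V, ∃ r, ∀ w, w ≠ f p → w ≠ f q → (del W {f p, f q}).Reachable w r := by
    intro p q
    have hold : ∀ v w, v ≠ p → v ≠ q → w ≠ p → w ≠ q →
        (del W {f p, f q}).Reachable (f v) (f w) := fun v w h1 h2 h3 h4 => by
      refine lift _ {p, q} ?_ (Or.inl (by simp [f])) (Or.inl (by simp [f])) (hH p q v w h1 h2 h3 h4)
      rintro y (hy | hy)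
      · exact Or.inl (hf hy)
      · exact Or.inr (hf hy)
    obtain ⟨r, hr⟩ := fresh {p, q} (Finset.card_le_two.trans (by norm_num))
    simp only [Finset.mem_insert, Finset.mem_singleton, not_or] at hr
    have step : ∀ {v w}, W.Adj v w → v ∉ ({f p, f q} : Set _) → w ∉ ({f p, f q} : Set _) →
        (del W {f p, f q}).Reachable v w := fun h1 h2 h3 => Adj.reachable ⟨h1, h2, h3⟩
    have hn : none ∉ ({f p, f q} : Set (Option (Option V))) := by simp [f]
    have hn' : some none ∉ ({f p, f q} : Set (Option (Option V))) := by simp [f]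
    have hmem : ∀ v, v ≠ p → v ≠ q → f v ∉ ({f p, f q} : Set (Option (Option V))) := by
      intro v h1 h2
      simp [f, h1, h2]
    have hnone : (del W {f p, f q}).Reachable none (f r) := by
      by_cases h : s ≠ p ∧ s ≠ q
      · exact (step es hn (hmem s h.1 h.2)).trans (hold s r h.1 h.2 hr.1 hr.2)
      by_cases h' : t ≠ p ∧ t ≠ q
      · exact (step et hn (hmem t h'.1 h'.2)).trans (hold t r h'.1 h'.2 hr.1 hr.2)
      have hx : x ≠ p ∧ x ≠ q := by grind
      exact ((step e0 hn hn').trans (step ex hn' (hmem x hx.1 hx.2))).trans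
        (hold x r hx.1 hx.2 hr.1 hr.2)
    refine ⟨f r, ?_⟩
    rintro (_ | _ | w) h1 h2
    · exact hnone
    · exact (step e0 hn hn').symm.trans hnone
    · exact hold w r (fun h => h1 (congrArg f h)) (fun h => h2 (congrArg f h)) hr.1 hr.2
  -- A subdividing vertex `n` and an old vertex `q` are deleted, and `a` is the end other than `t`
  -- of the edge subdivided by `n`. Deleting `q` and `a` keeps `H` connected and makes the missing
  -- edge irrelevant; then `a` and the other subdividing vertex `n'` are attached again.
  have mixed : ∀ (n n' : Option (Option V)) (a b : V) (q : V), n ≠ n' → (∀ v, n ≠ f v) →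
      (∀ v, n' ≠ f v) → (∀ w, (∀ v, w ≠ f v) → w = n ∨ w = n') →
      (∃ c, W.Adj n' (f t) ∧ W.Adj n' (f c) ∧ c ≠ t) → a ≠ b →
      (∀ w, H.Adj a w → w ≠ b → G.Adj a w) → (n = none → a = s) → (n = some none → a = x) →
      ∃ r, ∀ w, w ≠ n → w ≠ f q → (del W {n, f q}).Reachable w r := by
    intro n n' a b q hnn hn hn' hall hc hab hGa hs hx
    obtain ⟨r, hr⟩ := fresh {q, a} (Finset.card_le_two.trans (by norm_num))
    simp only [Finset.mem_insert, Finset.mem_singleton, not_or] at hr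
    have hold : ∀ v w, v ≠ q → v ≠ a → w ≠ q → w ≠ a →
        (del W {n, f q}).Reachable (f v) (f w) := fun v w h1 h2 h3 h4 => by
      refine lift _ {q, a} ?_ ?_ ?_ (hH q a v w h1 h2 h3 h4)
      · rintro y (hy | hy)
        · exact absurd hy.symm (hn y)
        · exact Or.inl (hf hy)
      · by_cases h : n = none
        · exact Or.inr (Or.inl (Or.inr (hs h).symm))
        · exact Or.inl (by simp [f, Ne.symm h])
      · by_cases h : n = some none
        · exact Or.inr (Or.inr (Or.inr (hx h).symm))
        · exact Or.inl (by simp [f, Ne.symm h])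
    have hmem : ∀ v, v ≠ q → f v ∉ ({n, f q} : Set (Option (Option V))) := by
      rintro v h1 (h | h)
      · exact hn v h.symm
      · exact h1 (hf h)
    have hold' : ∀ v, v ≠ q → (del W {n, f q}).Reachable (f v) (f r) := by
      intro v hv
      by_cases hva : v = a
      · subst hva
        -- Degree four leaves `a` a neighbour besides `q` and the other end `b` of the subdivided
        -- edge.
        obtain ⟨w, hw, hw'⟩ := nbr v {b, q} (Finset.card_le_two.trans (by norm_num))
        simp only [Finset.mem_insert, Finset.mem_singleton, not_or] at hw'
        have hvw : W.Adj (f v) (f w) := hGa w hw hw'.1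
        exact (Adj.reachable (G := del W {n, f q}) ⟨hvw, hmem v hv, hmem w hw'.2⟩).trans
          (hold w r hw'.2 hw.ne' hr.1 hr.2)
      · exact hold v r hv hva hr.1 hr.2
    refine ⟨f r, fun w h1 h2 => ?_⟩
    by_cases hw : ∃ v, w = f v
    · obtain ⟨v, rfl⟩ := hw
      exact hold' v fun h => h2 (congrArg f h)
    · push Not at hw
      obtain rfl := (hall w hw).resolve_left h1
      obtain ⟨c, h3, h4, h5⟩ := hc
      have hmem' : w ∉ ({n, f q} : Set (Option (Option V))) := by
        rintro (h | h)
        · exact h1 h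
        · exact h2 h
      by_cases htq : t = q
      · exact (Adj.reachable (G := del W {n, f q}) ⟨h4, hmem', hmem c (htq ▸ h5)⟩).trans
          (hold' c (htq ▸ h5))
      · exact (Adj.reachable (G := del W {n, f q}) ⟨h3, hmem', hmem t htq⟩).trans (hold' t htq)
  have left : ∀ q, ∃ r, ∀ w, w ≠ none → w ≠ f q → (del W {none, f q}).Reachable w r := by
    intro q
    refine mixed none (some none) s t q (by simp) (by simp [f]) (by simp [f]) ?_
      ⟨x, et', ex, htx.symm⟩ hst (fun w hw hwt => (hGadj _ _).2 ⟨hw, ?_, ?_⟩) (fun _ => rfl)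
      (by simp)
    · rintro (_ | _ | w) hw
      · exact Or.inl rfl
      · exact Or.inr rfl
      · exact absurd rfl (hw w)
    · rw [Ne, Sym2.eq_iff]; grind
    · rw [Ne, Sym2.eq_iff]; grind
  have right : ∀ q, ∃ r, ∀ w, w ≠ some none → w ≠ f q →
      (del W {some none, f q}).Reachable w r := by
    intro q
    refine mixed (some none) none x t q (by simp) (by simp [f]) (by simp [f]) ?_
      ⟨s, et, es, hst⟩ htx.symm (fun w hw hwt => (hGadj _ _).2 ⟨hw, ?_, ?_⟩) (by simp)
      (fun _ => rfl)
    · rintro (_ | _ | w) hw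
      · exact Or.inr rfl
      · exact Or.inl rfl
      · exact absurd rfl (hw w)
    · rw [Ne, Sym2.eq_iff]; grind
    · rw [Ne, Sym2.eq_iff]; grind
  have both : ∃ r, ∀ w, w ≠ none → w ≠ some none → (del W {none, some none}).Reachable w r := by
    -- Without the two subdividing vertices both edges `st` and `tx` are lost. The rest of `H` is
    -- connected without `t`, and `t` is attached through another neighbour.
    obtain ⟨y, hy, hy'⟩ := nbr t {s, x} (Finset.card_le_two.trans (by norm_num))
    simp only [Finset.mem_insert, Finset.mem_singleton, not_or] at hy'
    have hmem : ∀ v, f v ∉ ({none, some none} : Set (Option (Option V))) := by simp [f]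
    refine ⟨f y, ?_⟩
    rintro (_ | _ | w) h1 h2
    · exact absurd rfl h1
    · exact absurd rfl h2
    · by_cases hw : w = t
      · subst hw
        have : W.Adj (f w) (f y) := (hGadj _ _).2 ⟨hy, by rw [Ne, Sym2.eq_iff]; grind,
          by rw [Ne, Sym2.eq_iff]; grind⟩
        exact Adj.reachable ⟨this, hmem _, hmem _⟩
      · refine lift _ {t} (fun v hv => absurd hv (hmem v)) (by simp) (by simp)
          (del_mono (by simp) (hH t t w y hw hw hy.ne' hy.ne'))
  have main : ∀ p q, p ≠ q → ∃ r, ∀ w, w ≠ p → w ≠ q → (del W {p, q}).Reachable w r := by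
    have swap : ∀ {p q}, (∃ r, ∀ w, w ≠ p → w ≠ q → (del W {p, q}).Reachable w r) →
        ∃ r, ∀ w, w ≠ q → w ≠ p → (del W {q, p}).Reachable w r := by
      rintro p q ⟨r, hr⟩
      refine ⟨r, fun w h1 h2 => ?_⟩
      rw [Set.pair_comm]
      exact hr w h2 h1
    rintro (_ | _ | p) (_ | _ | q) hpq
    · exact absurd rfl hpq
    · exact both
    · exact left q
    · exact swap both
    · exact absurd rfl hpq
    · exact right q
    · exact swap (left p)
    · exact swap (right p)
    · exact old p q
  refine robust_of_ne (by rw [Fintype.card_option, Fintype.card_option]; omega) ?_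
  intro p q v w hpq h1 h2 h3 h4
  obtain ⟨r, hr⟩ := main p q hpq
  exact (hr v h1 h2).trans (hr w h3 h4).symm

lemma deg_deleteEdges_of_adj [Finite V] {H : SimpleGraph V} {E : Set (Sym2 V)} {v w : V}
    (hvw : H.Adj v w) (hE : ∀ y, s(v, y) ∈ E ↔ y = w) : deg (H.deleteEdges E) v + 1 = deg H v := by
  rw [deg, deg, ← Set.ncard_sdiff_singleton_add_one (s := H.neighborSet v) (a := w) hvw]
  congr 2
  ext y
  simp [hE]

/-- At any vertex `t`, the deleted edges are `st` on the hamiltonian cycle and `tx` off it. The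
degrees of `s`, `t`, `x` drop to 3, 2, 3, so the set joined to `v` is `{t, x}`, and adding `v` and
`v'` amounts to subdividing the two edges and joining the new vertices. -/
theorem exists_isSeed [Fintype V] {H : SimpleGraph V} (h : IsThreeConnectedUH4Regular H) :
    ∃ s t, ∃ G : SimpleGraph V, IsSeed 4 G s t := by
  classical
  obtain ⟨hconn, hun, hreg⟩ := h
  obtain ⟨hcard, hrob⟩ := isKConnected_three_iff.1 hconn
  have : Nonempty V := Fintype.card_pos_iff.1 (by omega)
  have hH : ∀ v, deg H v = 4 := fun v => by
    rw [← degree_eq_deg]; convert hreg v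
  obtain ⟨C, hC⟩ := isUniquelyHamiltonian_iff.1 hun
  obtain ⟨t⟩ := ‹Nonempty V›
  obtain ⟨s, s', hss, hCt⟩ := deg_eq_two_iff.1 (hC.ham.deg_eq t)
  have hts : C.Adj t s := (hCt s).2 (Or.inl rfl)
  obtain ⟨x, hHx, hCx⟩ : ∃ x, H.Adj t x ∧ ¬ C.Adj t x := by
    by_contra! hc
    have h1 := Set.ncard_le_ncard (s := H.neighborSet t) (t := C.neighborSet t) hc (Set.toFinite _)
    rw [← deg, ← deg, hH, hC.ham.deg_eq] at h1
    omega
  have hst : s ≠ t := hts.ne'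
  have htx : t ≠ x := hHx.ne
  have hsx : s ≠ x := by
    rintro rfl
    exact hCx hts
  obtain ⟨G, hG⟩ : ∃ G, G = H.deleteEdges {s(s, t), s(t, x)} := ⟨_, rfl⟩
  have hds : deg G s = 3 := by
    have := deg_deleteEdges_of_adj (H := H) (E := {s(s, t), s(t, x)}) (hC.le hts.symm)
      fun y => by simp only [Set.mem_insert_iff, Set.mem_singleton_iff, Sym2.eq_iff]; grind
    rw [hH, ← hG] at this
    omega
  have hdx : deg G x = 3 := by
    have := deg_deleteEdges_of_adj (H := H) (E := {s(s, t), s(t, x)}) hHx.symm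
      fun y => by simp only [Set.mem_insert_iff, Set.mem_singleton_iff, Sym2.eq_iff]; grind
    rw [hH, ← hG] at this
    omega
  have hdt : deg G t = 2 := by
    have h1 : G.neighborSet t = H.neighborSet t \ {s, x} := by
      ext y
      simp only [hG, mem_neighborSet, deleteEdges_adj, Set.mem_insert_iff, Set.mem_singleton_iff,
        Sym2.eq_iff, Set.mem_sdiff]
      grind
    have h2 := Set.ncard_sdiff_add_ncard_of_subset (s := {s, x}) (t := H.neighborSet t) (by
      rintro y (rfl | rfl)
      · exact hC.le hts
      · exact hHx)
    rw [← h1, ← deg, ← deg, hH, Set.ncard_pair hsx] at h2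
    omega
  have hd : ∀ v, v ≠ s → v ≠ t → v ≠ x → deg G v = 4 := by
    intro v h1 h2 h3
    rw [← hH v, deg, deg]
    congr 1
    ext y
    simp only [hG, mem_neighborSet, deleteEdges_adj, Set.mem_insert_iff, Set.mem_singleton_iff,
      Sym2.eq_iff]
    grind
  have hd4 : ∀ v, deg G v ≤ 4 := fun v => by
    by_cases h1 : v = s
    · subst h1; omega
    by_cases h2 : v = t
    · subst h2; omega
    by_cases h3 : v = x
    · subst h3; omega
    exact (hd v h1 h2 h3).le
  have hd3 : ∀ v, deg G v = 3 ↔ v = s ∨ v = x := by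
    intro v
    constructor
    · intro h
      by_contra! hc
      by_cases hv : v = t
      · subst hv; omega
      · have := hd v hc.1 hv hc.2
        omega
    · rintro (rfl | rfl) <;> assumption
  have hset : seedExtension G s t = addVertex G {t, x} := by
    rw [seedExtension]
    congr 1
    ext w
    simp only [degree_eq_deg, hd3, Set.mem_ofPred_eq, Set.mem_insert_iff, Set.mem_singleton_iff]
    grind
  refine ⟨s, t, G, ?_, le_rfl, ?_, ?_, fun v => ?_, ?_, ?_⟩
  · obtain ⟨v, hv⟩ : ∃ v, v ∉ ({s, t, x} : Finset V) := by
      by_contra! hc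
      have := Finset.card_le_card (fun v _ => hc v : Finset.univ ⊆ {s, t, x})
      rw [Finset.card_univ] at this
      have := Finset.card_le_three (a := s) (b := t) (c := x)
      omega
    simp only [Finset.mem_insert, Finset.mem_singleton, not_or] at hv
    refine le_antisymm (maxDegree_le_of_forall_degree_le _ _ fun v => ?_) ?_
    · rw [degree_eq_deg]; exact hd4 v
    · rw [← hd v hv.1 hv.2.1 hv.2.2, ← degree_eq_deg]
      exact G.degree_le_maxDegree v
  · rw [card_verticesOfDegree, cnt, show {v | deg G v = 3} = {s, x} by ext v; simp [hd3],
      Set.ncard_pair hsx]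
  · rw [degree_eq_deg]; exact hds
  · rw [degree_eq_deg]
    constructor
    · intro h
      by_contra hv
      have h1 : v ≠ s := by rintro rfl; omega
      have h2 : v ≠ x := by rintro rfl; omega
      have := hd v h1 hv h2
      omega
    · rintro rfl; exact hdt
  · subst hG
    convert existsUnique_hamiltonian_path hC hts.symm hCx
  · rw [hset]
    exact isKConnected_three_iff.2 ⟨by rw [Fintype.card_option, Fintype.card_option]; omega,
      hG ▸ hrob.subdivide hH hst hsx htx⟩

end UniqHam

theorem corollary3p9 :
    ((∃ (V : Type) (_ : Fintype V) (G : SimpleGraph V), IsThreeConnectedUH4Regular G) ↔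
      ExistsSeed 4) ∧
    (ExistsSeed 4 →
      (∃ (V : ℕ → Type) (_ : ∀ i, Fintype (V i)) (G : ∀ i, SimpleGraph (V i)),
        (∀ i, IsThreeConnectedUH4Regular (G i)) ∧ (∀ i j, i ≠ j → IsEmpty (G i ≃g G j))) ∧
      (∀ M : Finset ℕ, (∀ d ∈ M, 2 ≤ d) → 4 ∈ M → 2 ≤ M.card →
        IsStronglyUhcRealizable M)) := by
  refine ⟨⟨fun ⟨V, _, H, h⟩ => ?_, fun ⟨V, _, S, s, t, h⟩ => ?_⟩, fun ⟨V, _, S, s, t, h⟩ =>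
    ⟨?_, fun M hM h4 hcard => ?_⟩⟩
  · obtain ⟨s, t, G, hG⟩ := UniqHam.exists_isSeed h
    exact ⟨V, inferInstance, G, s, t, hG⟩
  · obtain ⟨x, hS⟩ := UniqHam.IsSeed.exists_isSeedPole h
    obtain ⟨W, i, G, hG, -⟩ := UniqHam.exists_four_regular hS 0
    exact ⟨W, i, G, hG⟩
  · obtain ⟨x, hS⟩ := UniqHam.IsSeed.exists_isSeedPole h
    exact UniqHam.exists_sequence (fun V _ G => IsThreeConnectedUH4Regular G)
      (UniqHam.exists_four_regular hS)
  · obtain ⟨x, hS⟩ := UniqHam.IsSeed.exists_isSeedPole h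
    refine UniqHam.isStronglyUhcRealizable_of hcard fun d₀ hd₀ D₁ D₂ hdis hun => ?_
    by_cases h2 : d₀ = 2
    · subst h2
      exact UniqHam.exists_realizes_two h4 hd₀ hun hdis
    · have h3 : 3 ≤ d₀ := by
        have := hM d₀ hd₀.1
        omega
      obtain ⟨K, hK⟩ := UniqHam.exists_realizes hS h4 hd₀ h3 hdis hun
      exact ⟨28, K, hK⟩
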